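/- **Setting.** Let $n\ge 1$, $N=n(n+1)/2$, let $s_1,\dots,s_n$ be the simple transpositions of $S_{n+1}$ and $\omega_0$ its longest element. Let $\overline{\omega_0}=s_{i_1}\cdots s_{i_N}$ be a reduced decomposition. Its string diagram has $n+1$ strings $U_1,\dots,U_{n+1}$, numbered from left to right at the top; going down, the $q$-th crossing $t_q$ exchanges the strings in columns $i_q$ and $i_q+1$. Let $b_u$ be the lower end of $U_u$. *String inequalities.* For $1\le k\le n$ orient $U_1,\dots,U_k$ upward and the other strings downward. A rigorous path is an oriented path from $b_k$ to $b_{k+1}$ that meets no vertex twice and never goes straight through a crossing of two strings, either to the upper left when both are oriented upward, or to the lower left when both are oriented downward. It defines the inequality $\sum_q c_q x_q\ge 0$, where $c_q=1$ (resp. $-1$) if the path switches at $t_q$ from $U_u$ to $U_v$ with $u<v$ (resp. $u>v$), and $c_q=0$ otherwise; we write it as $\sum_q m_qx_q\le 0$ with $m=-c$. *$\lambda$-inequalities.* For each $q$, $\lambda_q$ is the inequality $x_q-\sum_{r>q}c_rx_r\le 2$ with $c_r=-2$ if $i_r=i_q$, $c_r=1$ if $|i_r-i_q|=1$, and $c_r=0$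 otherwise. Let $d$ run over the set of all string inequalities and $\lambda$-inequalities, let $M_d\in\mathbb Z^N$ be the coefficient vector of the left-hand side of $d$, and let $T^{M_d}$ be the corresponding Laurent monomial in $t_1,\dots,t_N$. For a vector $a=(a_d)$ of invertible coefficients put $f_{\overline{\omega_0},a}=1-\sum_d a_dT^{M_d}$, and let $Z_{\overline{\omega_0},a}$ be the hypersurface $f_{\overline{\omega_0},a}=0$ in the torus $T=\operatorname{Spec}\mathbb C[t_1^{\pm1},\dots,t_N^{\pm1}]$. *Parameter space and family.* A box of the diagram is bounded above and below by two consecutive crossings $t_{\rm top},t_{\rm bot}$ of one column. Whenever string inequalities $p_1,p_2$ and a box satisfy $T^{p_1}T^{\lambda_{\rm top}}=T^{p_2}T^{\lambda_{\rm bot}}$, $\deg_{t_{\rm top}}T^{p_1}=-1$ and $\deg_{t_{\rm bot}}T^{p_2}=1$, there is a box equation $a_{p_1}a_{\lambda_{\rm top}}=a_{p_2}a_{\lambda_{\rm bot}}$. Let $P_{\overline{\omega_0}}$ be the subscheme of the torus $\operatorname{Spec}\mathbb C[a_d^{\pm1}]_d$ defined by all box equations, and let $F_{\overline{\omega_0}}\subset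 P_{\overline{\omega_0}}\times T$ be the family $f_{\overline{\omega_0},a}(t)=0$ over $P_{\overline{\omega_0}}$. *The map $h_a$.* Let $\overline{\omega_0}'$ be a reduced decomposition that differs from $\overline{\omega_0}$ by a 3-move, i.e. at three consecutive places $i,j,k$ a subword $(s_u,s_v,s_u)$ with $|u-v|=1$ is replaced by $(s_v,s_u,s_v)$. Denote by $t'$ the coordinates of the torus $T'$ belonging to $\overline{\omega_0}'$. For a coefficient vector $a$ put $C=a_{\lambda_k}/a_{\lambda_i}$ and define $h_a:T'\dashrightarrow T$, on the locus $t_i't_k'+Ct_j'\neq0$, by $$(t_i,t_j,t_k)=\Bigl(\frac{t_i't_k'+Ct_j'}{t_i'},\ \frac{t_i't_k'}{C},\ \frac{Ct_i't_j'}{t_i't_k'+Ct_j'}\Bigr),\qquad t_q=t_q'\ \ (q\ne i,j,k).$$ **Theorem.** In this situation: 1. The map $h_a$ is a geometric lift of the tropical Berenstein–Zelevinsky map: it is given by subtraction-free rational expressions in $t'$ and the parameter $C$ which, when $+,\cdot,/$ are replaced by $\max,+,-$ and $C$ by $0$, become $$(x_i,x_j,x_k)\mapsto(\max(x_k,x_j-x_i),\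 x_i+x_k,\ \min(x_i,x_j-x_k)),\qquad x_q\mapsto x_q\ \ (q\neq i,j,k);$$ with $\min$ in place of $\max$ as tropical addition, they become the same map with $\min$ and $\max$ exchanged. 2. There is an isomorphism $g:P_{\overline{\omega_0}'}\to P_{\overline{\omega_0}}$ of $\mathbb C$-schemes such that, if $a'$ denotes the universal coefficient vector on $P_{\overline{\omega_0}'}$ and $a=g(a')$, then $h_a^*(f_{\overline{\omega_0},a})=f_{\overline{\omega_0}',a'}$. 3. The map $H=(g,h_a):F_{\overline{\omega_0}'}\dashrightarrow F_{\overline{\omega_0}}$, $(a',t')\mapsto(g(a'),h_{g(a')}(t'))$, is a birational map of families: it is an isomorphism from the dense open subscheme of $F_{\overline{\omega_0}'}$ where $t_i't_k'+Ct_j'\ne0$ onto a dense open subscheme of $F_{\overline{\omega_0}}$, and it lies over $g$. 4. For every closed point $a'\in P_{\overline{\omega_0}'}(\mathbb C)$, with $a=g(a')$, one has $h_a^*(f_{\overline{\omega_0},a})=f_{\overline{\omega_0}',a'}$, and $h_a$ restricts to a birational map $Z_{\overline{\omega_0}',a'}\dashrightarrow Z_{\overline{\omega_0},a}$ of the fibres,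 i.e. to an isomorphism from the dense open subscheme where $t_i't_k'+Ct_j'\neq0$ onto a dense open subscheme of $Z_{\overline{\omega_0},a}$. -/

import Mathlib

noncomputable section

open CategoryTheory AlgebraicGeometry

namespace StringMirror

/-! ### Reduced decompositions and string diagrams

Everything is indexed from `0`: the simple reflections are `s_c`, `c : Fin n`, the strings are
labelled by `Fin (n + 1)` (from left to right at the top), and the crossings (vertices)
`t_q`, `q : Fin N`, are numbered from top to bottom. -/

section Diagram

variable {n N : ℕ}

/-- The simple reflection exchanging the columns `c` and `c + 1`. -/
def simpleRefl (c : Fin n) : Equiv.Perm (Fin (n + 1)) :=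
  Equiv.swap c.castSucc c.succ

/-- `w` is a reduced decomposition `s_{w 0} s_{w 1} ⋯` of the longest element `ω₀` of `S_{n+1}`
(the permutation reversing the order): its product is `ω₀` and its length is
`ℓ(ω₀) = n (n + 1) / 2`. -/
structure IsReducedDecomposition (w : Fin N → Fin n) : Prop where
  length_eq : 2 * N = n * (n + 1)
  prod_eq : (List.ofFn fun q => simpleRefl (w q)).prod = Fin.revPerm

/-- Two letters are neighbours: `|a - b| = 1`. -/
def Adjacent (a b : Fin n) : Prop := a.val + 1 = b.val ∨ b.val + 1 = a.val

/-- `w` and `w'` differ by a 3-move at the consecutive places `i, j, k`: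
`(s_a, s_b, s_a)` is replaced by `(s_b, s_a, s_b)`, where `|a - b| = 1`. -/
structure IsThreeMove (w w' : Fin N → Fin n) (i j k : Fin N) : Prop where
  j_eq : j.val = i.val + 1
  k_eq : k.val = j.val + 1
  adjacent : Adjacent (w i) (w j)
  same : w k = w i
  new_i : w' i = w j
  new_j : w' j = w i
  new_k : w' k = w j
  other : ∀ q, q ≠ i → q ≠ j → q ≠ k → w' q = w q

/-- The arrangement of the strings just above the crossing `q`:
`arrangement w q c` is the label of the string which is in column `c` after the first `q`
exchanges. -/
def arrangement (w : Fin N → Fin n) (q : ℕ) : Equiv.Perm (Fin (n + 1)) :=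
  ((List.ofFn fun r => simpleRefl (w r)).take q).prod

/-- The string that comes from the upper left into the crossing `q` (and leaves it to the lower
right). -/
def leftString (w : Fin N → Fin n) (q : Fin N) : Fin (n + 1) :=
  arrangement w q (w q).castSucc

/-- The string that comes from the upper right into the crossing `q` (and leaves it to the lower
left). -/
def rightString (w : Fin N → Fin n) (q : Fin N) : Fin (n + 1) :=
  arrangement w q (w q).succ

/-- The crossing `q` lies on the string `u`. -/
def OnString (w : Fin N → Fin n) (u : Fin (n + 1)) (q : Fin N) : Prop :=
  u = leftString w q ∨ u = rightString w q

/-- `q` is the lowest crossing on the string `u`. -/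
def IsLowest (w : Fin N → Fin n) (u : Fin (n + 1)) (q : Fin N) : Prop :=
  OnString w u q ∧ ∀ r, OnString w u r → r ≤ q

/-- In the orientation belonging to `k`, the strings up to the `k`-th one are oriented upward, the
other ones downward. -/
def IsUpward (k : Fin n) (u : Fin (n + 1)) : Prop := u ≤ k.castSucc

/-- `r` is the crossing that follows the crossing `q` on the string `u`, in the orientation
belonging to `k`. -/
def IsNext (w : Fin N → Fin n) (k : Fin n) (u : Fin (n + 1)) (q r : Fin N) : Prop :=
  OnString w u q ∧ OnString w u r ∧
    ((IsUpward k u ∧ r < q ∧ ∀ x, OnString w u x → ¬ (r < x ∧ x < q)) ∨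
      (¬ IsUpward k u ∧ q < r ∧ ∀ x, OnString w u x → ¬ (q < x ∧ x < r)))

/-- The passage of a path through a crossing `vertex`: it arrives along the string `inn` and
leaves along the string `out`. -/
structure Passage (n N : ℕ) where
  vertex : Fin N
  inn : Fin (n + 1)
  out : Fin (n + 1)

/-- The two bad fragments: the path goes straight through a crossing, either to the upper left
while the string that it crosses is oriented upward (to the upper right), or to the lower left
while the string that it crosses is oriented downward (to the lower right). -/
def IsBad (w : Fin N → Fin n) (k : Fin n) (p : Passage n N) : Prop :=
  p.inn = p.out ∧
    ((p.inn = leftString w p.vertex ∧ IsUpward k p.inn ∧ IsUpward k (rightString w p.vertex)) ∨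
      (p.inn = rightString w p.vertex ∧ ¬ IsUpward k p.inn ∧
        ¬ IsUpward k (leftString w p.vertex)))

/-- A rigorous path, given by its successive passages through crossings: an oriented path
from the lower end of the `k`-th string to the lower end of the next string, which meets no vertex
twice and avoids the bad fragments. -/
structure IsRigorousPath (w : Fin N → Fin n) (k : Fin n) (γ : List (Passage n N)) : Prop where
  ne_nil : γ ≠ []
  start : ∀ p ∈ γ.head?, p.inn = k.castSucc ∧ IsLowest w k.castSucc p.vertex
  finish : ∀ p ∈ γ.getLast?, p.out = k.succ ∧ IsLowest w k.succ p.vertex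
  on_string : ∀ p ∈ γ, OnString w p.inn p.vertex ∧ OnString w p.out p.vertex
  chain : γ.IsChain fun p p' => p'.inn = p.out ∧ IsNext w k p.out p.vertex p'.vertex
  nodup : (γ.map Passage.vertex).Nodup
  not_bad : ∀ p ∈ γ, ¬ IsBad w k p

/-- `1` if the path switches from `U_a` to `U_b` with `a < b`, `-1` if it switches from `U_a` to
`U_b` with `a > b`, and `0` if it does not switch. -/
def Passage.sign (p : Passage n N) : ℤ :=
  if p.inn < p.out then 1 else if p.out < p.inn then -1 else 0

/-- The coefficients of the string inequality `∑ a_q x_q ≥ 0` of a path. -/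
def stringCoeff (γ : List (Passage n N)) (q : Fin N) : ℤ :=
  (γ.map fun p => if p.vertex = q then p.sign else 0).sum

/-- The exponent vectors `m` of all string inequalities, written as `∑ m_q x_q ≤ 0`. -/
def stringExponents (w : Fin N → Fin n) : Set (Fin N → ℤ) :=
  {m | ∃ k γ, IsRigorousPath w k γ ∧ m = -stringCoeff γ}

theorem stringCoeff_mem (γ : List (Passage n N)) (h : (γ.map Passage.vertex).Nodup)
    (q : Fin N) : stringCoeff γ q ∈ Finset.Icc (-1 : ℤ) 1 := by
  have key : ∀ γ : List (Passage n N), q ∉ γ.map Passage.vertex → stringCoeff γ q = 0 := by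
    intro γ
    induction γ with
    | nil => intro _; simp [stringCoeff]
    | cons p γ ih =>
      intro hq
      simp only [List.map_cons, List.mem_cons, not_or] at hq
      have h2 := ih hq.2
      have h1 : p.vertex ≠ q := fun e => hq.1 e.symm
      simp only [stringCoeff, List.map_cons, List.sum_cons, if_neg h1, zero_add] at h2 ⊢
      exact h2
  induction γ with
  | nil => simp [stringCoeff]
  | cons p γ ih =>
    simp only [List.map_cons, List.nodup_cons] at h
    have e : stringCoeff (p :: γ) q = (if p.vertex = q then p.sign else 0) + stringCoeff γ q := by
      simp [stringCoeff]
    rw [e]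
    by_cases hp : p.vertex = q
    · rw [key γ (hp ▸ h.1), if_pos hp, add_zero, Finset.mem_Icc]
      unfold Passage.sign
      split_ifs <;> norm_num
    · rw [if_neg hp, zero_add]
      exact ih h.2

theorem stringExponents_finite (w : Fin N → Fin n) : (stringExponents w).Finite := by
  refine Set.Finite.subset
    (Finset.finite_toSet (Fintype.piFinset fun _ : Fin N => Finset.Icc (-1 : ℤ) 1)) ?_
  rintro m ⟨k, γ, hγ, rfl⟩
  rw [Finset.mem_coe, Fintype.mem_piFinset]
  intro q
  have h := stringCoeff_mem γ hγ.nodup q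
  rw [Finset.mem_Icc] at h ⊢
  simp only [Pi.neg_apply]
  constructor <;> linarith [h.1, h.2]

/-- The exponent vector of the `λ`-inequality `x_q - ∑_{r > q} c_r x_r ≤ 2`. -/
def lambdaExponent (w : Fin N → Fin n) (q r : Fin N) : ℤ :=
  open Classical in
  if r = q then 1
  else if q < r then (if w r = w q then 2 else if Adjacent (w r) (w q) then -1 else 0)
  else 0

/-- The defining inequalities of the string polytope: the string inequalities and one
`λ`-inequality for each crossing. -/
abbrev Inequality (w : Fin N → Fin n) : Type := stringExponents w ⊕ Fin N

instance (w : Fin N → Fin n) : Fintype (stringExponents w) :=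
  (stringExponents_finite w).fintype

/-- The exponent vector `M_d` of a defining inequality. -/
def exponent (w : Fin N → Fin n) : Inequality w → Fin N → ℤ :=
  Sum.elim (fun m => m.val) (lambdaExponent w)

/-- A box (bounded region) of the string diagram is bounded above and below by two
consecutive crossings of one column. -/
def IsBox (w : Fin N → Fin n) (top bot : Fin N) : Prop :=
  top < bot ∧ w top = w bot ∧ ∀ q, top < q → q < bot → w q ≠ w top

/-- The box conditions for the string inequalities `p₁, p₂` and the box between `top` and
`bot`. -/
structure BoxCondition (w : Fin N → Fin n) (top bot : Fin N) (p₁ p₂ : stringExponents w) :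
    Prop where
  box : IsBox w top bot
  balance : p₁.val + lambdaExponent w top = p₂.val + lambdaExponent w bot
  deg_top : p₁.val top = -1
  deg_bot : p₂.val bot = 1

end Diagram

/-! ### Laurent polynomials -/

section Laurent

/-- The ring of Laurent polynomials over `S` in the variables indexed by the finite type `ι`. -/
abbrev Laurent (S : Type) [CommRing S] (ι : Type) : Type := AddMonoidAlgebra S (ι → ℤ)

/-- The Laurent monomial with exponent vector `m`, as a unit. -/
def monomialUnit (S : Type) [CommRing S] {ι : Type} (m : ι → ℤ) : (Laurent S ι)ˣ :=
  Units.map (AddMonoidAlgebra.of S (ι → ℤ)) (toUnits (Multiplicative.ofAdd m))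

/-- The variable with index `q`, as a unit. -/
def varUnit (S : Type) [CommRing S] {ι : Type} [DecidableEq ι] (q : ι) : (Laurent S ι)ˣ :=
  monomialUnit S (Pi.single q 1)

/-- The ring homomorphism on Laurent polynomials which is `γ` on coefficients and
sends the variables to the units `u q`. -/
def laurentEval {S L ι : Type} [CommRing S] [CommRing L] [Fintype ι] (γ : S →+* L)
    (u : ι → Lˣ) : Laurent S ι →+* L :=
  AddMonoidAlgebra.liftNCRingHom γ
    ((Units.coeHom L).comp
      { toFun := fun m => ∏ q, u q ^ (m.toAdd q)
        map_one' := by simp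
        map_mul' := fun a b => by simp [zpow_add, Finset.prod_mul_distrib] })
    (fun _ _ => Commute.all _ _)

end Laurent

/-! ### The families -/

section Family

variable {n N : ℕ}

/-- The coordinate of the torus of coefficient vectors that belongs to the inequality `d`. -/
def coeffVar (w : Fin N → Fin n) (d : Inequality w) : (Laurent ℂ (Inequality w))ˣ :=
  open Classical in varUnit ℂ d

/-- The ideal of the combinatorial box equations
`a_{p₁} a_{λ_top} = a_{p₂} a_{λ_bot}`. -/
def boxIdeal (w : Fin N → Fin n) : Ideal (Laurent ℂ (Inequality w)) :=
  Ideal.span {x | ∃ top bot p₁ p₂, BoxCondition w top bot p₁ p₂ ∧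
    x = (coeffVar w (Sum.inl p₁) : Laurent ℂ (Inequality w)) * coeffVar w (Sum.inr top) -
      coeffVar w (Sum.inl p₂) * coeffVar w (Sum.inr bot)}

/-- The coordinate ring of the parameter space `P_w`. -/
abbrev ParamRing (w : Fin N → Fin n) : Type := Laurent ℂ (Inequality w) ⧸ boxIdeal w

/-- The parameter space `P_w`: the subscheme of the torus of coefficient vectors
defined by the combinatorial box equations. -/
abbrev paramSpace (w : Fin N → Fin n) : Scheme.{0} := Spec (CommRingCat.of (ParamRing w))

/-- The universal coefficient vector on `P_w`. -/
def univCoeff (w : Fin N → Fin n) (d : Inequality w) : (ParamRing w)ˣ :=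
  Units.map (Ideal.Quotient.mk (boxIdeal w) : Laurent ℂ (Inequality w) →* ParamRing w)
    (coeffVar w d)

/-- The coefficient vector of the point of `P_w` with values in `S` that is given by the ring
homomorphism `γ`. -/
def coeffAt {S : Type} [CommRing S] {w : Fin N → Fin n} (γ : ParamRing w →+* S)
    (d : Inequality w) : Sˣ :=
  Units.map (γ : ParamRing w →* S) (univCoeff w d)

/-- The Laurent polynomial `f_{w,a} = 1 - ∑_d a_d T^{M_d}`. -/
def poly {S : Type} [CommRing S] (w : Fin N → Fin n) (a : Inequality w → Sˣ) :
    Laurent S (Fin N) :=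
  1 - ∑ d, AddMonoidAlgebra.single (exponent w d) (a d : S)

/-- The torus with coordinates `t_1, …, t_N` over `S`. -/
abbrev torus (S : Type) [CommRing S] (N : ℕ) : Scheme.{0} :=
  Spec (CommRingCat.of (Laurent S (Fin N)))

/-- The hypersurface `Z_{w,a}`, defined by `f_{w,a} = 0` in the torus over `S`. -/
def hypersurface {S : Type} [CommRing S] (w : Fin N → Fin n) (a : Inequality w → Sˣ) :
    Scheme.{0} :=
  Spec (CommRingCat.of (Laurent S (Fin N) ⧸ Ideal.span {poly w a}))

/-- The inclusion of `Z_{w,a}` into the torus. -/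
def hypersurfaceIncl {S : Type} [CommRing S] (w : Fin N → Fin n) (a : Inequality w → Sˣ) :
    hypersurface w a ⟶ torus S N :=
  Spec.map (CommRingCat.ofHom (Ideal.Quotient.mk (Ideal.span {poly w a})))

/-- The total space of the family `F_w`: the hypersurface, in the torus over
`P_w`, whose coefficients are the universal ones. -/
def family (w : Fin N → Fin n) : Scheme.{0} := hypersurface w (univCoeff w)

/-- The structure morphism `F_w ⟶ P_w`. -/
def familyProj (w : Fin N → Fin n) : family w ⟶ paramSpace w :=
  hypersurfaceIncl w (univCoeff w) ≫
    Spec.map (CommRingCat.ofHom (algebraMap (ParamRing w) (Laurent (ParamRing w) (Fin N))))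

end Family

/-! ### The map `(g, h_a)` -/

section Map

variable {n N : ℕ}

/-- The denominator `t_i t_k + C t_j`. -/
def hDenom {S : Type} [CommRing S] (i j k : Fin N) (C : Sˣ) : Laurent S (Fin N) :=
  (varUnit S i : Laurent S (Fin N)) * varUnit S k +
    algebraMap S (Laurent S (Fin N)) C * varUnit S j

/-- Laurent polynomials with `t_i t_k + C t_j` inverted. -/
abbrev HRing {S : Type} [CommRing S] (i j k : Fin N) (C : Sˣ) : Type :=
  Localization.Away (hDenom i j k C)

/-- The variable `t_q` in the localization. -/
def hVar {S : Type} [CommRing S] (i j k : Fin N) (C : Sˣ) (q : Fin N) : (HRing i j k C)ˣ :=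
  Units.map (algebraMap (Laurent S (Fin N)) (HRing i j k C) : _ →* _) (varUnit S q)

/-- The constant `C` in the localization. -/
def hConst {S : Type} [CommRing S] (i j k : Fin N) (C : Sˣ) : (HRing i j k C)ˣ :=
  Units.map (algebraMap S (HRing i j k C) : S →* HRing i j k C) C

/-- The unit `t_i t_k + C t_j` of the localization. -/
def hDenomUnit {S : Type} [CommRing S] (i j k : Fin N) (C : Sˣ) : (HRing i j k C)ˣ :=
  (IsLocalization.Away.algebraMap_isUnit (S := HRing i j k C) (hDenom i j k C)).unit

/-- The coordinates of the map `h`: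
`(t_i, t_j, t_k) = ((t_i' t_k' + C t_j') / t_i', t_i' t_k' / C, C t_i' t_j' / (t_i' t_k' + C t_j'))`
and `t_q = t_q'` for the other `q`. -/
def hCoord {S : Type} [CommRing S] (i j k : Fin N) (C : Sˣ) (q : Fin N) : (HRing i j k C)ˣ :=
  if q = i then hDenomUnit i j k C / hVar i j k C i
  else if q = j then hVar i j k C i * hVar i j k C k / hConst i j k C
  else if q = k then hConst i j k C * hVar i j k C i * hVar i j k C j / hDenomUnit i j k C
  else hVar i j k C q

/-- The pull-back of functions under the rational map `(g, h)` from the torus over `S'` to the torus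
over `S`, where `γ : S →+* S'` is the pull-back of functions under `g`. -/
def hPull {S S' : Type} [CommRing S] [CommRing S'] (i j k : Fin N) (γ : S →+* S') (C : S'ˣ) :
    Laurent S (Fin N) →+* HRing i j k C :=
  laurentEval ((algebraMap S' (HRing i j k C)).comp γ) (hCoord i j k C)

/-- A partial isomorphism between hypersurfaces of tori which is the restriction of the
rational map `(g, h)`: it is defined where `t_i' t_k' + C t_j'` does not vanish, and there it is
given by the formulas for `(g, h)`. -/
structure IsInducedBy {S S' : Type} [CommRing S] [CommRing S'] {w w' : Fin N → Fin n}
    {a : Inequality w → Sˣ} {a' : Inequality w' → S'ˣ} (i j k : Fin N) (γ : S →+* S') (C : S'ˣ)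
    (H : (hypersurface w' a').PartialIso (hypersurface w a)) : Prop where
  source_eq : H.source = hypersurfaceIncl w' a' ⁻¹ᵁ PrimeSpectrum.basicOpen (hDenom i j k C)
  formula : ∃ φ : H.source.toScheme ⟶ Spec (CommRingCat.of (HRing i j k C)),
    φ ≫ Spec.map (CommRingCat.ofHom (algebraMap (Laurent S' (Fin N)) (HRing i j k C))) =
      H.source.ι ≫ hypersurfaceIncl w' a' ∧
    H.iso.hom ≫ H.target.ι ≫ hypersurfaceIncl w a =
      φ ≫ Spec.map (CommRingCat.ofHom (hPull i j k γ C))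

end Map

/-! ### Geometric lifts -/

section Lift

/-- Subtraction-free rational expressions in variables `v : V` and one parameter. -/
inductive SubtractionFree (V : Type) : Type
  | var (v : V) : SubtractionFree V
  | param : SubtractionFree V
  | add (x y : SubtractionFree V) : SubtractionFree V
  | mul (x y : SubtractionFree V) : SubtractionFree V
  | div (x y : SubtractionFree V) : SubtractionFree V

/-- The value of an expression in a field. -/
def SubtractionFree.eval {V K : Type} [Field K] (C : K) (t : V → K) : SubtractionFree V → K
  | .var v => t v
  | .param => C
  | .add x y => x.eval C t + y.eval C t
  | .mul x y => x.eval C t * y.eval C t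
  | .div x y => x.eval C t / y.eval C t

/-- The tropicalization of an expression: `+, ·, /` become `op, +, -` (where `op` is `min` or
`max`, according to the convention), and the parameter becomes `0`. -/
def SubtractionFree.trop {V : Type} (op : ℝ → ℝ → ℝ) (x : V → ℝ) : SubtractionFree V → ℝ
  | .var v => x v
  | .param => 0
  | .add y z => op (y.trop op x) (z.trop op x)
  | .mul y z => y.trop op x + z.trop op x
  | .div y z => y.trop op x - z.trop op x

/-- The tropical Berenstein–Zelevinsky map of a 3-move; with `op = max` and `op' = min` it is
`(x_i, x_j, x_k) ↦ (max (x_k, x_j - x_i), x_i + x_k, min (x_i, x_j - x_k))`. The choice `op = min`,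
`op' = max` belongs to the opposite convention for tropical addition. -/
def tropicalBZ {N : ℕ} (op op' : ℝ → ℝ → ℝ) (i j k : Fin N) (x : Fin N → ℝ) (q : Fin N) : ℝ :=
  if q = i then op (x k) (x j - x i)
  else if q = j then x i + x k
  else if q = k then op' (x i) (x j - x k)
  else x q

/-- The maps `h` between complex tori (with parameter `C`) are a geometric lift of the
piecewise linear map `ψ`: they are given, at every point where they are defined, by
subtraction-free expressions whose tropicalizations are the coordinates of `ψ`. -/
def IsGeometricLift {N : ℕ} (op : ℝ → ℝ → ℝ) (i j k : Fin N)
    (ψ : (Fin N → ℝ) → Fin N → ℝ) : Prop :=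
  ∃ E : Fin N → SubtractionFree (Fin N),
    (∀ (C : ℂˣ) (e : HRing i j k C →ₐ[ℂ] ℂ) (q : Fin N),
      e (hPull i j k (RingHom.id ℂ) C (varUnit ℂ q)) =
        (E q).eval (C : ℂ) fun r => e (hVar i j k C r)) ∧
    ∀ (x : Fin N → ℝ) (q : Fin N), (E q).trop op x = ψ x q

end Lift

end StringMirror

end

noncomputable section

open CategoryTheory AlgebraicGeometry

namespace StringMirror

/-! ### Reducedness: at every crossing the left string has the smaller label -/

section Reduced

variable {n N : ℕ}

/-! Put D = t_i' t_k' + C t_j'. The pull-back of T^m under `h_a` is a monomial times D to the power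
m_i - m_k (`prod_hCoord`). For the exponents of f this power is 0, 1 or -1. Power 0 gives a single
monomial; power 1 gives two monomials, one for each summand of D; the terms with power -1 occur in
pairs whose sum contains a factor D, which cancels. So the theorem reduces to two questions: how do
the triples (m_i, m_j, m_k) of the two diagrams correspond, and which coefficients make the pairs
fit?

Triples. A rigorous path is replaced by the 0/1 function on the chambers of the diagram that marks
the chambers it encloses. Such functions are characterized by a local condition at each crossing and
by their values at the top and the bottom, and the exponent at a crossing is left + right - top -
bottom (`mem_stringExponents_iff`). A 3-move changes the diagram only in one small triangular
chamber. Hence its effect on the exponents is a finite check on the 0/1 values around the triangle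
(`low_to_high_bool`, `high_to_low_bool`), which yields the admissible triples `IsMovable` and their
images `TripleMove`.

Coefficients. Two terms of a pair add up to a multiple of D only if their coefficients have ratio C
= a_{λ_k}/a_{λ_i}. This is the box equation of the triangle (`IsThreeMove.small_box`). Comparing the
other coefficients forces the formula `moveCoeff`, in which a coefficient is multiplied by a power
of C. That it respects all box equations rests on the identity λ_bot - λ_top = exponent vector of
the indicator function of the box: the two paths of a box equation enclose regions that differ by
exactly this box. For each position of the box relative to the triangle, the box equation becomes a
box equation of the other diagram times a power of C (`IsThreeMove.solvesBoxEquations`). Since C is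
unchanged by the move and the formulas are symmetric, moving back gives the identity
(`IsThreeMove.moveCoeff_moveCoeff`), so g is an isomorphism.

Birationality. The map h exchanges the two summands of D, so it preserves D, and it is inverse to
the map h of the reverse move (`IsThreeMove.lift_hPull`). It therefore identifies the two localized
tori, and by `IsThreeMove.hPull_poly` the two hypersurfaces in them. Density of the locus D ≠ 0 is
proved over an arbitrary coefficient ring, without any integrality of P: D is not a zero divisor
modulo f (`IsThreeMove.hDenom_regular`), because the substitution t_j = -t_i t_k / C, which kills D,
leaves the constant term of f equal to 1.

All of this is done for arbitrary solutions of the box equations, so that the universal family and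
the fibres over complex points are two instances of the same statements. -/

theorem arrangement_zero (w : Fin N → Fin n) : arrangement w 0 = 1 := by
  simp [arrangement]

theorem arrangement_succ (w : Fin N → Fin n) (q : Fin N) :
    arrangement w (q + 1) = arrangement w q * simpleRefl (w q) := by
  unfold arrangement
  rw [List.take_add_one, List.prod_append]
  simp

theorem arrangement_last {w : Fin N → Fin n} (hw : IsReducedDecomposition w) :
    arrangement w N = Fin.revPerm := by
  rw [← hw.prod_eq, arrangement, List.take_of_length_le (by simp)]

/-- The pairs of labels which a permutation, read as an arrangement, puts in the wrong order. -/
def inversions (σ : Equiv.Perm (Fin (n + 1))) : Finset (Fin (n + 1) × Fin (n + 1)) :=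
  {p | p.1 < p.2 ∧ σ.symm p.2 < σ.symm p.1}

theorem simpleRefl_lt (c : Fin n) {x y : Fin (n + 1)} (hxy : x < y)
    (h : ¬ (x = c.castSucc ∧ y = c.succ)) : simpleRefl c x < simpleRefl c y := by
  unfold simpleRefl
  simp only [Fin.ext_iff, Fin.lt_def, Fin.val_castSucc, Fin.val_succ] at hxy h
  rw [Equiv.swap_apply_def, Equiv.swap_apply_def]
  split_ifs <;> simp only [Fin.ext_iff, Fin.lt_def, Fin.val_castSucc, Fin.val_succ] at * <;> omega

/-- Exchanging two neighbouring columns preserves the order of all other pairs of positions, so the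
exchanged pair is the only inversion that can be created. -/
theorem inversions_mul_simpleRefl (σ : Equiv.Perm (Fin (n + 1))) (c : Fin n)
    {p : Fin (n + 1) × Fin (n + 1)} (hp : p ∈ inversions (σ * simpleRefl c)) :
    p ∈ inversions σ ∨ p = (σ c.castSucc, σ c.succ) := by
  simp only [inversions, Finset.mem_filter, Finset.mem_univ, true_and] at hp ⊢
  by_contra! hcon
  obtain ⟨h1, h2⟩ := hp
  have h3 := hcon.1 h1
  have hne : σ.symm p.1 ≠ σ.symm p.2 := fun e => h1.ne (σ.symm.injective e)
  have h4 := lt_of_le_of_ne h3 hne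
  have h5 : ¬ (σ.symm p.1 = c.castSucc ∧ σ.symm p.2 = c.succ) := by
    rintro ⟨e1, e2⟩
    apply hcon.2
    rw [← e1, ← e2]; simp
  have h6 := simpleRefl_lt c h4 h5
  have key : ∀ x, (σ * simpleRefl c).symm x = simpleRefl c (σ.symm x) := by
    intro x
    rw [Equiv.symm_apply_eq]
    simp [simpleRefl]
  rw [key, key] at h2
  exact absurd h6 (not_lt.2 h2.le)

theorem card_inversions_revPerm :
    2 * (inversions (Fin.revPerm : Equiv.Perm (Fin (n + 1)))).card = n * (n + 1) := by
  have h : inversions (Fin.revPerm : Equiv.Perm (Fin (n + 1))) =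
      Finset.univ.filter fun p : Fin (n + 1) × Fin (n + 1) => p.1 < p.2 := by
    ext p
    simp [inversions]
  have h2 : (Finset.univ.filter fun p : Fin (n + 1) × Fin (n + 1) => p.1 < p.2).card =
      (Finset.univ.filter fun p : Fin (n + 1) × Fin (n + 1) => p.2 < p.1).card :=
    Finset.card_bij (fun p _ => (p.2, p.1)) (by simp) (by aesop) (by aesop)
  have h3 : (Finset.univ.filter fun p : Fin (n + 1) × Fin (n + 1) => p.1 = p.2).card = n + 1 := by
    rw [show (Finset.univ.filter fun p : Fin (n + 1) × Fin (n + 1) => p.1 = p.2) =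
      Finset.univ.image (fun x => (x, x)) by ext ⟨x, y⟩; simp [eq_comm]]
    rw [Finset.card_image_of_injective _ (by intro x y h; simpa using h)]
    simp
  have h4 : (Finset.univ : Finset (Fin (n + 1) × Fin (n + 1))).card = (n + 1) * (n + 1) := by
    simp
  have h5 : (Finset.univ : Finset (Fin (n + 1) × Fin (n + 1))) =
      ((Finset.univ.filter fun p : Fin (n + 1) × Fin (n + 1) => p.1 < p.2).disjUnion
      (Finset.univ.filter fun p : Fin (n + 1) × Fin (n + 1) => p.2 < p.1)
        (by rw [Finset.disjoint_filter]; intro p _ h; exact not_lt.2 h.le)).disjUnion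
      (Finset.univ.filter fun p : Fin (n + 1) × Fin (n + 1) => p.1 = p.2)
        (by
          rw [Finset.disjoint_left]
          intro p hp
          simp only [Finset.mem_disjUnion, Finset.mem_filter, Finset.mem_univ, true_and] at hp ⊢
          rcases hp with hp | hp
          · exact hp.ne
          · exact hp.ne') := by
    ext p
    simp only [Finset.mem_univ, Finset.mem_disjUnion, Finset.mem_filter, true_and, true_iff]
    rcases lt_trichotomy p.1 p.2 with h | h | h <;> tauto
  rw [h5, Finset.card_disjUnion, Finset.card_disjUnion, h3, ← h2] at h4
  rw [h]
  nlinarith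

/-- Each crossing creates at most one inversion, and none if the larger label comes from the left.
The longest element has as many inversions as the word has letters, so no crossing can be wasted.
Consequently only three orientation patterns occur at a crossing: both strings up, left up and right
down, both down. -/
theorem leftString_lt_rightString {w : Fin N → Fin n} (hw : IsReducedDecomposition w)
    (q : Fin N) : leftString w q < rightString w q := by
  by_contra hq
  -- The summand 1 records the letter lost at the offending crossing `q`; at level `N` the bound
  -- contradicts the number of inversions of the longest element.
  have key : ∀ l ≤ N, (inversions (arrangement w l)).card + (if q.val < l then 1 else 0) ≤ l := by
    intro l
    induction l with
    | zero =>
      intro _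
      rw [arrangement_zero]
      simp only [inversions, not_lt_zero, if_false, add_zero, Nat.le_zero, Finset.card_eq_zero,
        Finset.filter_eq_empty_iff]
      rintro p - ⟨h1, h2⟩
      exact absurd h1 (not_lt.2 h2.le)
    | succ l ih =>
      intro hl
      have ih := ih (by omega)
      have hs := arrangement_succ w ⟨l, hl⟩
      simp only at hs
      rw [hs]
      by_cases hlr : arrangement w l (w ⟨l, hl⟩).castSucc < arrangement w l (w ⟨l, hl⟩).succ
      · have hne : q.val ≠ l := by
          rintro rfl
          exact hq hlr
        have h1 : inversions (arrangement w l * simpleRefl (w ⟨l, hl⟩)) ⊆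
            insert (arrangement w l (w ⟨l, hl⟩).castSucc, arrangement w l (w ⟨l, hl⟩).succ)
              (inversions (arrangement w l)) := by
          intro p hp
          rw [Finset.mem_insert]
          exact (inversions_mul_simpleRefl _ _ hp).symm
        have h2 := (Finset.card_le_card h1).trans (Finset.card_insert_le _ _)
        split_ifs at ih ⊢ <;> omega
      · have h1 : inversions (arrangement w l * simpleRefl (w ⟨l, hl⟩)) ⊆
            inversions (arrangement w l) := by
          intro p hp
          rcases inversions_mul_simpleRefl _ _ hp with h | h
          · exact h
          · simp only [inversions, Finset.mem_filter] at hp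
            rw [h] at hp
            exact absurd hp.2.1 hlr
        have h2 := Finset.card_le_card h1
        split_ifs at ih ⊢ <;> omega
  have h1 := key N le_rfl
  rw [arrangement_last hw, if_pos q.isLt] at h1
  have h2 := card_inversions_revPerm (n := n)
  have h3 := hw.length_eq
  omega

end Reduced

/-! ### Functions on the chambers of the string diagram -/

section Chambers

variable {n N : ℕ}

theorem arrangement_succ_left (w : Fin N → Fin n) (q : Fin N) :
    arrangement w (q + 1) (w q).castSucc = rightString w q := by
  rw [arrangement_succ]; simp [simpleRefl, rightString]

theorem arrangement_succ_right (w : Fin N → Fin n) (q : Fin N) :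
    arrangement w (q + 1) (w q).succ = leftString w q := by
  rw [arrangement_succ]; simp [simpleRefl, leftString]

theorem arrangement_succ_other (w : Fin N → Fin n) (q : Fin N) (c : Fin (n + 1))
    (h1 : c ≠ (w q).castSucc) (h2 : c ≠ (w q).succ) :
    arrangement w (q + 1) c = arrangement w q c := by
  rw [arrangement_succ, Equiv.Perm.mul_apply, simpleRefl, Equiv.swap_apply_of_ne_of_ne h1 h2]

theorem onString_iff_arrangement (w : Fin N → Fin n) (q : Fin N) (c : Fin (n + 1)) :
    OnString w (arrangement w q c) q ↔ c = (w q).castSucc ∨ c = (w q).succ := by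
  simp [OnString, leftString, rightString]

/-- A function on the chambers of the diagram, given level by level (the gap `g` lies to the left
of the column `g`): a crossing only changes the value in the gap between its two columns. -/
def IsChamberFunction (w : Fin N → Fin n) (χ : ℕ → ℕ → ℤ) : Prop :=
  ∀ (q : Fin N) (g : ℕ), g ≠ (w q).val + 1 → χ (q + 1) g = χ q g

/-- A function on chambers whose jumps along the strings go in the direction that is prescribed
by the orientation, at the crossing `q`. -/
structure IsMonotoneAt (w : Fin N → Fin n) (k : Fin n) (χ : ℕ → ℕ → ℤ) (q : Fin N) : Prop where
  left_up : IsUpward k (leftString w q) →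
    χ q (w q + 1) ≤ χ q (w q) ∧ χ q (w q + 2) ≤ χ (q + 1) (w q + 1)
  left_down : ¬ IsUpward k (leftString w q) →
    χ q (w q) ≤ χ q (w q + 1) ∧ χ (q + 1) (w q + 1) ≤ χ q (w q + 2)
  right_up : IsUpward k (rightString w q) →
    χ q (w q + 2) ≤ χ q (w q + 1) ∧ χ (q + 1) (w q + 1) ≤ χ q (w q)
  right_down : ¬ IsUpward k (rightString w q) →
    χ q (w q + 1) ≤ χ q (w q + 2) ∧ χ q (w q) ≤ χ (q + 1) (w q + 1)

theorem isUpward_left_of_right {w : Fin N → Fin n} (hw : IsReducedDecomposition w) {k : Fin n}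
    {q : Fin N} (h : IsUpward k (rightString w q)) : IsUpward k (leftString w q) :=
  (leftString_lt_rightString hw q).le.trans h

/-- A minimum principle, propagated downward. The new chamber below a crossing dominates its right
neighbour if both strings go up, and its left neighbour if the right string goes down. -/
theorem nonneg_of_isMonotoneAt {w : Fin N → Fin n} (hw : IsReducedDecomposition w) {k : Fin n}
    {χ : ℕ → ℕ → ℤ} (hχ : IsChamberFunction w χ) (hm : ∀ q, IsMonotoneAt w k χ q)
    (h0 : ∀ g, 0 ≤ χ 0 g) : ∀ l ≤ N, ∀ g, 0 ≤ χ l g := by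
  intro l
  induction l with
  | zero => exact fun _ => h0
  | succ l ih =>
    intro hl g
    have ih := ih (by omega)
    have hm := hm ⟨l, hl⟩
    by_cases hg : g = (w ⟨l, hl⟩).val + 1
    · subst hg
      by_cases hr : IsUpward k (rightString w ⟨l, hl⟩)
      · exact (ih _).trans (hm.left_up (isUpward_left_of_right hw hr)).2
      · exact (ih _).trans (hm.right_down hr).2
    · have := hχ ⟨l, hl⟩ g hg
      simp only at this
      rw [this]
      exact ih g

/-- The matching maximum principle, propagated upward from the bottom: the chamber above a crossing
is dominated by its left or its right neighbour, which persists to the next level. -/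
theorem le_of_isMonotoneAt {w : Fin N → Fin n} (hw : IsReducedDecomposition w) {k : Fin n}
    {χ : ℕ → ℕ → ℤ} (hχ : IsChamberFunction w χ) (hm : ∀ q, IsMonotoneAt w k χ q) {b : ℤ}
    (h0 : ∀ g, χ N g ≤ b) : ∀ l ≤ N, ∀ g, χ l g ≤ b := by
  intro l hl
  induction hd : N - l generalizing l with
  | zero =>
    obtain rfl : l = N := by omega
    exact h0
  | succ d ih =>
    have hl' : l < N := by omega
    have ih := ih (l + 1) (by omega) (by omega)
    have hm := hm ⟨l, hl'⟩
    have hχ := hχ ⟨l, hl'⟩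
    simp only at hχ
    intro g
    by_cases hg : g = (w ⟨l, hl'⟩).val + 1
    · subst hg
      by_cases hr : IsUpward k (rightString w ⟨l, hl'⟩)
      · refine (hm.left_up (isUpward_left_of_right hw hr)).1.trans ?_
        rw [← hχ _ (by omega)]
        exact ih _
      · refine (hm.right_down hr).1.trans ?_
        simp only
        rw [← hχ _ (by omega)]
        exact ih _
    · rw [← hχ g hg]
      exact ih g

/-- The condition at a crossing for the set of chambers to the left of a rigorous path: here
`t`, `l`, `r`, `b` are the values of the indicator function above, to the left, to the right and
below the crossing. -/
def IsVertexConfig (lu ru : Prop) (t l r b : ℤ) : Prop :=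
  (lu → ru → t ≤ l ∧ b ≤ t ∧ r ≤ b) ∧ (lu → ¬ ru → t ≤ l ∧ t ≤ r ∧ l ≤ b ∧ r ≤ b) ∧
    (¬ lu → ¬ ru → l ≤ b ∧ b ≤ t ∧ t ≤ r)

/-- The indicator functions of the sets of chambers enclosed by the rigorous paths for `k`. -/
structure IsInterior (w : Fin N → Fin n) (k : Fin n) (χ : ℕ → ℕ → ℤ) : Prop where
  step : IsChamberFunction w χ
  top : ∀ g, χ 0 g = 0
  bottom : ∀ g, χ N g = if g = n - k.val then 1 else 0
  vertex : ∀ q, IsVertexConfig (IsUpward k (leftString w q)) (IsUpward k (rightString w q))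
    (χ q (w q + 1)) (χ q (w q)) (χ q (w q + 2)) (χ (q + 1) (w q + 1))

/-- The exponent vector attached to a function on chambers. -/
def chamberExponent (w : Fin N → Fin n) (χ : ℕ → ℕ → ℤ) (q : Fin N) : ℤ :=
  χ q (w q) + χ q (w q + 2) - χ q (w q + 1) - χ (q + 1) (w q + 1)

theorem IsInterior.isMonotoneAt {w : Fin N → Fin n} (hw : IsReducedDecomposition w) {k : Fin n}
    {χ : ℕ → ℕ → ℤ} (hχ : IsInterior w k χ) (q : Fin N) : IsMonotoneAt w k χ q := by
  have h := hχ.vertex q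
  have h2 := isUpward_left_of_right hw (k := k) (q := q)
  by_cases hl : IsUpward k (leftString w q) <;> by_cases hr : IsUpward k (rightString w q) <;>
    simp only [IsVertexConfig, hl, hr, true_imp_iff, false_imp_iff, not_true, not_false_iff,
      and_true, true_and, imp_false] at h h2 <;>
    constructor <;> intro h' <;> first | exact absurd h' ‹_› | exact absurd ‹_› h' | omega

/-- The values are squeezed between the value 0 at the top and the bound 1 at the bottom.
Restriction to 0 and 1 is what turns the later local analysis into finite checks. -/
theorem IsInterior.mem {w : Fin N → Fin n} (hw : IsReducedDecomposition w) {k : Fin n}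
    {χ : ℕ → ℕ → ℤ} (hχ : IsInterior w k χ) {l : ℕ} (hl : l ≤ N) (g : ℕ) :
    χ l g = 0 ∨ χ l g = 1 := by
  have h1 := nonneg_of_isMonotoneAt hw hχ.step (hχ.isMonotoneAt hw) (fun g => (hχ.top g).ge) l hl g
  have h2 := le_of_isMonotoneAt hw hχ.step (hχ.isMonotoneAt hw) (b := 1)
    (fun g => by rw [hχ.bottom]; split_ifs <;> norm_num) l hl g
  omega

/-- A conserved flow on the pieces of the strings is the jump of a function on chambers. -/
theorem exists_chamberFunction (w : Fin N → Fin n) (f : ℕ → Fin (n + 1) → ℤ)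
    (h0 : ∀ u, f 0 u = 0) (hother : ∀ (q : Fin N) u, ¬ OnString w u q → f (q + 1) u = f q u)
    (hcons : ∀ q : Fin N, f q (leftString w q) + f q (rightString w q) =
      f (q + 1) (leftString w q) + f (q + 1) (rightString w q)) :
    ∃ χ : ℕ → ℕ → ℤ, IsChamberFunction w χ ∧ (∀ g, χ 0 g = 0) ∧
      ∀ l ≤ N, ∀ c : Fin (n + 1), χ l (c + 1) - χ l c = f l (arrangement w l c) := by
  -- The potential is built level by level: the value below a crossing is the value to its left plus
  -- the flow on the string that leaves to the lower left.
  let χ : ℕ → ℕ → ℤ := fun l => Nat.rec (fun _ => 0) (fun q x g =>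
    if h : q < N then
      if g = (w ⟨q, h⟩).val + 1 then x (w ⟨q, h⟩) + f (q + 1) (rightString w ⟨q, h⟩) else x g
    else x g) l
  have hstep : IsChamberFunction w χ := by
    intro q g hg
    simp [χ, hg]
  refine ⟨χ, hstep, fun g => rfl, fun l => ?_⟩
  induction l with
  | zero => intro _ c; simp [χ, h0]
  | succ l ih =>
    intro hl c
    have ih := ih (by omega)
    obtain ⟨q, rfl⟩ : ∃ q : Fin N, l = q.val := ⟨⟨l, hl⟩, rfl⟩
    have hmid : χ (q + 1) ((w q).val + 1) = χ q (w q) + f (q + 1) (rightString w q) := by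
      simp [χ]
    by_cases h1 : c = (w q).castSucc
    · subst h1
      rw [arrangement_succ_left, Fin.val_castSucc, hmid, hstep q _ (by omega)]
      ring
    by_cases h2 : c = (w q).succ
    · subst h2
      -- The jump across the other lower string was not prescribed; it comes out right by
      -- conservation of the flow at the crossing.
      have e1 := ih (w q).castSucc
      have e2 := ih (w q).succ
      rw [arrangement_succ_right, Fin.val_succ, hmid, hstep q _ (by omega)]
      rw [Fin.val_castSucc] at e1
      rw [Fin.val_succ] at e2
      have := hcons q
      simp only [leftString, rightString] at this ⊢
      omega
    · rw [arrangement_succ_other w q c h1 h2, hother]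
      · rw [hstep q c, hstep q (c + 1), ih]
        · intro e; apply h1; ext; simpa using e
        · intro e; apply h2; ext; simpa using e
      · rw [onString_iff_arrangement]; tauto

end Chambers

/-! ### From rigorous paths to chamber functions -/

section PathToChambers

variable {n N : ℕ}

theorem mem_head_or_of_isChain {α : Type*} {R : α → α → Prop} {l : List α} (hl : l.IsChain R)
    {x : α} (hx : x ∈ l) : x ∈ l.head? ∨ ∃ y ∈ l, R y x := by
  induction l with
  | nil => simp at hx
  | cons a l ih =>
    rcases List.mem_cons.1 hx with rfl | hx
    · simp
    · right
      rcases ih hl.tail hx with h | ⟨y, hy, hyx⟩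
      · exact ⟨a, by simp, (List.isChain_cons.1 hl).1 x h⟩
      · exact ⟨y, List.mem_cons_of_mem _ hy, hyx⟩

theorem mem_getLast_or_of_isChain {α : Type*} {R : α → α → Prop} {l : List α} (hl : l.IsChain R)
    {x : α} (hx : x ∈ l) : x ∈ l.getLast? ∨ ∃ y ∈ l, R x y := by
  have h := mem_head_or_of_isChain (List.isChain_reverse.2 hl) (List.mem_reverse.2 hx)
  simpa using h

variable {w : Fin N → Fin n} {k : Fin n} {γ : List (Passage n N)}

theorem IsRigorousPath.start_or (hγ : IsRigorousPath w k γ) {p : Passage n N} (hp : p ∈ γ) :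
    (p.inn = k.castSucc ∧ IsLowest w k.castSucc p.vertex) ∨
      ∃ p' ∈ γ, p.inn = p'.out ∧ IsNext w k p'.out p'.vertex p.vertex :=
  (mem_head_or_of_isChain hγ.chain hp).imp_left fun h => hγ.start p h

theorem IsRigorousPath.finish_or (hγ : IsRigorousPath w k γ) {p : Passage n N} (hp : p ∈ γ) :
    (p.out = k.succ ∧ IsLowest w k.succ p.vertex) ∨
      ∃ p' ∈ γ, p'.inn = p.out ∧ IsNext w k p.out p.vertex p'.vertex :=
  (mem_getLast_or_of_isChain hγ.chain hp).imp_left fun h => hγ.finish p h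

theorem IsRigorousPath.eq_of_vertex_eq (hγ : IsRigorousPath w k γ) {p p' : Passage n N}
    (hp : p ∈ γ) (hp' : p' ∈ γ) (h : p.vertex = p'.vertex) : p = p' :=
  List.inj_on_of_nodup_map hγ.nodup hp hp' h

theorem isUpward_castSucc (k : Fin n) : IsUpward k k.castSucc := le_rfl

theorem not_isUpward_succ (k : Fin n) : ¬ IsUpward k k.succ :=
  not_le.2 (Fin.castSucc_lt_succ)

open Classical in
/-- The string `u` is used by the path at the level just below the crossings before `l`. -/
def Used (w : Fin N → Fin n) (k : Fin n) (γ : List (Passage n N)) (l : ℕ) (u : Fin (n + 1)) :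
    Prop :=
  ∃ p ∈ γ, u = (if IsUpward k u then p.inn else p.out) ∧ p.vertex.val < l ∧
    ∀ x, OnString w u x → ¬ (p.vertex < x ∧ x.val < l)

theorem not_used_zero (u : Fin (n + 1)) : ¬ Used w k γ 0 u := by
  rintro ⟨p, -, -, h, -⟩
  omega

open Classical in
theorem used_succ_iff {q : Fin N} {u : Fin (n + 1)} (hu : OnString w u q) :
    Used w k γ (q + 1) u ↔
      ∃ p ∈ γ, p.vertex = q ∧ u = (if IsUpward k u then p.inn else p.out) := by
  constructor
  · rintro ⟨p, hp, hpu, hlt, h⟩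
    refine ⟨p, hp, ?_, hpu⟩
    by_contra hne
    have := h q hu
    rw [Fin.lt_def] at this
    rw [Fin.ext_iff] at hne
    omega
  · rintro ⟨p, hp, rfl, hpu⟩
    exact ⟨p, hp, hpu, by omega, fun x _ hx => by have := hx.1; rw [Fin.lt_def] at this; omega⟩

theorem used_succ_of_not_onString (hγ : IsRigorousPath w k γ) {q : Fin N} {u : Fin (n + 1)}
    (hu : ¬ OnString w u q) : Used w k γ (q + 1) u ↔ Used w k γ q u := by
  refine exists_congr fun p => and_congr_right fun hp => and_congr_right fun hpu => ?_
  have hon : OnString w u p.vertex := by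
    rw [hpu]
    split_ifs
    · exact (hγ.on_string p hp).1
    · exact (hγ.on_string p hp).2
  have hne : p.vertex.val ≠ q.val := by
    intro e
    exact hu (Fin.ext e ▸ hon)
  refine and_congr (by omega) (forall_congr' fun x => forall_congr' fun hx => not_congr ?_)
  have hne : x.val ≠ q.val := by
    intro e
    exact hu (Fin.ext e ▸ hx)
  refine and_congr_right fun _ => by omega

-- The segment of `u` just above `q` joins `q` to the previous crossing on `u`, and the path
-- traverses it exactly when its passages at the two ends are consecutive. The path cannot start or
-- finish in between, because both its ends lie at lowest crossings of their strings.
open Classical in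
theorem used_iff (hγ : IsRigorousPath w k γ) {q : Fin N} {u : Fin (n + 1)}
    (hu : OnString w u q) :
    Used w k γ q u ↔
      ∃ p ∈ γ, p.vertex = q ∧ u = (if IsUpward k u then p.out else p.inn) := by
  by_cases hup : IsUpward k u
  · simp only [Used, hup, if_true]
    constructor
    · rintro ⟨p, hp, rfl, hlt, h⟩
      rcases hγ.start_or hp with ⟨h1, h2⟩ | ⟨p', hp', h1, h2⟩
      · rw [h1] at hu
        exact absurd (h2.2 q hu) (not_le.2 hlt)
      · refine ⟨p', hp', ?_, h1⟩
        rw [← h1] at h2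
        rcases h2.2.2 with ⟨-, h3, h4⟩ | ⟨h3, -⟩
        · by_contra hne
          rcases lt_or_gt_of_ne hne with hlt' | hlt'
          · exact h p'.vertex h2.1 ⟨h3, hlt'⟩
          · exact h4 q hu ⟨hlt, hlt'⟩
        · exact absurd hup h3
    · rintro ⟨p, hp, rfl, rfl⟩
      rcases hγ.finish_or hp with ⟨h1, h2⟩ | ⟨p', hp', h1, h2⟩
      · rw [h1] at hup
        exact absurd hup (not_isUpward_succ k)
      · refine ⟨p', hp', h1.symm, ?_⟩
        rcases h2.2.2 with ⟨-, h3, h4⟩ | ⟨h3, -⟩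
        · exact ⟨h3, h4⟩
        · exact absurd hup h3
  · simp only [Used, hup, if_false]
    constructor
    · rintro ⟨p, hp, rfl, hlt, h⟩
      rcases hγ.finish_or hp with ⟨h1, h2⟩ | ⟨p', hp', h1, h2⟩
      · rw [h1] at hu
        exact absurd (h2.2 q hu) (not_le.2 hlt)
      · refine ⟨p', hp', ?_, h1.symm⟩
        rcases h2.2.2 with ⟨h3, -⟩ | ⟨-, h3, h4⟩
        · exact absurd h3 hup
        · by_contra hne
          rcases lt_or_gt_of_ne hne with hlt' | hlt'
          · exact h p'.vertex h2.2.1 ⟨h3, hlt'⟩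
          · exact h4 q hu ⟨hlt, hlt'⟩
    · rintro ⟨p, hp, rfl, rfl⟩
      rcases hγ.start_or hp with ⟨h1, h2⟩ | ⟨p', hp', h1, h2⟩
      · rw [h1] at hup
        exact absurd (isUpward_castSucc k) hup
      · refine ⟨p', hp', h1, ?_⟩
        rw [← h1] at h2
        rcases h2.2.2 with ⟨h3, -⟩ | ⟨-, h3, h4⟩
        · exact absurd h3 hup
        · exact ⟨h3, h4⟩

open Classical in
/-- The flow of a path along the string `u`, counted downward. -/
def pathFlow (w : Fin N → Fin n) (k : Fin n) (γ : List (Passage n N)) (l : ℕ)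
    (u : Fin (n + 1)) : ℤ :=
  if Used w k γ l u then (if IsUpward k u then -1 else 1) else 0

theorem stringCoeff_of_mem (hγ : (γ.map Passage.vertex).Nodup) {p : Passage n N} (hp : p ∈ γ) :
    stringCoeff γ p.vertex = p.sign := by
  classical
  unfold stringCoeff
  have hn : γ.Nodup := hγ.of_map _
  rw [← List.sum_toFinset _ hn, Finset.sum_eq_single p]
  · simp
  · intro b hb hne
    rw [if_neg]
    intro e
    exact hne (List.inj_on_of_nodup_map hγ (List.mem_toFinset.1 hb) hp e)
  · intro h
    exact absurd (List.mem_toFinset.2 hp) h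

theorem stringCoeff_of_notMem {q : Fin N} (h : ∀ p ∈ γ, p.vertex ≠ q) : stringCoeff γ q = 0 := by
  unfold stringCoeff
  apply List.sum_eq_zero
  simp only [List.mem_map]
  rintro x ⟨p, hp, rfl⟩
  rw [if_neg (h p hp)]

end PathToChambers

section PathToChambers

variable {n N : ℕ} {w : Fin N → Fin n} {k : Fin n} {γ : List (Passage n N)}

open Classical in
theorem pathFlow_above (hγ : IsRigorousPath w k γ) {p : Passage n N} (hp : p ∈ γ)
    {u : Fin (n + 1)} (hu : OnString w u p.vertex) :
    pathFlow w k γ p.vertex u =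
      if IsUpward k u then (if u = p.out then -1 else 0) else (if u = p.inn then 1 else 0) := by
  have h : Used w k γ p.vertex u ↔ u = (if IsUpward k u then p.out else p.inn) := by
    rw [used_iff hγ hu]
    constructor
    · rintro ⟨p', hp', e, h⟩
      rwa [hγ.eq_of_vertex_eq hp' hp e] at h
    · exact fun h => ⟨p, hp, rfl, h⟩
  unfold pathFlow
  rw [h]
  by_cases hup : IsUpward k u <;> simp only [hup, if_true, if_false]

open Classical in
theorem pathFlow_below (hγ : IsRigorousPath w k γ) {p : Passage n N} (hp : p ∈ γ)
    {u : Fin (n + 1)} (hu : OnString w u p.vertex) :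
    pathFlow w k γ (p.vertex + 1) u =
      if IsUpward k u then (if u = p.inn then -1 else 0) else (if u = p.out then 1 else 0) := by
  have h : Used w k γ (p.vertex + 1) u ↔ u = (if IsUpward k u then p.inn else p.out) := by
    rw [used_succ_iff hu]
    constructor
    · rintro ⟨p', hp', e, h⟩
      rwa [hγ.eq_of_vertex_eq hp' hp e] at h
    · exact fun h => ⟨p, hp, rfl, h⟩
  unfold pathFlow
  rw [h]
  by_cases hup : IsUpward k u <;> simp only [hup, if_true, if_false]

theorem pathFlow_unvisited (hγ : IsRigorousPath w k γ) {q : Fin N} (hq : ∀ p ∈ γ, p.vertex ≠ q)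
    {u : Fin (n + 1)} (hu : OnString w u q) :
    pathFlow w k γ q u = 0 ∧ pathFlow w k γ (q + 1) u = 0 := by
  unfold pathFlow
  rw [if_neg, if_neg]
  · exact ⟨rfl, rfl⟩
  · rw [used_succ_iff hu]
    rintro ⟨p, hp, e, -⟩
    exact hq p hp e
  · rw [used_iff hγ hu]
    rintro ⟨p, hp, e, -⟩
    exact hq p hp e

/-- Counted downward, an arrival contributes 1 above the crossing on a downward string and -1 below
it on an upward one; a departure contributes 1 below or -1 above. In each combination of the two the
totals above and below agree. -/
theorem pathFlow_conserved (hw : IsReducedDecomposition w) (hγ : IsRigorousPath w k γ)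
    (q : Fin N) :
    pathFlow w k γ q (leftString w q) + pathFlow w k γ q (rightString w q) =
      pathFlow w k γ (q + 1) (leftString w q) + pathFlow w k γ (q + 1) (rightString w q) := by
  have hL : OnString w (leftString w q) q := Or.inl rfl
  have hR : OnString w (rightString w q) q := Or.inr rfl
  by_cases hq : ∀ p ∈ γ, p.vertex ≠ q
  · rw [(pathFlow_unvisited hγ hq hL).1, (pathFlow_unvisited hγ hq hL).2,
      (pathFlow_unvisited hγ hq hR).1, (pathFlow_unvisited hγ hq hR).2]
  · push Not at hq
    obtain ⟨p, hp, rfl⟩ := hq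
    have hne := (leftString_lt_rightString hw p.vertex).ne
    have hne' := hne.symm
    rw [pathFlow_above hγ hp hL, pathFlow_above hγ hp hR, pathFlow_below hγ hp hL,
      pathFlow_below hγ hp hR]
    rcases (hγ.on_string p hp).1 with h1 | h1 <;> rcases (hγ.on_string p hp).2 with h2 | h2 <;>
      rw [h1, h2] <;> simp only [hne, hne', if_true, if_false] <;> split_ifs <;> norm_num

/-- The number l + r - t - b is the flow on the left string below the crossing minus the flow on it
above, so it detects a switch and its direction. The inequalities of `IsVertexConfig` beyond the
signs of the jumps express the absence of the bad fragments. -/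
theorem pathFlow_vertex (hw : IsReducedDecomposition w) (hγ : IsRigorousPath w k γ) (q : Fin N)
    {t l r b : ℤ} (h1 : t - l = pathFlow w k γ q (leftString w q))
    (h2 : r - t = pathFlow w k γ q (rightString w q))
    (h3 : b - l = pathFlow w k γ (q + 1) (rightString w q))
    (h4 : r - b = pathFlow w k γ (q + 1) (leftString w q)) :
    IsVertexConfig (IsUpward k (leftString w q)) (IsUpward k (rightString w q)) t l r b ∧
      l + r - t - b = -stringCoeff γ q := by
  have hL : OnString w (leftString w q) q := Or.inl rfl
  have hR : OnString w (rightString w q) q := Or.inr rfl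
  by_cases hq : ∀ p ∈ γ, p.vertex ≠ q
  · rw [(pathFlow_unvisited hγ hq hL).1] at h1
    rw [(pathFlow_unvisited hγ hq hR).1] at h2
    rw [(pathFlow_unvisited hγ hq hR).2] at h3
    rw [(pathFlow_unvisited hγ hq hL).2] at h4
    rw [stringCoeff_of_notMem hq]
    refine ⟨⟨fun _ _ => ?_, fun _ _ => ?_, fun _ _ => ?_⟩, ?_⟩ <;> omega
  · push Not at hq
    obtain ⟨p, hp, rfl⟩ := hq
    have hlt := leftString_lt_rightString hw p.vertex
    have hne := hlt.ne
    have hne' := hne.symm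
    have hbad := hγ.not_bad p hp
    have hup := isUpward_left_of_right hw (k := k) (q := p.vertex)
    rw [stringCoeff_of_mem hγ.nodup hp, Passage.sign]
    rw [pathFlow_above hγ hp hL] at h1
    rw [pathFlow_above hγ hp hR] at h2
    rw [pathFlow_below hγ hp hR] at h3
    rw [pathFlow_below hγ hp hL] at h4
    unfold IsBad at hbad
    unfold IsVertexConfig
    by_cases hl : IsUpward k (leftString w p.vertex) <;>
      by_cases hr : IsUpward k (rightString w p.vertex) <;>
      rcases (hγ.on_string p hp).1 with e1 | e1 <;> rcases (hγ.on_string p hp).2 with e2 | e2 <;>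
      rw [e1, e2] at hbad h1 h2 h3 h4 ⊢ <;>
      simp only [hl, hr, hne, hne', hlt, hlt.not_gt, lt_irrefl, if_true, if_false, true_imp_iff,
        false_imp_iff, not_true, not_false_iff, and_true, true_and, and_false, or_true, or_false,
        imp_false] at hbad hup h1 h2 h3 h4 ⊢ <;> omega

theorem used_last_iff (hγ : IsRigorousPath w k γ)
    (u : Fin (n + 1)) : Used w k γ N u ↔ u = k.castSucc ∨ u = k.succ := by
  constructor
  · rintro ⟨p, hp, hu, -, h⟩
    by_cases hup : IsUpward k u
    · rw [if_pos hup] at hu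
      rcases hγ.start_or hp with ⟨h1, -⟩ | ⟨p', hp', h1, h2⟩
      · exact Or.inl (hu.trans h1)
      · rw [← h1, ← hu] at h2
        rcases h2.2.2 with ⟨-, h3, -⟩ | ⟨h3, -⟩
        · exact absurd ⟨h3, p'.vertex.isLt⟩ (h _ h2.1)
        · exact absurd hup h3
    · rw [if_neg hup] at hu
      rcases hγ.finish_or hp with ⟨h1, -⟩ | ⟨p', hp', h1, h2⟩
      · exact Or.inr (hu.trans h1)
      · rw [← hu] at h2
        rcases h2.2.2 with ⟨h3, -⟩ | ⟨-, h3, -⟩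
        · exact absurd h3 hup
        · exact absurd ⟨h3, p'.vertex.isLt⟩ (h _ h2.2.1)
  · rintro (rfl | rfl)
    · have hs := hγ.start (γ.head hγ.ne_nil) (by simp [List.head?_eq_some_head hγ.ne_nil])
      refine ⟨γ.head hγ.ne_nil, List.head_mem _, ?_, Fin.isLt _, ?_⟩
      · rw [if_pos (isUpward_castSucc k), hs.1]
      · exact fun x hx h => absurd (hs.2.2 x hx) (not_le.2 h.1)
    · have hs := hγ.finish (γ.getLast hγ.ne_nil) (by simp [List.getLast?_eq_some_getLast hγ.ne_nil])
      refine ⟨γ.getLast hγ.ne_nil, List.getLast_mem _, ?_, Fin.isLt _, ?_⟩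
      · rw [if_neg (not_isUpward_succ k), hs.1]
      · exact fun x hx h => absurd (hs.2.2 x hx) (not_le.2 h.1)

theorem chamber_above_eq_zero {χ : ℕ → ℕ → ℤ} (hstep : IsChamberFunction w χ)
    (htop : ∀ g, χ 0 g = 0) {g : ℕ} (hg : g = 0 ∨ n < g) : ∀ l ≤ N, χ l g = 0 := by
  intro l
  induction l with
  | zero => exact fun _ => htop g
  | succ l ih =>
    intro hl
    have h := hstep ⟨l, hl⟩ g (by have := (w ⟨l, hl⟩).isLt; omega)
    simp only at h
    rw [h]
    exact ih (by omega)

/-- Since the longest element reverses the order, the strings `k` and `k + 1` end in the columns n -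
k and n - k - 1. Their jumps -1 and 1 therefore enclose just the gap n - k. -/
theorem bottom_of_jumps {χ : ℕ → ℕ → ℤ} (hw : IsReducedDecomposition w)
    (hstep : IsChamberFunction w χ) (htop : ∀ g, χ 0 g = 0)
    (hj : ∀ c : Fin (n + 1), χ N (c + 1) - χ N c =
      if arrangement w N c = k.castSucc then -1 else if arrangement w N c = k.succ then 1 else 0) :
    ∀ g, χ N g = if g = n - k.val then 1 else 0 := by
  have hk := k.isLt
  intro g
  by_cases hg : n < g
  · rw [chamber_above_eq_zero hstep htop (Or.inr hg) N le_rfl, if_neg (by omega)]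
  induction g with
  | zero => rw [chamber_above_eq_zero hstep htop (Or.inl rfl) N le_rfl, if_neg (by omega)]
  | succ g ih =>
    have ih := ih (by omega)
    have h := hj ⟨g, by omega⟩
    rw [arrangement_last hw] at h
    simp only [Fin.revPerm_apply, Fin.ext_iff, Fin.val_rev, Fin.val_castSucc, Fin.val_succ] at h
    split_ifs at * <;> omega

/-- The chambers to the left of a rigorous path. -/
theorem exists_isInterior_of_path (hw : IsReducedDecomposition w) (hγ : IsRigorousPath w k γ) :
    ∃ χ, IsInterior w k χ ∧ chamberExponent w χ = -stringCoeff γ ∧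
      ∀ l ≤ N, ∀ c : Fin (n + 1), χ l (c + 1) - χ l c = pathFlow w k γ l (arrangement w l c) := by
  obtain ⟨χ, hstep, htop, hedge⟩ := exists_chamberFunction w (pathFlow w k γ)
    (fun u => if_neg (not_used_zero u))
    (fun q u hu => by
      unfold pathFlow
      rw [used_succ_of_not_onString hγ hu]) (pathFlow_conserved hw hγ)
  have hv : ∀ q : Fin N, _ := fun q => pathFlow_vertex hw hγ q
    (t := χ q (w q + 1)) (l := χ q (w q)) (r := χ q (w q + 2)) (b := χ (q + 1) (w q + 1))
    (hedge q q.isLt.le (w q).castSucc) (hedge q q.isLt.le (w q).succ)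
    (by
      have := hedge (q + 1) q.isLt (w q).castSucc
      rw [arrangement_succ_left, Fin.val_castSucc, hstep q (w q) (by omega)] at this
      exact this)
    (by
      have := hedge (q + 1) q.isLt (w q).succ
      rw [arrangement_succ_right, Fin.val_succ, hstep q (w q + 1 + 1) (by omega)] at this
      exact this)
  refine ⟨χ, ⟨hstep, htop, bottom_of_jumps hw hstep htop fun c => ?_, fun q => (hv q).1⟩,
    funext fun q => (hv q).2, hedge⟩
  rw [hedge N le_rfl, pathFlow, used_last_iff hγ]
  have hne : k.succ ≠ k.castSucc := (Fin.castSucc_lt_succ).ne'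
  by_cases h1 : arrangement w N c = k.castSucc
  · rw [h1]; simp [isUpward_castSucc]
  · by_cases h2 : arrangement w N c = k.succ
    · rw [h2]; simp [not_isUpward_succ, hne]
    · simp [h1, h2]

end PathToChambers

/-- A partial injection of a finite type without cycles through `s` has a maximal orbit. -/
theorem exists_maximal_chain {α : Type*} [Finite α] {R : α → α → Prop} {s : α}
    (hinj : ∀ x y z, R x z → R y z → x = y) (hs : ∀ x, ¬ R x s) :
    ∃ l : List α, l.head? = some s ∧ l.IsChain R ∧ l.Nodup ∧ ∀ x ∈ l.getLast?, ∀ y, ¬ R x y := by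
  classical
  have := Fintype.ofFinite α
  by_contra hcon
  push Not at hcon
  -- If no chain from `s` were maximal, duplicate-free chains of every length would exist, against
  -- finiteness.
  have key : ∀ m : ℕ, ∃ l : List α, l.length = m + 1 ∧ l.head? = some s ∧ l.IsChain R ∧
      l.Nodup := by
    intro m
    induction m with
    | zero => exact ⟨[s], by simp⟩
    | succ m ih =>
      obtain ⟨l, hlen, hh, hc, hn⟩ := ih
      obtain ⟨x, hx, y, hxy⟩ := hcon l hh hc hn
      -- A repeated `y` would either be `s`, which has no predecessor, or have a predecessor in the
      -- chain before its last element, against injectivity.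
      have hy : y ∉ l := by
        intro hy
        rcases l.eq_nil_or_concat with rfl | ⟨l', z, rfl⟩
        · simp at hh
        · simp only [List.concat_eq_append] at *
          obtain rfl : z = x := by simpa using hx
          have hmem : ∀ a ∈ (l' ++ [z]), a = s ∨ ∃ b ∈ l', R b a := by
            intro a ha
            obtain ⟨i, hi, rfl⟩ := List.getElem_of_mem ha
            rcases i with _ | i
            · left
              rw [List.head?_eq_getElem?, List.getElem?_eq_getElem hi] at hh
              simpa using hh
            · right
              have h1 := List.isChain_iff_getElem.1 hc i hi
              have hi' : i < l'.length := by simpa using hi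
              refine ⟨l'[i], List.getElem_mem _, ?_⟩
              simpa [List.getElem_append_left hi'] using h1
          rcases hmem y hy with rfl | ⟨b, hb, hby⟩
          · exact hs _ hxy
          · rw [hinj _ _ _ hby hxy] at hb
            rw [List.nodup_append] at hn
            exact hn.2.2 z hb z (by simp) rfl
      refine ⟨l ++ [y], by simp [hlen], ?_, ?_, ?_⟩
      · rw [List.head?_append, hh]; rfl
      · rw [List.isChain_append]
        refine ⟨hc, by simp, ?_⟩
        intro a ha b hb
        obtain rfl : y = b := by simpa using hb
        rw [Option.mem_def] at ha hx
        rw [hx] at ha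
        cases ha
        exact hxy
      · rw [List.nodup_append]
        refine ⟨hn, by simp, ?_⟩
        rintro a ha b hb rfl
        obtain rfl : a = y := by simpa using hb
        exact hy ha
  obtain ⟨l, hlen, -, -, hn⟩ := key (Fintype.card α)
  have := hn.length_le_card
  omega

/-! ### From chamber functions back to rigorous paths -/

section ChambersToPath

variable {n N : ℕ} {w : Fin N → Fin n} {k : Fin n} {χ : ℕ → ℕ → ℤ}

instance : Finite (Passage n N) :=
  Finite.of_injective (fun p => (p.vertex, p.inn, p.out)) (by
    rintro ⟨a, b, c⟩ ⟨a', b', c'⟩ h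
    simpa using h)

/-- The jump of a function on chambers across the string `u`. -/
def jump (w : Fin N → Fin n) (χ : ℕ → ℕ → ℤ) (l : ℕ) (u : Fin (n + 1)) : ℤ :=
  χ l ((arrangement w l).symm u + 1) - χ l ((arrangement w l).symm u)

theorem jump_arrangement (l : ℕ) (c : Fin (n + 1)) :
    jump w χ l (arrangement w l c) = χ l (c + 1) - χ l c := by
  simp [jump]

theorem jump_left (q : Fin N) :
    jump w χ q (leftString w q) = χ q (w q + 1) - χ q (w q) :=
  jump_arrangement (w := w) (χ := χ) q (w q).castSucc

theorem jump_right (q : Fin N) :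
    jump w χ q (rightString w q) = χ q (w q + 2) - χ q (w q + 1) :=
  jump_arrangement (w := w) (χ := χ) q (w q).succ

theorem jump_succ_right (hχ : IsChamberFunction w χ) (q : Fin N) :
    jump w χ (q + 1) (rightString w q) = χ (q + 1) (w q + 1) - χ q (w q) := by
  have := jump_arrangement (w := w) (χ := χ) (q + 1) (w q).castSucc
  rwa [arrangement_succ_left, Fin.val_castSucc, hχ q (w q) (by omega)] at this

theorem jump_succ_left (hχ : IsChamberFunction w χ) (q : Fin N) :
    jump w χ (q + 1) (leftString w q) = χ q (w q + 2) - χ (q + 1) (w q + 1) := by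
  have := jump_arrangement (w := w) (χ := χ) (q + 1) (w q).succ
  rwa [arrangement_succ_right, Fin.val_succ, hχ q (w q + 1 + 1) (by omega)] at this

theorem jump_succ_of_not_onString (hχ : IsChamberFunction w χ) {q : Fin N} {u : Fin (n + 1)}
    (hu : ¬ OnString w u q) : jump w χ (q + 1) u = jump w χ q u := by
  obtain ⟨c, rfl⟩ := (arrangement w q).surjective u
  rw [onString_iff_arrangement, not_or] at hu
  rw [jump_arrangement, ← arrangement_succ_other w q c hu.1 hu.2, jump_arrangement, hχ, hχ]
  · intro e; apply hu.2; ext; simpa using e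
  · intro e; apply hu.1; ext; simpa using e

theorem jump_eq_of_forall_not_onString (hχ : IsChamberFunction w χ) {u : Fin (n + 1)} {l l' : ℕ}
    (hl : l ≤ l') (hl' : l' ≤ N) (h : ∀ x : Fin N, OnString w u x → ¬ (l ≤ x.val ∧ x.val < l')) :
    jump w χ l' u = jump w χ l u := by
  induction l', hl using Nat.le_induction with
  | base => rfl
  | succ m hm ih =>
    rw [← ih (by omega) (fun x hx hx' => h x hx ⟨hx'.1, by omega⟩)]
    exact jump_succ_of_not_onString hχ (q := ⟨m, hl'⟩) fun hu => h _ hu ⟨hm, by simp⟩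

theorem IsInterior.jump_last (hw : IsReducedDecomposition w) (hχ : IsInterior w k χ)
    (u : Fin (n + 1)) :
    jump w χ N u = if u = k.castSucc then -1 else if u = k.succ then 1 else 0 := by
  obtain ⟨c, rfl⟩ := (arrangement w N).surjective u
  have := k.isLt
  have := c.isLt
  rw [jump_arrangement, hχ.bottom, hχ.bottom, arrangement_last hw]
  simp only [Fin.revPerm_apply, Fin.ext_iff, Fin.val_rev, Fin.val_castSucc, Fin.val_succ]
  split_ifs <;> omega

theorem jump_zero (hχ : ∀ g, χ 0 g = 0) (u : Fin (n + 1)) : jump w χ 0 u = 0 := by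
  simp [jump, hχ]

open Classical in
/-- A path that follows the jumps of `χ` arrives at the crossing `q` along the string `u`. -/
def Enters (w : Fin N → Fin n) (k : Fin n) (χ : ℕ → ℕ → ℤ) (q : Fin N) (u : Fin (n + 1)) : Prop :=
  OnString w u q ∧ (if IsUpward k u then jump w χ (q + 1) u ≠ 0 else jump w χ q u ≠ 0)

open Classical in
/-- A path that follows the jumps of `χ` leaves the crossing `q` along the string `u`. -/
def Leaves (w : Fin N → Fin n) (k : Fin n) (χ : ℕ → ℕ → ℤ) (q : Fin N) (u : Fin (n + 1)) : Prop :=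
  OnString w u q ∧ (if IsUpward k u then jump w χ q u ≠ 0 else jump w χ (q + 1) u ≠ 0)

/-- The passages of a path that follows the jumps of `χ`. -/
def IsPassageOf (w : Fin N → Fin n) (k : Fin n) (χ : ℕ → ℕ → ℤ) (p : Passage n N) : Prop :=
  Enters w k χ p.vertex p.inn ∧ Leaves w k χ p.vertex p.out

/-- This is read off from the table of the 0/1 values around a crossing in the three possible
orientation patterns: the local condition leaves at most one way in and one way out, and it rules
out the bad fragments. -/
theorem IsInterior.vertex_passages (hw : IsReducedDecomposition w) (hχ : IsInterior w k χ)
    (q : Fin N) :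
    (∀ u u', Enters w k χ q u → Enters w k χ q u' → u = u') ∧
    (∀ u u', Leaves w k χ q u → Leaves w k χ q u' → u = u') ∧
    (∀ u, Enters w k χ q u → ∃ u', Leaves w k χ q u') ∧
    (∀ u u', Enters w k χ q u → Leaves w k χ q u' → ¬ IsBad w k ⟨q, u, u'⟩) := by
  have hv := hχ.vertex q
  have h1 := hχ.mem hw q.isLt.le (w q)
  have h2 := hχ.mem hw q.isLt.le (w q + 1)
  have h3 := hχ.mem hw q.isLt.le (w q + 2)
  have h4 : χ (q + 1) (w q + 1) = 0 ∨ χ (q + 1) (w q + 1) = 1 := hχ.mem hw q.isLt (w q + 1)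
  have hup := isUpward_left_of_right hw (k := k) (q := q)
  have hne := (leftString_lt_rightString hw q).ne
  have e1 := jump_left (w := w) (χ := χ) q
  have e2 := jump_right (w := w) (χ := χ) q
  have e3 := jump_succ_left hχ.step q
  have e4 := jump_succ_right hχ.step q
  have oL : OnString w (leftString w q) q := Or.inl rfl
  have oR : OnString w (rightString w q) q := Or.inr rfl
  suffices h : ¬ (Enters w k χ q (leftString w q) ∧ Enters w k χ q (rightString w q)) ∧
      ¬ (Leaves w k χ q (leftString w q) ∧ Leaves w k χ q (rightString w q)) ∧
      (Enters w k χ q (leftString w q) ∨ Enters w k χ q (rightString w q) →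
        Leaves w k χ q (leftString w q) ∨ Leaves w k χ q (rightString w q)) ∧
      (IsUpward k (leftString w q) → IsUpward k (rightString w q) →
        ¬ (Enters w k χ q (leftString w q) ∧ Leaves w k χ q (leftString w q))) ∧
      (¬ IsUpward k (leftString w q) → ¬ IsUpward k (rightString w q) →
        ¬ (Enters w k χ q (rightString w q) ∧ Leaves w k χ q (rightString w q))) by
    obtain ⟨a1, a2, a3, a4, a5⟩ := h
    refine ⟨?_, ?_, ?_, ?_⟩
    · intro u u' hu hu'
      rcases hu.1 with rfl | rfl <;> rcases hu'.1 with rfl | rfl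
      exacts [rfl, (a1 ⟨hu, hu'⟩).elim, (a1 ⟨hu', hu⟩).elim, rfl]
    · intro u u' hu hu'
      rcases hu.1 with rfl | rfl <;> rcases hu'.1 with rfl | rfl
      exacts [rfl, (a2 ⟨hu, hu'⟩).elim, (a2 ⟨hu', hu⟩).elim, rfl]
    · intro u hu
      have : Leaves w k χ q (leftString w q) ∨ Leaves w k χ q (rightString w q) := by
        apply a3
        rcases hu.1 with rfl | rfl
        exacts [Or.inl hu, Or.inr hu]
      rcases this with h | h <;> exact ⟨_, h⟩
    · intro u u' hu hu' hb
      simp only [IsBad] at hb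
      obtain ⟨rfl, ⟨rfl, b2, b3⟩ | ⟨rfl, b2, b3⟩⟩ := hb
      · exact a4 b2 b3 ⟨hu, hu'⟩
      · exact a5 b3 b2 ⟨hu, hu'⟩
  unfold IsVertexConfig at hv
  unfold Enters Leaves
  simp only [e1, e2, e3, e4, oL, oR, true_and]
  generalize χ q (w q) = a at *
  generalize χ q (w q + 1) = b at *
  generalize χ q (w q + 2) = c at *
  generalize χ (q + 1) (w q + 1) = d at *
  by_cases hl : IsUpward k (leftString w q) <;> by_cases hr : IsUpward k (rightString w q) <;>
    simp only [hl, hr, if_true, if_false, true_imp_iff, false_imp_iff, not_true, not_false_iff,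
      and_true, true_and, imp_false] at hv hup ⊢ <;>
    rcases h1 with rfl | rfl <;> rcases h2 with rfl | rfl <;> rcases h3 with rfl | rfl <;>
    rcases h4 with rfl | rfl <;> first | exact absurd hv (by decide) | decide

theorem IsNext.pred_unique {u : Fin (n + 1)} {q q' r : Fin N} (h : IsNext w k u q r)
    (h' : IsNext w k u q' r) : q = q' := by
  rcases h with ⟨a1, a2, ⟨a3, a4, a5⟩ | ⟨a3, a4, a5⟩⟩ <;>
    rcases h' with ⟨b1, b2, ⟨b3, b4, b5⟩ | ⟨b3, b4, b5⟩⟩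
  · rcases lt_trichotomy q q' with h | h | h
    · exact absurd ⟨a4, h⟩ (b5 q a1)
    · exact h
    · exact absurd ⟨b4, h⟩ (a5 q' b1)
  · exact absurd a3 b3
  · exact absurd b3 a3
  · rcases lt_trichotomy q q' with h | h | h
    · exact absurd ⟨h, b4⟩ (a5 q' b1)
    · exact h
    · exact absurd ⟨h, a4⟩ (b5 q a1)

theorem exists_last_below {P : Fin N → Prop} {l : ℕ} (h : ∃ x, P x ∧ x.val < l) :
    ∃ x, P x ∧ x.val < l ∧ ∀ y, P y → ¬ (x < y ∧ y.val < l) := by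
  classical
  obtain ⟨x, hx⟩ := h
  obtain ⟨m, hm, hmax⟩ := Finset.exists_max_image
    (Finset.univ.filter fun x : Fin N => P x ∧ x.val < l)
    id ⟨x, by simpa using hx⟩
  simp only [Finset.mem_filter, Finset.mem_univ, true_and, id] at hm hmax
  exact ⟨m, hm.1, hm.2, fun y hy h => absurd (hmax y ⟨hy, h.2⟩) (not_le.2 h.1)⟩

theorem exists_first_above {P : Fin N → Prop} {l : ℕ} (h : ∃ x, P x ∧ l ≤ x.val) :
    ∃ x, P x ∧ l ≤ x.val ∧ ∀ y, P y → ¬ (l ≤ y.val ∧ y < x) := by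
  classical
  obtain ⟨x, hx⟩ := h
  obtain ⟨m, hm, hmax⟩ := Finset.exists_min_image
    (Finset.univ.filter fun x : Fin N => P x ∧ l ≤ x.val)
    id ⟨x, by simpa using hx⟩
  simp only [Finset.mem_filter, Finset.mem_univ, true_and, id] at hm hmax
  exact ⟨m, hm.1, hm.2, fun y hy h => absurd (hmax y ⟨hy, h.1⟩) (not_le.2 h.2)⟩

/-- A string with a jump at the level `l` has a crossing above, and its last crossing above `l`
sees the same jump. -/
theorem exists_crossing_above (hχ : IsChamberFunction w χ) (htop : ∀ g, χ 0 g = 0)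
    {u : Fin (n + 1)} {l : ℕ} (hl : l ≤ N) (h : jump w χ l u ≠ 0) :
    ∃ x, OnString w u x ∧ x.val < l ∧ (∀ y, OnString w u y → ¬ (x < y ∧ y.val < l)) ∧
      jump w χ (x + 1) u = jump w χ l u := by
  have : ∃ x, OnString w u x ∧ x.val < l := by
    by_contra! hcon
    apply h
    rw [jump_eq_of_forall_not_onString hχ (Nat.zero_le l) hl, jump_zero htop]
    exact fun x hx hx' => absurd hx'.2 (not_lt.2 (hcon x hx))
  obtain ⟨x, hx, hxl, hlast⟩ := exists_last_below this
  refine ⟨x, hx, hxl, hlast, ?_⟩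
  rw [jump_eq_of_forall_not_onString hχ (l := x + 1) (l' := l) hxl hl]
  exact fun y hy hy' => hlast y hy ⟨Fin.lt_def.2 hy'.1, hy'.2⟩

theorem IsInterior.exists_passage (hw : IsReducedDecomposition w) (hχ : IsInterior w k χ)
    {q : Fin N} {u : Fin (n + 1)} (h : Enters w k χ q u) :
    ∃ p, IsPassageOf w k χ p ∧ p.vertex = q ∧ p.inn = u := by
  obtain ⟨u', hu'⟩ := (hχ.vertex_passages hw q).2.2.1 u h
  exact ⟨⟨q, u, u'⟩, ⟨h, hu'⟩, rfl, rfl⟩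

theorem IsInterior.eq_of_vertex_eq (hw : IsReducedDecomposition w) (hχ : IsInterior w k χ)
    {p p' : Passage n N} (h : IsPassageOf w k χ p) (h' : IsPassageOf w k χ p')
    (e : p.vertex = p'.vertex) : p = p' := by
  obtain ⟨q, a, b⟩ := p
  obtain ⟨q', a', b'⟩ := p'
  obtain rfl : q = q' := e
  have hv := hχ.vertex_passages hw q
  rw [hv.1 a a' h.1 h'.1, hv.2.1 b b' h.2 h'.2]

/-- A path that follows the jumps of `χ` can be continued until it reaches the lower end of
the string after the `k`-th one. -/
theorem IsInterior.exists_next (hw : IsReducedDecomposition w) (hχ : IsInterior w k χ)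
    {p : Passage n N} (h : IsPassageOf w k χ p) :
    (p.out = k.succ ∧ IsLowest w k.succ p.vertex) ∨
      ∃ p', IsPassageOf w k χ p' ∧ p'.inn = p.out ∧ IsNext w k p.out p.vertex p'.vertex := by
  obtain ⟨q, a, u⟩ := p
  obtain ⟨hu, hj⟩ := h.2
  simp only at hu hj ⊢
  by_cases hup : IsUpward k u
  · rw [if_pos hup] at hj
    obtain ⟨x, hx, hxl, hlast, hjx⟩ := exists_crossing_above hχ.step hχ.top q.isLt.le hj
    obtain ⟨p', hp', rfl, rfl⟩ := hχ.exists_passage hw (q := x) (u := u)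
      ⟨hx, by rw [if_pos hup, hjx]; exact hj⟩
    exact Or.inr ⟨p', hp', rfl, hu, hx, Or.inl ⟨hup, hxl, hlast⟩⟩
  · rw [if_neg hup] at hj
    by_cases hex : ∃ x, OnString w u x ∧ q.val + 1 ≤ x.val
    · obtain ⟨x, hx, hxl, hfirst⟩ := exists_first_above hex
      have hjx : jump w χ x u = jump w χ (q + 1) u :=
        jump_eq_of_forall_not_onString hχ.step hxl x.isLt.le fun y hy hy' =>
          hfirst y hy hy'
      obtain ⟨p', hp', rfl, rfl⟩ := hχ.exists_passage hw (q := x) (u := u)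
        ⟨hx, by rw [if_neg hup, hjx]; exact hj⟩
      exact Or.inr ⟨p', hp', rfl, hu, hx, Or.inr ⟨hup, hxl, fun y hy hy' => hfirst y hy hy'⟩⟩
    · left
      push Not at hex
      have hjN : jump w χ N u = jump w χ (q + 1) u :=
        jump_eq_of_forall_not_onString hχ.step q.isLt le_rfl fun y hy hy' =>
          absurd hy'.1 (not_le.2 (hex y hy))
      rw [hχ.jump_last hw] at hjN
      have hk : u ≠ k.castSucc := by
        rintro rfl
        exact hup (isUpward_castSucc k)
      rw [if_neg hk] at hjN
      have hu' : u = k.succ := by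
        by_contra hne
        rw [if_neg hne] at hjN
        exact hj hjN.symm
      exact ⟨hu', hu' ▸ ⟨hu, fun r hr => Fin.le_def.2 (by have := hex r hr; omega)⟩⟩

/-- Start at the lower end of the string `k`, where the bottom values force a jump, and follow the
jumps. Every passage determines its predecessor and nothing precedes the start, so the walk cannot
close up; by `IsInterior.exists_next` it can stop only at the lower end of the next string. -/
theorem IsInterior.exists_path (hw : IsReducedDecomposition w) (hχ : IsInterior w k χ) :
    ∃ γ, IsRigorousPath w k γ ∧ ∀ p ∈ γ, IsPassageOf w k χ p := by
  obtain ⟨s, hs, hsv, hsin⟩ : ∃ p, IsPassageOf w k χ p ∧ IsLowest w k.castSucc p.vertex ∧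
      p.inn = k.castSucc := by
    have hj : jump w χ N k.castSucc ≠ 0 := by rw [hχ.jump_last hw]; simp
    obtain ⟨x, hx, -, hlast, hjx⟩ := exists_crossing_above hχ.step hχ.top le_rfl hj
    obtain ⟨p, hp, rfl, hpi⟩ := hχ.exists_passage hw (q := x) (u := k.castSucc)
      ⟨hx, by rw [if_pos (isUpward_castSucc k), hjx]; exact hj⟩
    refine ⟨p, hp, ⟨hx, fun r hr => ?_⟩, hpi⟩
    by_contra hlt
    exact hlast r hr ⟨not_le.1 hlt, r.isLt⟩
  obtain ⟨γ, hhead, hchain, hnodup, hlast⟩ := exists_maximal_chain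
    (R := fun p p' : Passage n N => IsPassageOf w k χ p ∧ IsPassageOf w k χ p' ∧
      p'.inn = p.out ∧ IsNext w k p.out p.vertex p'.vertex) (s := s)
    (by
      rintro x y z ⟨a1, -, a2, a3⟩ ⟨b1, -, b2, b3⟩
      rw [← a2] at a3
      rw [← b2] at b3
      exact hχ.eq_of_vertex_eq hw a1 b1 (a3.pred_unique b3))
    (by
      rintro x ⟨-, -, a2, a3⟩
      rw [← a2, hsin] at a3
      rcases a3.2.2 with ⟨-, h, -⟩ | ⟨h, -⟩
      · exact absurd (hsv.2 _ a3.1) (not_le.2 h)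
      · exact h (isUpward_castSucc k))
  have hV : ∀ p ∈ γ, IsPassageOf w k χ p := by
    intro p hp
    rcases mem_head_or_of_isChain hchain hp with h | ⟨y, -, -, h, -⟩
    · rw [hhead] at h
      obtain rfl : s = p := by simpa using h
      exact hs
    · exact h
  refine ⟨γ, ⟨?_, ?_, ?_, ?_, ?_, ?_, ?_⟩, hV⟩
  · rintro rfl
    simp at hhead
  · intro p hp
    rw [hhead] at hp
    obtain rfl : s = p := by simpa using hp
    exact ⟨hsin, hsv⟩
  · intro p hp
    have hp' := hV p (List.mem_of_getLast? hp)
    rcases hχ.exists_next hw hp' with h | ⟨p', h1, h2, h3⟩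
    · exact h
    · exact absurd ⟨hp', h1, h2, h3⟩ (hlast p hp p')
  · exact fun p hp => ⟨(hV p hp).1.1, (hV p hp).2.1⟩
  · exact hchain.imp fun p p' h => h.2.2
  · exact List.Nodup.map_on
      (fun p hp p' hp' e => hχ.eq_of_vertex_eq hw (hV p hp) (hV p' hp') e) hnodup
  · exact fun p hp => (hχ.vertex_passages hw p.vertex).2.2.2 _ _ (hV p hp).1 (hV p hp).2

theorem IsInterior.jump_up (hw : IsReducedDecomposition w) (hχ : IsInterior w k χ)
    {l : ℕ} (hl : l ≤ N) {u : Fin (n + 1)} :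
    (IsUpward k u → jump w χ l u ≤ 0) ∧ (¬ IsUpward k u → 0 ≤ jump w χ l u) := by
  by_cases h0 : jump w χ l u = 0
  · simp [h0]
  · obtain ⟨x, hx, -, -, hj⟩ := exists_crossing_above hχ.step hχ.top hl h0
    rw [← hj]
    have hm := hχ.isMonotoneAt hw x
    have e3 := jump_succ_left hχ.step x
    have e4 := jump_succ_right hχ.step x
    rcases hx with rfl | rfl
    · have h1 := hm.left_up
      have h2 := hm.left_down
      constructor <;> intro h
      · have := h1 h; omega
      · have := h2 h; omega
    · have h1 := hm.right_up
      have h2 := hm.right_down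
      constructor <;> intro h
      · have := h1 h; omega
      · have := h2 h; omega

/-- The rigorous paths correspond to their interiors. -/
theorem IsInterior.exists_path_exponent (hw : IsReducedDecomposition w) (hχ : IsInterior w k χ) :
    ∃ γ, IsRigorousPath w k γ ∧ chamberExponent w χ = -stringCoeff γ := by
  obtain ⟨γ, hγ, hV⟩ := hχ.exists_path hw
  obtain ⟨ψ, hψ, hexp, hedge⟩ := exists_isInterior_of_path hw hγ
  refine ⟨γ, hγ, ?_⟩
  rw [← hexp]
  have hused : ∀ l ≤ N, ∀ u, Used w k γ l u → jump w χ l u ≠ 0 := by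
    rintro l hl u ⟨p, hp, hu, hlt, h⟩
    rw [jump_eq_of_forall_not_onString hχ.step (l := p.vertex + 1) (l' := l) hlt hl
      fun y hy hy' => h y hy ⟨Fin.lt_def.2 hy'.1, hy'.2⟩]
    have := hV p hp
    by_cases hup : IsUpward k u
    · rw [if_pos hup] at hu
      subst hu
      have := this.1.2
      rwa [if_pos hup] at this
    · rw [if_neg hup] at hu
      subst hu
      have := this.2.2
      rwa [if_neg hup] at this
  -- A priori `χ` could have further closed loops of jumps that the path misses. The difference `δ`
  -- carries just those; its jumps still respect the orientation and it vanishes at the top and the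
  -- bottom, so the minimum and maximum principles make it zero.
  let δ : ℕ → ℕ → ℤ := fun l g => χ l g - ψ l g
  have hδs : IsChamberFunction w δ := fun q g hg => by
    simp only [δ, hχ.step q g hg, hψ.step q g hg]
  have hjump : ∀ l ≤ N, ∀ u,
      (IsUpward k u → jump w δ l u ≤ 0) ∧ (¬ IsUpward k u → 0 ≤ jump w δ l u) := by
    intro l hl u
    have h1 := hχ.jump_up hw hl (u := u)
    have h2 := hused l hl u
    have h3 : jump w δ l u = jump w χ l u - pathFlow w k γ l u := by
      obtain ⟨c, rfl⟩ := (arrangement w l).surjective u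
      rw [jump_arrangement, jump_arrangement, ← hedge l hl c]
      simp only [δ]
      ring
    rw [h3]
    unfold pathFlow
    by_cases hup : IsUpward k u <;> by_cases hus : Used w k γ l u <;>
      simp only [hup, hus, if_true, if_false, true_imp_iff, false_imp_iff, not_true,
        not_false_iff, and_true, true_and] at h1 h2 ⊢ <;> omega
  have hδm : ∀ q, IsMonotoneAt w k δ q := by
    intro q
    have e1 := jump_left (w := w) (χ := δ) q
    have e2 := jump_right (w := w) (χ := δ) q
    have e3 := jump_succ_left hδs q
    have e4 := jump_succ_right hδs q
    have a := hjump q q.isLt.le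
    have b := hjump (q + 1) q.isLt
    constructor <;> intro h
    · have := (a _).1 h; have := (b _).1 h; omega
    · have := (a _).2 h; have := (b _).2 h; omega
    · have := (a _).1 h; have := (b _).1 h; omega
    · have := (a _).2 h; have := (b _).2 h; omega
  have h1 := nonneg_of_isMonotoneAt hw hδs hδm (fun g => by simp [δ, hχ.top, hψ.top])
  have h2 := le_of_isMonotoneAt hw hδs hδm (b := 0) (fun g => by simp [δ, hχ.bottom, hψ.bottom])
  have heq : ∀ l ≤ N, ∀ g, χ l g = ψ l g := by
    intro l hl g
    have := h1 l hl g
    have := h2 l hl g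
    simp only [δ] at *
    omega
  funext q
  unfold chamberExponent
  rw [heq q q.isLt.le, heq q q.isLt.le, heq q q.isLt.le, heq (q + 1) q.isLt]

/-- This replaces the global notion of a rigorous path by conditions at the single crossings, which
is what makes a 3-move a local problem. -/
theorem mem_stringExponents_iff (hw : IsReducedDecomposition w) {m : Fin N → ℤ} :
    m ∈ stringExponents w ↔ ∃ k χ, IsInterior w k χ ∧ m = chamberExponent w χ := by
  constructor
  · rintro ⟨k, γ, hγ, rfl⟩
    obtain ⟨χ, hχ, he, -⟩ := exists_isInterior_of_path hw hγ
    exact ⟨k, χ, hχ, he.symm⟩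
  · rintro ⟨k, χ, hχ, rfl⟩
    obtain ⟨γ, hγ, he⟩ := hχ.exists_path_exponent hw
    exact ⟨k, γ, hγ, he⟩

end ChambersToPath

/-! ### Finite verification of a 3-move on the values around the triangle -/

section LocalMove

instance (lu ru : Prop) [Decidable lu] [Decidable ru] (t l r b : ℤ) :
    Decidable (IsVertexConfig lu ru t l r b) := by
  unfold IsVertexConfig; infer_instance

/-- Three crossings of three strings `α, β, γ`, the first and the last of them between the first two
columns: `a, b, c, d` and `a, b', c', d` are the values in the gaps above and below, and `x` is the
value in the small chamber. -/
def IsLowConfig (α β γ : Prop) (a b c d b' c' x : ℤ) : Prop :=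
  IsVertexConfig α β b a c x ∧ IsVertexConfig α γ c x d c' ∧ IsVertexConfig β γ x a c' b'

/-- Three crossings of three strings `α, β, γ`, the first and the last of them between the last two
columns. -/
def IsHighConfig (α β γ : Prop) (a b c d b' c' x : ℤ) : Prop :=
  IsVertexConfig β γ c b d x ∧ IsVertexConfig α γ b a x b' ∧ IsVertexConfig α β x b' d c'

/-- The exponents at the three crossings of a low configuration. -/
def lowTriple (a b c d b' c' x : ℤ) : ℤ × ℤ × ℤ :=
  (a + c - b - x, x + d - c - c', a + c' - x - b')

/-- The exponents at the three crossings of a high configuration. -/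
def highTriple (a b c d b' c' x : ℤ) : ℤ × ℤ × ℤ :=
  (b + d - c - x, a + x - b - b', b' + d - x - c')

instance (α β γ : Prop) [Decidable α] [Decidable β] [Decidable γ] (a b c d b' c' x : ℤ) :
    Decidable (IsLowConfig α β γ a b c d b' c' x) := by
  unfold IsLowConfig; infer_instance

instance (α β γ : Prop) [Decidable α] [Decidable β] [Decidable γ] (a b c d b' c' x : ℤ) :
    Decidable (IsHighConfig α β γ a b c d b' c' x) := by
  unfold IsHighConfig; infer_instance

/-- The exponents at the three places of a 3-move that occur in string inequalities. -/
def IsMovable (m : ℤ × ℤ × ℤ) : Prop :=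
  m.1 = m.2.2 ∨ (m.1 = 0 ∧ m.2.2 = 1 ∧ m.2.1 ≤ 0) ∨ (m.1 = -1 ∧ m.2.2 = 0 ∧ 0 ≤ m.2.1) ∨
    (m.2.1 = 0 ∧ m.1 = m.2.2 + 1)

/-- The exponents at the three places of a 3-move, before and after the move. -/
def TripleMove (m m' : ℤ × ℤ × ℤ) : Prop :=
  (m.1 = m.2.2 ∧ m' = (m.2.1, m.1, m.2.1)) ∨ (m.1 = 0 ∧ m.2.2 = 1 ∧ m' = (m.2.1 + 1, 0, m.2.1)) ∨
    (m.1 = -1 ∧ m.2.2 = 0 ∧ m' = (m.2.1, 0, m.2.1 - 1)) ∨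
    (m.1 = m.2.2 + 1 ∧ (m' = (0, m.2.2, 1) ∨ m' = (-1, m.1, 0)))

instance (m : ℤ × ℤ × ℤ) : Decidable (IsMovable m) := by
  unfold IsMovable; infer_instance

/-- The results of a 3-move. -/
def tripleMoves (m : ℤ × ℤ × ℤ) : List (ℤ × ℤ × ℤ) :=
  if m.1 = m.2.2 then [(m.2.1, m.1, m.2.1)]
  else if m.1 = 0 ∧ m.2.2 = 1 then [(m.2.1 + 1, 0, m.2.1)]
  else if m.1 = -1 ∧ m.2.2 = 0 then [(m.2.1, 0, m.2.1 - 1)]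
  else [(0, m.2.2, 1), (-1, m.1, 0)]

theorem TripleMove.mem {m m' : ℤ × ℤ × ℤ} (h : TripleMove m m') : m' ∈ tripleMoves m := by
  unfold tripleMoves
  rcases h with ⟨h1, rfl⟩ | ⟨h1, h2, rfl⟩ | ⟨h1, h2, rfl⟩ | ⟨h1, h2⟩
  · simp [h1]
  · simp [h1, h2]
  · simp [h1, h2]
  · rw [if_neg (by omega), if_neg (by omega), if_neg (by omega)]
    rcases h2 with rfl | rfl <;> simp

-- The implications between `γ`, `β`, `α` say that the upward strings form an initial segment of the
-- labels. The six values around the triangle are kept and only the value in the small chamber may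
-- change. When the list of moves has two members, they are realized by different choices of this
-- value.
set_option synthInstance.maxSize 2000 in
set_option synthInstance.maxHeartbeats 200000 in
theorem low_to_high_bool : ∀ α β γ a b c d b' c' x : Bool, (γ → β) → (β → α) →
    IsLowConfig α β γ a.toInt b.toInt c.toInt d.toInt b'.toInt c'.toInt x.toInt →
    IsMovable (lowTriple a.toInt b.toInt c.toInt d.toInt b'.toInt c'.toInt x.toInt) ∧
    ∀ m' ∈ tripleMoves (lowTriple a.toInt b.toInt c.toInt d.toInt b'.toInt c'.toInt x.toInt),
      ∃ x' : Bool, IsHighConfig α β γ a.toInt b.toInt c.toInt d.toInt b'.toInt c'.toInt x'.toInt ∧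
        m' = highTriple a.toInt b.toInt c.toInt d.toInt b'.toInt c'.toInt x'.toInt := by
  decide +kernel

set_option synthInstance.maxSize 2000 in
set_option synthInstance.maxHeartbeats 200000 in
theorem high_to_low_bool : ∀ α β γ a b c d b' c' x : Bool, (γ → β) → (β → α) →
    IsHighConfig α β γ a.toInt b.toInt c.toInt d.toInt b'.toInt c'.toInt x.toInt →
    IsMovable (highTriple a.toInt b.toInt c.toInt d.toInt b'.toInt c'.toInt x.toInt) ∧
    ∀ m' ∈ tripleMoves (highTriple a.toInt b.toInt c.toInt d.toInt b'.toInt c'.toInt x.toInt),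
      ∃ x' : Bool, IsLowConfig α β γ a.toInt b.toInt c.toInt d.toInt b'.toInt c'.toInt x'.toInt ∧
        m' = lowTriple a.toInt b.toInt c.toInt d.toInt b'.toInt c'.toInt x'.toInt := by
  decide +kernel

-- Here the chamber to the left of the triangle can be added or removed freely. This rules out the
-- one triple for which the box equation of that chamber would not be transported by the move.
set_option synthInstance.maxSize 2000 in
set_option synthInstance.maxHeartbeats 200000 in
theorem low_box_bool : ∀ α β γ b c d b' c' x : Bool, (γ → β) → (β → α) →
    IsLowConfig α β γ 1 b.toInt c.toInt d.toInt b'.toInt c'.toInt x.toInt →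
    IsLowConfig α β γ 0 b.toInt c.toInt d.toInt b'.toInt c'.toInt x.toInt →
    lowTriple 1 b.toInt c.toInt d.toInt b'.toInt c'.toInt x.toInt ≠ (0, 0, 1) := by
  decide +kernel

set_option synthInstance.maxSize 2000 in
set_option synthInstance.maxHeartbeats 200000 in
theorem high_box_bool : ∀ α β γ a b c b' c' x : Bool, (γ → β) → (β → α) →
    IsHighConfig α β γ a.toInt b.toInt c.toInt 1 b'.toInt c'.toInt x.toInt →
    IsHighConfig α β γ a.toInt b.toInt c.toInt 0 b'.toInt c'.toInt x.toInt →
    highTriple a.toInt b.toInt c.toInt 1 b'.toInt c'.toInt x.toInt ≠ (0, 0, 1) := by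
  decide +kernel

theorem exists_bool_of_mem {x : ℤ} (h : x = 0 ∨ x = 1) : ∃ b : Bool, x = b.toInt := by
  rcases h with rfl | rfl
  · exact ⟨false, rfl⟩
  · exact ⟨true, rfl⟩

end LocalMove

/-! ### The effect of a 3-move on diagrams and on string exponents -/

section Move

variable {n N : ℕ} {w w' : Fin N → Fin n} {i j k : Fin N}

theorem IsThreeMove.symm (h : IsThreeMove w w' i j k) : IsThreeMove w' w i j k where
  j_eq := h.j_eq
  k_eq := h.k_eq
  adjacent := by rw [h.new_i, h.new_j]; exact h.adjacent.symm
  same := by rw [h.new_k, h.new_i]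
  new_i := h.new_j.symm
  new_j := h.new_i.symm
  new_k := by rw [h.same, h.new_j]
  other := fun q h1 h2 h3 => (h.other q h1 h2 h3).symm

theorem IsThreeMove.ne (h : IsThreeMove w w' i j k) : i ≠ j ∧ i ≠ k ∧ j ≠ k := by
  have := h.j_eq
  have := h.k_eq
  refine ⟨?_, ?_, ?_⟩ <;> intro e <;> rw [Fin.ext_iff] at e <;> omega

theorem IsThreeMove.cases (h : IsThreeMove w w' i j k) (q : Fin N) :
    q.val < i.val ∨ q = i ∨ q = j ∨ q = k ∨ k.val < q.val := by
  have := h.j_eq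
  have := h.k_eq
  simp only [Fin.ext_iff]
  omega

theorem simpleRefl_braid {a b : Fin n} (h : Adjacent a b) :
    simpleRefl a * simpleRefl b * simpleRefl a = simpleRefl b * simpleRefl a * simpleRefl b := by
  have key : ∀ a b : Fin n, a.val + 1 = b.val →
      simpleRefl a * simpleRefl b * simpleRefl a = simpleRefl b * simpleRefl a * simpleRefl b := by
    intro a b hab
    have e : a.succ = b.castSucc := by ext; simpa using hab
    have h1 : a.castSucc ≠ b.castSucc := by simp only [ne_eq, Fin.ext_iff, Fin.val_castSucc]; omega
    have h2 : a.castSucc ≠ b.succ := by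
      simp only [ne_eq, Fin.ext_iff, Fin.val_castSucc, Fin.val_succ]; omega
    have h3 : b.castSucc ≠ b.succ := (Fin.castSucc_lt_succ).ne
    unfold simpleRefl
    rw [e]
    have e1 := Equiv.swap_mul_swap_mul_swap h3.symm h2.symm
    have e2 := Equiv.swap_mul_swap_mul_swap h1 h2
    rw [Equiv.swap_comm b.castSucc a.castSucc, Equiv.swap_comm b.succ b.castSucc] at e1
    rw [e1, e2, Equiv.swap_comm]
  rcases h with h | h
  · exact key a b h
  · exact (key b a h).symm

theorem IsThreeMove.arrangement_of_le (h : IsThreeMove w w' i j k) :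
    ∀ l ≤ i.val, arrangement w' l = arrangement w l := by
  intro l
  induction l with
  | zero => intro _; rw [arrangement_zero, arrangement_zero]
  | succ l ih =>
    intro hl
    have := h.j_eq
    have := h.k_eq
    have hlN : l < N := by have := i.isLt; omega
    have h1 := arrangement_succ w ⟨l, hlN⟩
    have h2 := arrangement_succ w' ⟨l, hlN⟩
    simp only at h1 h2
    rw [h1, h2, ih (by omega), h.other] <;> intro e <;> rw [Fin.ext_iff] at e <;>
      simp only at e <;> omega

theorem IsThreeMove.arrangement_mid (h : IsThreeMove w w' i j k) :
    arrangement w (i.val + 3) =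
      arrangement w i * (simpleRefl (w i) * simpleRefl (w j) * simpleRefl (w i)) := by
  have h1 := arrangement_succ w i
  have h2 := arrangement_succ w j
  have h3 := arrangement_succ w k
  rw [h.k_eq, h.j_eq, h.same] at h3
  rw [h.j_eq] at h2
  rw [h3, h2, h1]
  simp only [mul_assoc]

theorem IsThreeMove.arrangement_of_lt (h : IsThreeMove w w' i j k) :
    ∀ l, k.val < l → l ≤ N → arrangement w' l = arrangement w l := by
  intro l hl
  have hj := h.j_eq
  have hk := h.k_eq
  induction l, (show i.val + 3 ≤ l by omega) using Nat.le_induction with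
  | base =>
    intro _
    rw [h.arrangement_mid, h.symm.arrangement_mid, h.arrangement_of_le i le_rfl, h.new_i, h.new_j,
      simpleRefl_braid h.adjacent]
  | succ l hl' ih =>
    intro hlN
    have h1 := arrangement_succ w ⟨l, hlN⟩
    have h2 := arrangement_succ w' ⟨l, hlN⟩
    simp only at h1 h2
    rw [h1, h2, ih (by omega) (by omega), h.other] <;> intro e <;> rw [Fin.ext_iff] at e <;>
      simp only at e <;> omega

theorem IsThreeMove.strings (h : IsThreeMove w w' i j k) {q : Fin N} (h1 : q ≠ i) (h2 : q ≠ j)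
    (h3 : q ≠ k) : leftString w' q = leftString w q ∧ rightString w' q = rightString w q := by
  unfold leftString rightString
  rw [h.other q h1 h2 h3]
  rcases h.cases q with h | h | h | h | h
  · rw [‹IsThreeMove w w' i j k›.arrangement_of_le q h.le]; exact ⟨rfl, rfl⟩
  · exact absurd h h1
  · exact absurd h h2
  · exact absurd h h3
  · rw [‹IsThreeMove w w' i j k›.arrangement_of_lt q h q.isLt.le]; exact ⟨rfl, rfl⟩

/-- The strings at the three crossings, if the first one is the left one. -/
theorem IsThreeMove.strings_low (h : IsThreeMove w w' i j k) (hlow : (w i).val + 1 = (w j).val) :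
    leftString w j = leftString w i ∧ leftString w k = rightString w i ∧
      rightString w k = rightString w j ∧ rightString w j = arrangement w i (w j).succ := by
  have e : (w j).castSucc = (w i).succ := by ext; simp [hlow]
  have hs : (w j).succ ≠ (w i).castSucc := by
    simp only [ne_eq, Fin.ext_iff, Fin.val_castSucc, Fin.val_succ]; omega
  have hs' : (w j).succ ≠ (w i).succ := by
    simp only [ne_eq, Fin.ext_iff, Fin.val_succ]; omega
  have hs2 : (w i).castSucc ≠ (w j).castSucc := by
    simp only [ne_eq, Fin.ext_iff, Fin.val_castSucc]; omega
  have h1 : leftString w j = leftString w i := by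
    rw [leftString, h.j_eq, e, arrangement_succ_right]
  refine ⟨h1, ?_, ?_, ?_⟩
  · rw [leftString, h.same, h.k_eq, arrangement_succ_other w j _ hs2 hs.symm, h.j_eq,
      arrangement_succ_left]
  · rw [rightString, h.same, h.k_eq, ← e, arrangement_succ_left]
  · rw [rightString, h.j_eq, arrangement_succ_other w i _ hs hs']

/-- The strings at the three crossings, if the first one is the right one. -/
theorem IsThreeMove.strings_high (h : IsThreeMove w w' i j k)
    (hhigh : (w j).val + 1 = (w i).val) :
    rightString w j = rightString w i ∧ leftString w k = leftString w j ∧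
      rightString w k = leftString w i ∧ leftString w j = arrangement w i (w j).castSucc := by
  have e : (w j).succ = (w i).castSucc := by ext; simp [hhigh]
  have hs : (w j).castSucc ≠ (w i).castSucc := by
    simp only [ne_eq, Fin.ext_iff, Fin.val_castSucc]; omega
  have hs' : (w j).castSucc ≠ (w i).succ := by
    simp only [ne_eq, Fin.ext_iff, Fin.val_castSucc, Fin.val_succ]; omega
  have hs2 : (w i).succ ≠ (w j).succ := by
    simp only [ne_eq, Fin.ext_iff, Fin.val_succ]; omega
  refine ⟨?_, ?_, ?_, ?_⟩
  · rw [rightString, h.j_eq, e, arrangement_succ_left]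
  · rw [leftString, h.same, h.k_eq, ← e, arrangement_succ_right]
  · rw [rightString, h.same, h.k_eq, arrangement_succ_other w j _ hs'.symm hs2, h.j_eq,
      arrangement_succ_right]
  · rw [leftString, h.j_eq, arrangement_succ_other w i _ hs hs']

/-- The orientation condition of `IsInterior` at a crossing. -/
abbrev VertexAt (w : Fin N → Fin n) (κ : Fin n) (χ : ℕ → ℕ → ℤ) (q : Fin N) : Prop :=
  IsVertexConfig (IsUpward κ (leftString w q)) (IsUpward κ (rightString w q))
    (χ q (w q + 1)) (χ q (w q)) (χ q (w q + 2)) (χ (q + 1) (w q + 1))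

/-- Between the levels `i` and `i + 3` only two gaps change, so the three crossings see seven
values: four above the triangle, two new ones below it, and the small chamber, which is visible at
level `i + 1`. -/
theorem IsThreeMove.vertex_low (h : IsThreeMove w w' i j k) (hlow : (w i).val + 1 = (w j).val)
    {χ : ℕ → ℕ → ℤ} (hχ : IsChamberFunction w χ) (κ : Fin n) :
    (VertexAt w κ χ i ∧ VertexAt w κ χ j ∧ VertexAt w κ χ k ↔
      IsLowConfig (IsUpward κ (leftString w i)) (IsUpward κ (rightString w i))
        (IsUpward κ (arrangement w i (w j).succ))
        (χ i (w i)) (χ i (w i + 1)) (χ i (w i + 2)) (χ i (w i + 3)) (χ (i + 3) (w i + 1))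
        (χ (i + 3) (w i + 2)) (χ (i + 1) (w i + 1))) ∧
    (chamberExponent w χ i, chamberExponent w χ j, chamberExponent w χ k) =
      lowTriple (χ i (w i)) (χ i (w i + 1)) (χ i (w i + 2)) (χ i (w i + 3)) (χ (i + 3) (w i + 1))
        (χ (i + 3) (w i + 2)) (χ (i + 1) (w i + 1)) := by
  obtain ⟨s1, s2, s3, s4⟩ := h.strings_low hlow
  have e1 : ∀ g, g ≠ (w i).val + 1 → χ (i + 1) g = χ i g := hχ i
  have e2 : ∀ g, g ≠ (w i).val + 2 → χ (i + 2) g = χ (i + 1) g := fun g hg => by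
    have := hχ j g (by omega)
    rwa [h.j_eq] at this
  have e3 : ∀ g, g ≠ (w i).val + 1 → χ (i + 3) g = χ (i + 2) g := fun g hg => by
    have := hχ k g (by rw [h.same]; omega)
    rwa [h.k_eq, h.j_eq] at this
  unfold VertexAt IsLowConfig lowTriple chamberExponent
  rw [s2, s1, s3, s4, h.same, h.k_eq, h.j_eq, ← hlow]
  rw [e1 ((w i).val + 1 + 1) (by omega), e1 ((w i).val + 1 + 2) (by omega),
    e2 ((w i).val) (by omega), e1 ((w i).val) (by omega), e2 ((w i).val + 1) (by omega),
    e3 ((w i).val + 2) (by omega)]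
  exact ⟨Iff.rfl, rfl⟩

theorem IsThreeMove.vertex_high (h : IsThreeMove w w' i j k) (hhigh : (w j).val + 1 = (w i).val)
    {χ : ℕ → ℕ → ℤ} (hχ : IsChamberFunction w χ) (κ : Fin n) :
    (VertexAt w κ χ i ∧ VertexAt w κ χ j ∧ VertexAt w κ χ k ↔
      IsHighConfig (IsUpward κ (arrangement w i (w j).castSucc))
        (IsUpward κ (leftString w i)) (IsUpward κ (rightString w i))
        (χ i (w j)) (χ i (w j + 1)) (χ i (w j + 2)) (χ i (w j + 3)) (χ (i + 3) (w j + 1))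
        (χ (i + 3) (w j + 2)) (χ (i + 1) (w j + 2))) ∧
    (chamberExponent w χ i, chamberExponent w χ j, chamberExponent w χ k) =
      highTriple (χ i (w j)) (χ i (w j + 1)) (χ i (w j + 2)) (χ i (w j + 3)) (χ (i + 3) (w j + 1))
        (χ (i + 3) (w j + 2)) (χ (i + 1) (w j + 2)) := by
  obtain ⟨s1, s2, s3, s4⟩ := h.strings_high hhigh
  have e1 : ∀ g, g ≠ (w j).val + 2 → χ (i + 1) g = χ i g := fun g hg => hχ i g (by omega)
  have e2 : ∀ g, g ≠ (w j).val + 1 → χ (i + 2) g = χ (i + 1) g := fun g hg => by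
    have := hχ j g (by omega)
    rwa [h.j_eq] at this
  have e3 : ∀ g, g ≠ (w j).val + 2 → χ (i + 3) g = χ (i + 2) g := fun g hg => by
    have := hχ k g (by rw [h.same]; omega)
    rwa [h.k_eq, h.j_eq] at this
  unfold VertexAt IsHighConfig highTriple chamberExponent
  rw [s2, s1, s3, s4, h.same, h.k_eq, h.j_eq, ← hhigh]
  rw [e1 ((w j).val) (by omega), e1 ((w j).val + 1) (by omega),
    e2 ((w j).val + 1 + 1) (by omega), e2 ((w j).val + 1 + 2) (by omega),
    e1 ((w j).val + 1 + 2) (by omega), e3 ((w j).val + 1) (by omega)]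
  exact ⟨Iff.rfl, rfl⟩

/-- The function on the chambers after a 3-move at the levels `i, i + 1, i + 2` which agrees with
`χ` away from the small chamber in the gap `g`, where it takes the value `x`. -/
def moveChambers (χ : ℕ → ℕ → ℤ) (i g : ℕ) (x : ℤ) (l h : ℕ) : ℤ :=
  if l = i + 1 then (if h = g then x else χ i h)
  else if l = i + 2 then (if h = g then x else χ (i + 3) h)
  else χ l h


/-- The first and the last new crossing change only the gap of the small chamber. At the middle one
the rows `i` and `i + 3` are compared, and these agree outside the two gaps touched by the move. -/
theorem IsThreeMove.isChamberFunction (h : IsThreeMove w w' i j k) {χ : ℕ → ℕ → ℤ}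
    (hχ : IsChamberFunction w χ) (x : ℤ) :
    IsChamberFunction w' (moveChambers χ i (w' i + 1) x) := by
  have hj := h.j_eq
  have hk := h.k_eq
  have e1 : ∀ g, g ≠ (w i).val + 1 → χ (i + 1) g = χ i g := hχ i
  have e2 : ∀ g, g ≠ (w j).val + 1 → χ (i + 2) g = χ (i + 1) g := fun g hg => by
    have := hχ j g hg
    rwa [hj] at this
  have e3 : ∀ g, g ≠ (w i).val + 1 → χ (i + 3) g = χ (i + 2) g := fun g hg => by
    have := hχ k g (by rwa [h.same])
    rwa [hk, hj] at this
  intro q g hg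
  unfold moveChambers
  rcases h.cases q with hq | rfl | rfl | rfl | hq
  · rw [if_neg (by omega), if_neg (by omega), if_neg (by omega), if_neg (by omega)]
    apply hχ
    rwa [← h.other] <;> intro e <;> rw [Fin.ext_iff] at e <;> omega
  · simp [hg]
  · rw [h.new_j] at hg
    simp only [hj, h.new_i, Nat.add_assoc, Nat.reduceAdd, Nat.add_left_cancel_iff,
      OfNat.ofNat_ne_one, if_true, if_false]
    split_ifs with h1
    · rfl
    · rw [e3 g hg, e2 g h1, e1 g hg]
  · rw [h.new_k] at hg
    simp [hk, hj, h.new_i, hg, Nat.add_assoc]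
  · rw [if_neg (by omega), if_neg (by omega), if_neg (by omega), if_neg (by omega)]
    apply hχ
    rwa [← h.other] <;> intro e <;> rw [Fin.ext_iff] at e <;> omega

theorem moveChambers_eq {χ : ℕ → ℕ → ℤ} {i g l : ℕ} {x : ℤ} (h1 : l ≠ i + 1) (h2 : l ≠ i + 2) :
    moveChambers χ i g x l = χ l := by
  funext h
  unfold moveChambers
  rw [if_neg h1, if_neg h2]

theorem IsThreeMove.isInterior (h : IsThreeMove w w' i j k) {χ : ℕ → ℕ → ℤ} {κ : Fin n}
    (hχ : IsInterior w κ χ) (x : ℤ)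
    (hv : VertexAt w' κ (moveChambers χ i (w' i + 1) x) i ∧
      VertexAt w' κ (moveChambers χ i (w' i + 1) x) j ∧
      VertexAt w' κ (moveChambers χ i (w' i + 1) x) k) :
    IsInterior w' κ (moveChambers χ i (w' i + 1) x) ∧
      ∀ q, q ≠ i → q ≠ j → q ≠ k →
        chamberExponent w' (moveChambers χ i (w' i + 1) x) q = chamberExponent w χ q := by
  have hj := h.j_eq
  have hk := h.k_eq
  have hkN := k.isLt
  have hrow : ∀ q : Fin N, q ≠ i → q ≠ j → q ≠ k →
      moveChambers χ i (w' i + 1) x q = χ q ∧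
        moveChambers χ i (w' i + 1) x (q + 1) = χ (q + 1) := by
    intro q h1 h2 h3
    simp only [ne_eq, Fin.ext_iff] at h1 h2 h3
    constructor <;> apply moveChambers_eq <;> omega
  refine ⟨⟨h.isChamberFunction hχ.step x, fun g => ?_, fun g => ?_, fun q => ?_⟩,
    fun q h1 h2 h3 => ?_⟩
  · rw [moveChambers_eq (by omega) (by omega), hχ.top]
  · rw [moveChambers_eq (by omega) (by omega), hχ.bottom]
  · by_cases h1 : q = i
    · rw [h1]; exact hv.1
    by_cases h2 : q = j
    · rw [h2]; exact hv.2.1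
    by_cases h3 : q = k
    · rw [h3]; exact hv.2.2
    rw [(h.strings h1 h2 h3).1, (h.strings h1 h2 h3).2, (hrow q h1 h2 h3).1, (hrow q h1 h2 h3).2,
      h.other q h1 h2 h3]
    exact hχ.vertex q
  · unfold chamberExponent
    rw [(hrow q h1 h2 h3).1, (hrow q h1 h2 h3).2, h.other q h1 h2 h3]

theorem isUpward_mono {κ : Fin n} {u v : Fin (n + 1)} (h : u < v) (hv : IsUpward κ v) :
    IsUpward κ u := h.le.trans hv

/-- The interiors of rigorous paths on both sides of a 3-move. -/
theorem IsThreeMove.exists_isInterior (h : IsThreeMove w w' i j k) (hw : IsReducedDecomposition w)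
    {χ : ℕ → ℕ → ℤ} {κ : Fin n} (hχ : IsInterior w κ χ) :
    IsMovable (chamberExponent w χ i, chamberExponent w χ j, chamberExponent w χ k) ∧
    ∀ m', TripleMove (chamberExponent w χ i, chamberExponent w χ j, chamberExponent w χ k) m' →
      ∃ χ', IsInterior w' κ χ' ∧
        (∀ q, q ≠ i → q ≠ j → q ≠ k → chamberExponent w' χ' q = chamberExponent w χ q) ∧
        m' = (chamberExponent w' χ' i, chamberExponent w' χ' j, chamberExponent w' χ' k) := by
  classical
  have hkN := k.isLt
  have hj := h.j_eq
  have hk := h.k_eq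
  have hmem : ∀ l ≤ N, ∀ g, ∃ b : Bool, χ l g = b.toInt := fun l hl g =>
    exists_bool_of_mem (hχ.mem hw hl g)
  have hv0 : VertexAt w κ χ i ∧ VertexAt w κ χ j ∧ VertexAt w κ χ k :=
    ⟨hχ.vertex i, hχ.vertex j, hχ.vertex k⟩
  rcases h.adjacent with hlow | hhigh
  · obtain ⟨hv, ht⟩ := h.vertex_low hlow hχ.step κ
    rw [hv] at hv0
    have hhigh' : (w' j).val + 1 = (w' i).val := by rw [h.new_i, h.new_j]; exact hlow
    have s1 : leftString w i < rightString w i := leftString_lt_rightString hw i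
    have s2 : rightString w i < arrangement w i (w j).succ := by
      obtain ⟨a1, a2, a3, a4⟩ := h.strings_low hlow
      have := leftString_lt_rightString hw k
      rwa [a2, a3, a4] at this
    have s3 : leftString w' i = rightString w i := by
      rw [leftString, rightString, h.arrangement_of_le i le_rfl, h.new_i]
      congr 1; ext; simp [hlow]
    have s4 : rightString w' i = arrangement w i (w j).succ := by
      rw [rightString, h.arrangement_of_le i le_rfl, h.new_i]
    have s5 : arrangement w' i (w' j).castSucc = leftString w i := by
      rw [leftString, h.arrangement_of_le i le_rfl, h.new_j]
    obtain ⟨a, ha⟩ := hmem i (by omega) (w i)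
    obtain ⟨b, hb⟩ := hmem i (by omega) (w i + 1)
    obtain ⟨c, hc⟩ := hmem i (by omega) (w i + 2)
    obtain ⟨d, hd⟩ := hmem i (by omega) (w i + 3)
    obtain ⟨b', hb'⟩ := hmem (i + 3) (by omega) (w i + 1)
    obtain ⟨c', hc'⟩ := hmem (i + 3) (by omega) (w i + 2)
    obtain ⟨x, hx⟩ := hmem (i + 1) (by omega) (w i + 1)
    rw [ha, hb, hc, hd, hb', hc', hx] at hv0 ht
    have key := low_to_high_bool (decide (IsUpward κ (leftString w i)))
      (decide (IsUpward κ (rightString w i)))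
      (decide (IsUpward κ (arrangement w i (w j).succ))) a b c d b' c' x
      (by simpa using isUpward_mono s2) (by simpa using isUpward_mono s1) (by simpa using hv0)
    rw [← ht] at key
    refine ⟨key.1, fun m' hm' => ?_⟩
    -- The finite check supplies the value of the new small chamber; all surrounding values are
    -- those of `χ`, because the levels `i` and `i + 3` are not affected.
    obtain ⟨x', hx', hm''⟩ := key.2 m' hm'.mem
    have hχ' := h.isChamberFunction hχ.step x'.toInt
    obtain ⟨hv', ht'⟩ := h.symm.vertex_high hhigh' hχ' κ
    have r1 : moveChambers χ i (w' i + 1) x'.toInt i = χ i := moveChambers_eq (by omega) (by omega)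
    have r2 : moveChambers χ i (w' i + 1) x'.toInt (i + 3) = χ (i + 3) :=
      moveChambers_eq (by omega) (by omega)
    have r3 : moveChambers χ i (w' i + 1) x'.toInt (i + 1) (w' j + 2) = x'.toInt := by
      unfold moveChambers
      rw [if_pos rfl, if_pos (by omega)]
    rw [r1, r2, r3, s3, s4, s5, h.new_j, ha, hb, hc, hd, hb', hc'] at hv'
    rw [r1, r2, r3, h.new_j, ha, hb, hc, hd, hb', hc'] at ht'
    obtain ⟨hI, hother⟩ := h.isInterior hχ x'.toInt (hv'.2 (by simpa using hx'))
    exact ⟨_, hI, hother, hm''.trans ht'.symm⟩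
  · obtain ⟨hv, ht⟩ := h.vertex_high hhigh hχ.step κ
    rw [hv] at hv0
    have hlow' : (w' i).val + 1 = (w' j).val := by rw [h.new_i, h.new_j]; exact hhigh
    have s1 : leftString w i < rightString w i := leftString_lt_rightString hw i
    have s2 : arrangement w i (w j).castSucc < leftString w i := by
      obtain ⟨a1, a2, a3, a4⟩ := h.strings_high hhigh
      have := leftString_lt_rightString hw k
      rwa [a2, a3, a4] at this
    have s3 : leftString w' i = arrangement w i (w j).castSucc := by
      rw [leftString, h.arrangement_of_le i le_rfl, h.new_i]
    have s4 : rightString w' i = leftString w i := by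
      rw [leftString, rightString, h.arrangement_of_le i le_rfl, h.new_i]
      congr 1; ext; simp [hhigh]
    have s5 : arrangement w' i (w' j).succ = rightString w i := by
      rw [rightString, h.arrangement_of_le i le_rfl, h.new_j]
    obtain ⟨a, ha⟩ := hmem i (by omega) (w j)
    obtain ⟨b, hb⟩ := hmem i (by omega) (w j + 1)
    obtain ⟨c, hc⟩ := hmem i (by omega) (w j + 2)
    obtain ⟨d, hd⟩ := hmem i (by omega) (w j + 3)
    obtain ⟨b', hb'⟩ := hmem (i + 3) (by omega) (w j + 1)
    obtain ⟨c', hc'⟩ := hmem (i + 3) (by omega) (w j + 2)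
    obtain ⟨x, hx⟩ := hmem (i + 1) (by omega) (w j + 2)
    rw [ha, hb, hc, hd, hb', hc', hx] at hv0 ht
    have key := high_to_low_bool (decide (IsUpward κ (arrangement w i (w j).castSucc)))
      (decide (IsUpward κ (leftString w i)))
      (decide (IsUpward κ (rightString w i))) a b c d b' c' x
      (by simpa using isUpward_mono s1) (by simpa using isUpward_mono s2) (by simpa using hv0)
    rw [← ht] at key
    refine ⟨key.1, fun m' hm' => ?_⟩
    obtain ⟨x', hx', hm''⟩ := key.2 m' hm'.mem
    have hχ' := h.isChamberFunction hχ.step x'.toInt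
    obtain ⟨hv', ht'⟩ := h.symm.vertex_low hlow' hχ' κ
    have r1 : moveChambers χ i (w' i + 1) x'.toInt i = χ i := moveChambers_eq (by omega) (by omega)
    have r2 : moveChambers χ i (w' i + 1) x'.toInt (i + 3) = χ (i + 3) :=
      moveChambers_eq (by omega) (by omega)
    have r3 : moveChambers χ i (w' i + 1) x'.toInt (i + 1) (w' i + 1) = x'.toInt := by
      unfold moveChambers
      rw [if_pos rfl, if_pos rfl]
    rw [r3, r1, r2, s3, s4, s5, ← h.new_i] at hv'
    rw [← h.new_i] at ha hb hc hd hb' hc' hx'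
    rw [ha, hb, hc, hd, hb', hc'] at hv'
    rw [r3, r1, r2, ha, hb, hc, hd, hb', hc'] at ht'
    obtain ⟨hI, hother⟩ := h.isInterior hχ x'.toInt (hv'.2 (by simpa using hx'))
    exact ⟨_, hI, hother, hm''.trans ht'.symm⟩

/-- Replaces the entries at the three places of a 3-move. -/
def withTriple (i j k : Fin N) (m : Fin N → ℤ) (t : ℤ × ℤ × ℤ) (q : Fin N) : ℤ :=
  if q = i then t.1 else if q = j then t.2.1 else if q = k then t.2.2 else m q

theorem IsThreeMove.withTriple_apply (h : IsThreeMove w w' i j k) (m : Fin N → ℤ)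
    (t : ℤ × ℤ × ℤ) : withTriple i j k m t i = t.1 ∧ withTriple i j k m t j = t.2.1 ∧
      withTriple i j k m t k = t.2.2 := by
  obtain ⟨h1, h2, h3⟩ := h.ne
  simp [withTriple, h1.symm, h2.symm, h3.symm]

theorem withTriple_other {i j k : Fin N} (m : Fin N → ℤ) (t : ℤ × ℤ × ℤ) {q : Fin N} (h1 : q ≠ i)
    (h2 : q ≠ j) (h3 : q ≠ k) : withTriple i j k m t q = m q := by
  simp [withTriple, h1, h2, h3]

theorem IsThreeMove.isMovable (h : IsThreeMove w w' i j k) (hw : IsReducedDecomposition w)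
    {m : Fin N → ℤ} (hm : m ∈ stringExponents w) : IsMovable (m i, m j, m k) := by
  obtain ⟨κ, χ, hχ, rfl⟩ := (mem_stringExponents_iff hw).1 hm
  exact (h.exists_isInterior hw hχ).1

theorem IsThreeMove.withTriple_mem (h : IsThreeMove w w' i j k) (hw : IsReducedDecomposition w)
    (hw' : IsReducedDecomposition w') {m : Fin N → ℤ} (hm : m ∈ stringExponents w)
    {t : ℤ × ℤ × ℤ} (ht : TripleMove (m i, m j, m k) t) :
    withTriple i j k m t ∈ stringExponents w' := by
  obtain ⟨κ, χ, hχ, rfl⟩ := (mem_stringExponents_iff hw).1 hm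
  obtain ⟨χ', hχ', h1, rfl⟩ := (h.exists_isInterior hw hχ).2 t ht
  refine (mem_stringExponents_iff hw').2 ⟨κ, χ', hχ', ?_⟩
  funext q
  unfold withTriple
  split_ifs with a1 a2 a3
  · rw [a1]
  · rw [a2]
  · rw [a3]
  · exact (h1 q a1 a2 a3).symm

end Move

/-! ### Boxes as differences of interiors -/

section Boxes

variable {n N : ℕ} {w w' : Fin N → Fin n} {i j k : Fin N}

/-- The exponent at a crossing determines the value below it from the three values already known, so
a chamber function with zero top row is determined by its exponents. -/
theorem eq_zero_of_chamberExponent_eq_zero {χ : ℕ → ℕ → ℤ} (hχ : IsChamberFunction w χ)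
    (htop : ∀ g, χ 0 g = 0) (h : ∀ q, chamberExponent w χ q = 0) : ∀ l ≤ N, ∀ g, χ l g = 0 := by
  intro l
  induction l with
  | zero => exact fun _ => htop
  | succ l ih =>
    intro hl g
    have ih := ih (by omega)
    have h1 := h ⟨l, hl⟩
    have h2 := hχ ⟨l, hl⟩ g
    simp only [chamberExponent] at h1 h2
    rw [ih, ih, ih] at h1
    by_cases hg : g = (w ⟨l, hl⟩).val + 1
    · rw [hg]; omega
    · rw [h2 hg, ih]

/-- The indicator function of the box between the crossings `top` and `bot`. -/
def boxIndicator (w : Fin N → Fin n) (top bot : Fin N) (l g : ℕ) : ℤ :=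
  if g = w top + 1 ∧ top.val < l ∧ l ≤ bot.val then 1 else 0

theorem IsBox.isChamberFunction {top bot : Fin N} (h : IsBox w top bot) :
    IsChamberFunction w (boxIndicator w top bot) := by
  intro q g hg
  unfold boxIndicator
  have h1 := h.1
  have h2 := h.2.1
  rw [Fin.lt_def] at h1
  rw [Fin.ext_iff] at h2
  by_cases e1 : q = top
  · subst e1; rw [if_neg (by omega), if_neg (by omega)]
  by_cases e2 : q = bot
  · subst e2; rw [if_neg (by omega), if_neg (by omega)]
  rw [Fin.ext_iff] at e1 e2
  congr 1
  rw [eq_iff_iff]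
  omega

/-- The box lies below `top` and above `bot`, which gives -1 at both, and beside the crossings of
the neighbouring columns in between, which gives 1 there. Below `bot` the two `λ`-exponents cancel
because the letters agree. -/
theorem IsBox.chamberExponent_boxIndicator {top bot : Fin N} (h : IsBox w top bot) :
    chamberExponent w (boxIndicator w top bot) = lambdaExponent w bot - lambdaExponent w top := by
  obtain ⟨h1, h2, h3⟩ := h
  funext q
  have h3 := h3 q
  rw [Fin.lt_def] at h1
  rcases eq_or_ne q top with rfl | hqt
  · simp only [chamberExponent, boxIndicator, Pi.sub_apply, lambdaExponent, Adjacent, Fin.ext_iff,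
      Fin.lt_def, true_and] at *
    split_ifs <;> omega
  rcases eq_or_ne q bot with rfl | hqb
  · simp only [chamberExponent, boxIndicator, Pi.sub_apply, lambdaExponent, Adjacent, Fin.ext_iff,
      Fin.lt_def] at *
    split_ifs <;> omega
  simp only [chamberExponent, boxIndicator, Pi.sub_apply, lambdaExponent, Adjacent, Fin.ext_iff,
    Fin.lt_def, ne_eq] at *
  split_ifs <;> omega

theorem chamberExponent_sub_smul (χ ψ : ℕ → ℕ → ℤ) (y : ℤ) (q : Fin N) :
    chamberExponent w (fun l g => χ l g - y * ψ l g) q =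
      chamberExponent w χ q - y * chamberExponent w ψ q := by
  simp only [chamberExponent]
  ring

theorem IsChamberFunction.sub_smul {χ ψ : ℕ → ℕ → ℤ} (hχ : IsChamberFunction w χ)
    (hψ : IsChamberFunction w ψ) (y : ℤ) :
    IsChamberFunction w (fun l g => χ l g - y * ψ l g) := fun q g hg => by
  simp only
  rw [hχ q g hg, hψ q g hg]

/-- The exponent vector of a string inequality is not a multiple of the vector of a box. -/
theorem IsBox.ne_smul (hw : IsReducedDecomposition w) {top bot : Fin N} (h : IsBox w top bot)
    {m : Fin N → ℤ} (hm : m ∈ stringExponents w) (y : ℤ) :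
    m ≠ y • (lambdaExponent w bot - lambdaExponent w top) := by
  intro e
  obtain ⟨κ, χ, hχ, rfl⟩ := (mem_stringExponents_iff hw).1 hm
  -- If the vectors agreed, `χ` would be `y` times the indicator of the box. At the bottom level the
  -- indicator vanishes, while `χ` is 1 in the gap n - κ.
  have hz := eq_zero_of_chamberExponent_eq_zero (hχ.step.sub_smul h.isChamberFunction y)
    (fun g => by simp [hχ.top, boxIndicator])
    (fun q => by
      rw [chamberExponent_sub_smul, e, h.chamberExponent_boxIndicator]
      simp) N le_rfl (n - κ)
  have h2 := bot.isLt
  simp only [hχ.bottom, if_true, boxIndicator] at hz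
  rw [if_neg (by omega)] at hz
  omega

/-- The balance condition says that the exponent vectors differ by that of the box, hence so do the
interiors. No box reaches the bottom level, so the bottom values agree and both paths belong to the
same index. -/
theorem IsBox.exists_isInterior (hw : IsReducedDecomposition w) {top bot : Fin N}
    (h : IsBox w top bot) {p₁ p₂ : Fin N → ℤ} (h1 : p₁ ∈ stringExponents w)
    (h2 : p₂ ∈ stringExponents w)
    (hbal : p₁ + lambdaExponent w top = p₂ + lambdaExponent w bot) :
    ∃ κ χ₁ χ₂, IsInterior w κ χ₁ ∧ IsInterior w κ χ₂ ∧ p₁ = chamberExponent w χ₁ ∧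
      ∀ l ≤ N, ∀ g, χ₁ l g = χ₂ l g + boxIndicator w top bot l g := by
  obtain ⟨κ₁, χ₁, hχ₁, rfl⟩ := (mem_stringExponents_iff hw).1 h1
  obtain ⟨κ₂, χ₂, hχ₂, rfl⟩ := (mem_stringExponents_iff hw).1 h2
  have hz := eq_zero_of_chamberExponent_eq_zero
    ((hχ₁.step.sub_smul h.isChamberFunction 1).sub_smul hχ₂.step 1)
    (fun g => by simp [hχ₁.top, hχ₂.top, boxIndicator])
    (fun q => by
      have := congrFun hbal q
      simp only [Pi.add_apply] at this
      rw [chamberExponent_sub_smul, chamberExponent_sub_smul, h.chamberExponent_boxIndicator]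
      simp only [Pi.sub_apply]
      omega)
  have heq : ∀ l ≤ N, ∀ g, χ₁ l g = χ₂ l g + boxIndicator w top bot l g := by
    intro l hl g
    have := hz l hl g
    omega
  have hκ : κ₁ = κ₂ := by
    have := heq N le_rfl (n - κ₁)
    have h3 := bot.isLt
    have h4 := κ₁.isLt
    have h5 := κ₂.isLt
    have h6 : boxIndicator w top bot N (n - κ₁) = 0 := if_neg (by omega)
    rw [hχ₁.bottom, hχ₂.bottom, if_pos rfl, h6] at this
    ext
    by_contra hne
    rw [if_neg (by omega)] at this
    omega
  subst hκ
  exact ⟨κ₁, χ₁, χ₂, hχ₁, hχ₂, rfl, heq⟩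

/-- A box equation of a box that meets only one side of the triangle of a 3-move does not
involve a string inequality with the exponents `0, 0, 1` at the three crossings. -/
theorem IsThreeMove.ne_of_box (h : IsThreeMove w w' i j k) (hw : IsReducedDecomposition w)
    {top bot : Fin N} (hb : IsBox w top bot) {p₁ p₂ : Fin N → ℤ} (h1 : p₁ ∈ stringExponents w)
    (h2 : p₂ ∈ stringExponents w)
    (hbal : p₁ + lambdaExponent w top = p₂ + lambdaExponent w bot) (hti : top < i) (hkb : k < bot)
    (hadj : Adjacent (w top) (w i)) (hne : w top ≠ w j) : (p₁ i, p₁ j, p₁ k) ≠ (0, 0, 1) := by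
  obtain ⟨κ, χ, ψ, hχ, hψ, rfl, heq⟩ := hb.exists_isInterior hw h1 h2 hbal
  have hkN := k.isLt
  have hj := h.j_eq
  have hk := h.k_eq
  rw [Fin.lt_def] at hti hkb
  rw [ne_eq, Fin.ext_iff] at hne
  have hmem : ∀ l ≤ N, ∀ g, ∃ b : Bool, χ l g = b.toInt := fun l hl g =>
    exists_bool_of_mem (hχ.mem hw hl g)
  have hvχ : VertexAt w κ χ i ∧ VertexAt w κ χ j ∧ VertexAt w κ χ k :=
    ⟨hχ.vertex i, hχ.vertex j, hχ.vertex k⟩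
  have hvψ : VertexAt w κ ψ i ∧ VertexAt w κ ψ j ∧ VertexAt w κ ψ k :=
    ⟨hψ.vertex i, hψ.vertex j, hψ.vertex k⟩
  have heq' : ∀ l ≤ N, ∀ g, g ≠ (w top).val + 1 → ψ l g = χ l g := by
    intro l hl g hg
    have h6 : boxIndicator w top bot l g = 0 := if_neg (by omega)
    rw [heq l hl, h6, add_zero]
  classical
  rcases h.adjacent with hlow | hhigh
  · have hc : (w top).val + 1 = (w i).val := by unfold Adjacent at hadj; omega
    obtain ⟨hv, ht⟩ := h.vertex_low hlow hχ.step κ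
    obtain ⟨hv', -⟩ := h.vertex_low hlow hψ.step κ
    rw [hv] at hvχ
    rw [hv', heq' i (by omega) (w i + 1) (by omega), heq' i (by omega) (w i + 2) (by omega),
      heq' i (by omega) (w i + 3) (by omega), heq' _ (by omega) (w i + 1) (by omega),
      heq' (i + 3) (by omega) (w i + 2) (by omega),
      heq' (i + 1) (by omega) (w i + 1) (by omega)] at hvψ
    rw [ht]
    have h01 : χ i (w i) = 1 ∧ ψ i (w i) = 0 := by
      have e := heq i (by omega) (w i)
      rw [boxIndicator, if_pos (by omega)] at e
      have := hχ.mem hw (l := i) (by omega) (w i)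
      have := hψ.mem hw (l := i) (by omega) (w i)
      omega
    have s1 : leftString w i < rightString w i := leftString_lt_rightString hw i
    have s2 : rightString w i < arrangement w i (w j).succ := by
      obtain ⟨a1, a2, a3, a4⟩ := h.strings_low hlow
      have := leftString_lt_rightString hw k
      rwa [a2, a3, a4] at this
    obtain ⟨b, hb⟩ := hmem i (by omega) (w i + 1)
    obtain ⟨c, hc⟩ := hmem i (by omega) (w i + 2)
    obtain ⟨d, hd⟩ := hmem i (by omega) (w i + 3)
    obtain ⟨b', hb'⟩ := hmem (i + 3) (by omega) (w i + 1)
    obtain ⟨c', hc'⟩ := hmem (i + 3) (by omega) (w i + 2)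
    obtain ⟨x, hx⟩ := hmem (i + 1) (by omega) (w i + 1)
    rw [h01.1, hb, hc, hd, hb', hc', hx] at hvχ ⊢
    rw [h01.2, hb, hc, hd, hb', hc', hx] at hvψ
    exact low_box_bool (decide (IsUpward κ (leftString w i)))
      (decide (IsUpward κ (rightString w i)))
      (decide (IsUpward κ (arrangement w i (w j).succ))) b c d b' c' x
      (by simpa using isUpward_mono s2) (by simpa using isUpward_mono s1) (by simpa using hvχ)
      (by simpa using hvψ)
  · have hc : (w top).val = (w j).val + 2 := by unfold Adjacent at hadj; omega
    obtain ⟨hv, ht⟩ := h.vertex_high hhigh hχ.step κ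
    obtain ⟨hv', -⟩ := h.vertex_high hhigh hψ.step κ
    rw [hv] at hvχ
    rw [hv', heq' i (by omega) (w j) (by omega), heq' i (by omega) (w j + 1) (by omega),
      heq' i (by omega) (w j + 2) (by omega), heq' _ (by omega) (w j + 1) (by omega),
      heq' (i + 3) (by omega) (w j + 2) (by omega),
      heq' (i + 1) (by omega) (w j + 2) (by omega)] at hvψ
    rw [ht]
    have h01 : χ i (w j + 3) = 1 ∧ ψ i (w j + 3) = 0 := by
      have e := heq i (by omega) (w j + 3)
      rw [boxIndicator, if_pos (by omega)] at e
      have := hχ.mem hw (l := i) (by omega) (w j + 3)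
      have := hψ.mem hw (l := i) (by omega) (w j + 3)
      omega
    have s1 : leftString w i < rightString w i := leftString_lt_rightString hw i
    have s2 : arrangement w i (w j).castSucc < leftString w i := by
      obtain ⟨a1, a2, a3, a4⟩ := h.strings_high hhigh
      have := leftString_lt_rightString hw k
      rwa [a2, a3, a4] at this
    obtain ⟨a, ha⟩ := hmem i (by omega) (w j)
    obtain ⟨b, hb⟩ := hmem i (by omega) (w j + 1)
    obtain ⟨c, hc⟩ := hmem i (by omega) (w j + 2)
    obtain ⟨b', hb'⟩ := hmem (i + 3) (by omega) (w j + 1)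
    obtain ⟨c', hc'⟩ := hmem (i + 3) (by omega) (w j + 2)
    obtain ⟨x, hx⟩ := hmem (i + 1) (by omega) (w j + 2)
    rw [h01.1, ha, hb, hc, hb', hc', hx] at hvχ ⊢
    rw [h01.2, ha, hb, hc, hb', hc', hx] at hvψ
    exact high_box_bool (decide (IsUpward κ (arrangement w i (w j).castSucc)))
      (decide (IsUpward κ (leftString w i)))
      (decide (IsUpward κ (rightString w i))) a b c b' c' x
      (by simpa using isUpward_mono s1) (by simpa using isUpward_mono s2) (by simpa using hvχ)
      (by simpa using hvψ)

end Boxes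

/-! ### Bookkeeping of exponent triples, powers of C and λ-exponents -/

section Exponents

variable {n N : ℕ} {w w' : Fin N → Fin n} {i j k : Fin N}

/-- The exponents `t` at the three places of a 3-move become `t'`, and the coefficient is
multiplied by the power of the parameter with exponent `e`. -/
def MoveTo (t t' : ℤ × ℤ × ℤ) (e : ℤ) : Prop :=
  (t.1 = t.2.2 ∧ t'.1 = t.2.1 ∧ t'.2.1 = t.1 ∧ t'.2.2 = t.2.1 ∧ e = t.2.1 - t.1) ∨
  (t.1 = 0 ∧ t.2.2 = 1 ∧ t'.1 = t.2.1 + 1 ∧ t'.2.1 = 0 ∧ t'.2.2 = t.2.1 ∧ e = t.2.1) ∨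
  (t.1 = -1 ∧ t.2.2 = 0 ∧ t'.1 = t.2.1 ∧ t'.2.1 = 0 ∧ t'.2.2 = t.2.1 - 1 ∧ e = t.2.1) ∨
  (t.1 = t.2.2 + 1 ∧ t.2.1 = 0 ∧ t'.1 = 0 ∧ t'.2.1 = t.2.2 ∧ t'.2.2 = 1 ∧ e = -t.2.2) ∨
  (t.1 = t.2.2 + 1 ∧ t.2.1 = 0 ∧ t'.1 = -1 ∧ t'.2.1 = t.1 ∧ t'.2.2 = 0 ∧ e = -t.1)

/-- A choice of the exponents after a 3-move. -/
def movedTriple (t : ℤ × ℤ × ℤ) : ℤ × ℤ × ℤ :=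
  if t.1 = t.2.2 then (t.2.1, t.1, t.2.1)
  else if t.1 = 0 ∧ t.2.2 = 1 then (t.2.1 + 1, 0, t.2.1)
  else if t.1 = -1 ∧ t.2.2 = 0 then (t.2.1, 0, t.2.1 - 1)
  else (0, t.2.2, 1)

/-- The exponent of the parameter that belongs to `movedTriple`. -/
def movedPower (t : ℤ × ℤ × ℤ) : ℤ :=
  if t.1 = t.2.2 then t.2.1 - t.1
  else if t.1 = 0 ∧ t.2.2 = 1 then t.2.1
  else if t.1 = -1 ∧ t.2.2 = 0 then t.2.1
  else -t.2.2

theorem MoveTo.tripleMove {t t' : ℤ × ℤ × ℤ} {e : ℤ} (h : MoveTo t t' e) : TripleMove t t' := by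
  obtain ⟨x, y, z⟩ := t
  obtain ⟨x', y', z'⟩ := t'
  unfold MoveTo at h
  unfold TripleMove
  simp only [Prod.mk.injEq] at h ⊢
  rcases h with h | h | h | h | h
  · exact Or.inl (by omega)
  · exact Or.inr (Or.inl (by omega))
  · exact Or.inr (Or.inr (Or.inl (by omega)))
  · exact Or.inr (Or.inr (Or.inr ⟨by omega, Or.inl (by omega)⟩))
  · exact Or.inr (Or.inr (Or.inr ⟨by omega, Or.inr (by omega)⟩))

/-- The first alternative is its own converse. The second and third, where two terms merge, are
converse to the fourth and fifth, where one term splits. -/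
theorem MoveTo.symm {t t' : ℤ × ℤ × ℤ} {e : ℤ} (h : MoveTo t t' e) : MoveTo t' t (-e) := by
  obtain ⟨x, y, z⟩ := t
  obtain ⟨x', y', z'⟩ := t'
  unfold MoveTo at h ⊢
  simp only at h ⊢
  rcases h with h | h | h | h | h
  · exact Or.inl (by omega)
  · exact Or.inr (Or.inr (Or.inr (Or.inl (by omega))))
  · exact Or.inr (Or.inr (Or.inr (Or.inr (by omega))))
  · exact Or.inr (Or.inl (by omega))
  · exact Or.inr (Or.inr (Or.inl (by omega)))

theorem moveTo_movedTriple {t : ℤ × ℤ × ℤ} (h : IsMovable t) :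
    MoveTo t (movedTriple t) (movedPower t) := by
  obtain ⟨x, y, z⟩ := t
  unfold IsMovable at h
  unfold MoveTo movedTriple movedPower
  simp only at h ⊢
  split_ifs with h1 h2 h3
  · exact Or.inl ⟨h1, rfl, rfl, rfl, rfl⟩
  · exact Or.inr (Or.inl ⟨h2.1, h2.2, rfl, rfl, rfl, rfl⟩)
  · exact Or.inr (Or.inr (Or.inl ⟨h3.1, h3.2, rfl, rfl, rfl, rfl⟩))
  · have h4 : y = 0 ∧ x = z + 1 := by tauto
    exact Or.inr (Or.inr (Or.inr (Or.inl ⟨h4.2, h4.1, rfl, rfl, rfl, rfl⟩)))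

/-- The only ambiguity is which of the two terms of a split is chosen; the two choices differ by one
power of the parameter. -/
theorem MoveTo.eq_moved_or {t t' : ℤ × ℤ × ℤ} {e : ℤ} (h : MoveTo t t' e) :
    (t' = movedTriple t ∧ e = movedPower t) ∨
      (t.1 = t.2.2 + 1 ∧ t.2.1 = 0 ∧ movedTriple t = (0, t.2.2, 1) ∧ movedPower t = -t.2.2 ∧
        t' = (-1, t.2.2 + 1, 0) ∧ e = -t.2.2 - 1) := by
  obtain ⟨x, y, z⟩ := t
  obtain ⟨x', y', z'⟩ := t'
  unfold MoveTo at h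
  unfold movedTriple movedPower
  simp only [Prod.mk.injEq] at h ⊢
  rcases h with h | h | h | h | h
  · rw [if_pos h.1, if_pos h.1]
    exact Or.inl ⟨by simp only [Prod.mk.injEq]; omega, by omega⟩
  · rw [if_neg (by omega), if_pos (by omega), if_neg (by omega), if_pos (by omega)]
    exact Or.inl ⟨by simp only [Prod.mk.injEq]; omega, by omega⟩
  · rw [if_neg (by omega), if_neg (by omega), if_pos (by omega), if_neg (by omega),
      if_neg (by omega), if_pos (by omega)]
    exact Or.inl ⟨by simp only [Prod.mk.injEq]; omega, by omega⟩
  · rw [if_neg (by omega), if_neg (by omega), if_neg (by omega), if_neg (by omega),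
      if_neg (by omega), if_neg (by omega)]
    exact Or.inl ⟨by simp only [Prod.mk.injEq]; omega, by omega⟩
  · rw [if_neg (by omega), if_neg (by omega), if_neg (by omega), if_neg (by omega),
      if_neg (by omega), if_neg (by omega)]
    exact Or.inr ⟨by omega, by omega, rfl, rfl, by omega, by omega⟩

theorem mem_Icc_of_mem_stringExponents {m : Fin N → ℤ} (hm : m ∈ stringExponents w) (q : Fin N) :
    -1 ≤ m q ∧ m q ≤ 1 := by
  obtain ⟨k, γ, hγ, rfl⟩ := hm
  have h := stringCoeff_mem γ hγ.nodup q
  rw [Finset.mem_Icc] at h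
  simp only [Pi.neg_apply]
  omega

/-- The exponent of `λ_q` at a later crossing, in terms of the letters. -/
def letterCoeff (c d : Fin n) : ℤ :=
  open Classical in if d = c then 2 else if Adjacent d c then -1 else 0

theorem lambdaExponent_of_lt {q r : Fin N} (h : q < r) :
    lambdaExponent w q r = letterCoeff (w q) (w r) := by
  unfold lambdaExponent letterCoeff
  rw [if_neg h.ne', if_pos h]

theorem lambdaExponent_self (q : Fin N) : lambdaExponent w q q = 1 := if_pos rfl

theorem lambdaExponent_of_gt {q r : Fin N} (h : r < q) : lambdaExponent w q r = 0 := by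
  unfold lambdaExponent
  rw [if_neg h.ne, if_neg h.not_gt]

theorem letterCoeff_self (c : Fin n) : letterCoeff c c = 2 := if_pos rfl

theorem letterCoeff_of_adjacent {c d : Fin n} (h : Adjacent d c) : letterCoeff c d = -1 := by
  unfold letterCoeff
  rw [if_neg, if_pos h]
  rintro rfl
  unfold Adjacent at h
  omega

theorem letterCoeff_of_ne {c d : Fin n} (h : c ≠ d) :
    (Adjacent d c ∧ letterCoeff c d = -1) ∨ (¬ Adjacent d c ∧ letterCoeff c d = 0) := by
  by_cases h' : Adjacent d c
  · exact Or.inl ⟨h', letterCoeff_of_adjacent h'⟩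
  · right
    refine ⟨h', ?_⟩
    unfold letterCoeff
    rw [if_neg h.symm, if_neg h']

theorem IsThreeMove.lt (h : IsThreeMove w w' i j k) : i < j ∧ j < k ∧ i < k := by
  have := h.j_eq
  have := h.k_eq
  simp only [Fin.lt_def]
  omega

theorem IsThreeMove.lambda_i (h : IsThreeMove w w' i j k) :
    lambdaExponent w i i = 1 ∧ lambdaExponent w i j = -1 ∧ lambdaExponent w i k = 2 :=
  ⟨lambdaExponent_self i,
    by rw [lambdaExponent_of_lt h.lt.1, letterCoeff_of_adjacent h.adjacent.symm],
    by rw [lambdaExponent_of_lt h.lt.2.2, h.same, letterCoeff_self]⟩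

theorem IsThreeMove.lambda_j (h : IsThreeMove w w' i j k) :
    lambdaExponent w j i = 0 ∧ lambdaExponent w j j = 1 ∧ lambdaExponent w j k = -1 :=
  ⟨lambdaExponent_of_gt h.lt.1, lambdaExponent_self j,
    by rw [lambdaExponent_of_lt h.lt.2.1, h.same, letterCoeff_of_adjacent h.adjacent]⟩

theorem IsThreeMove.lambda_k (h : IsThreeMove w w' i j k) :
    lambdaExponent w k i = 0 ∧ lambdaExponent w k j = 0 ∧ lambdaExponent w k k = 1 :=
  ⟨lambdaExponent_of_gt h.lt.2.2, lambdaExponent_of_gt h.lt.2.1, lambdaExponent_self k⟩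

theorem IsThreeMove.lambda_lt (h : IsThreeMove w w' i j k) {q : Fin N} (hq : q < i) :
    lambdaExponent w q i = letterCoeff (w q) (w i) ∧
    lambdaExponent w q j = letterCoeff (w q) (w j) ∧
    lambdaExponent w q k = letterCoeff (w q) (w i) :=
  ⟨lambdaExponent_of_lt hq, lambdaExponent_of_lt (hq.trans h.lt.1),
    by rw [lambdaExponent_of_lt (hq.trans h.lt.2.2), h.same]⟩

theorem IsThreeMove.lambda_gt (h : IsThreeMove w w' i j k) {q : Fin N} (hq : k < q) :
    lambdaExponent w q i = 0 ∧ lambdaExponent w q j = 0 ∧ lambdaExponent w q k = 0 :=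
  ⟨lambdaExponent_of_gt (h.lt.2.2.trans hq), lambdaExponent_of_gt (h.lt.2.1.trans hq),
    lambdaExponent_of_gt hq⟩

theorem IsThreeMove.other_of_lt (h : IsThreeMove w w' i j k) {q : Fin N} (hq : q < i) :
    w' q = w q :=
  h.other q hq.ne (hq.trans h.lt.1).ne (hq.trans h.lt.2.2).ne

theorem IsThreeMove.other_of_gt (h : IsThreeMove w w' i j k) {q : Fin N} (hq : k < q) :
    w' q = w q :=
  h.other q (h.lt.2.2.trans hq).ne' (h.lt.2.1.trans hq).ne' hq.ne'

theorem IsThreeMove.lambda_lt' (h : IsThreeMove w w' i j k) {q : Fin N} (hq : q < i) :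
    lambdaExponent w' q i = letterCoeff (w q) (w j) ∧
    lambdaExponent w' q j = letterCoeff (w q) (w i) ∧
    lambdaExponent w' q k = letterCoeff (w q) (w j) := by
  have := h.symm.lambda_lt hq
  rwa [h.other_of_lt hq, h.new_i, h.new_j] at this

theorem IsThreeMove.off_cases (h : IsThreeMove w w' i j k) {r : Fin N} (h1 : r ≠ i) (h2 : r ≠ j)
    (h3 : r ≠ k) : r < i ∨ k < r := by
  rcases h.cases r with h | h | h | h | h
  · exact Or.inl h
  · exact absurd h h1
  · exact absurd h h2
  · exact absurd h h3
  · exact Or.inr h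

/-- Away from the three crossings, the exponents of a `λ`-inequality only depend on its letter. -/
theorem IsThreeMove.lambda_off (h : IsThreeMove w w' i j k) {q q' r : Fin N} (h1 : r ≠ i)
    (h2 : r ≠ j) (h3 : r ≠ k)
    (hq : (q' = q ∧ q ≠ i ∧ q ≠ j ∧ q ≠ k) ∨
      ((q = i ∨ q = j ∨ q = k) ∧ (q' = i ∨ q' = j ∨ q' = k) ∧ w' q' = w q)) :
    lambdaExponent w' q' r = lambdaExponent w q r := by
  have hr := h.other r h1 h2 h3
  rcases hq with ⟨rfl, a1, a2, a3⟩ | ⟨a, b, c⟩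
  · unfold lambdaExponent
    rw [hr, h.other q' a1 a2 a3]
  · rcases h.off_cases h1 h2 h3 with hlt | hgt
    · have l1 : r < q := by
        rcases a with rfl | rfl | rfl
        · exact hlt
        · exact hlt.trans h.lt.1
        · exact hlt.trans h.lt.2.2
      have l2 : r < q' := by
        rcases b with rfl | rfl | rfl
        · exact hlt
        · exact hlt.trans h.lt.1
        · exact hlt.trans h.lt.2.2
      rw [lambdaExponent_of_gt l1, lambdaExponent_of_gt l2]
    · have l1 : q < r := by
        rcases a with rfl | rfl | rfl
        · exact h.lt.2.2.trans hgt
        · exact h.lt.2.1.trans hgt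
        · exact hgt
      have l2 : q' < r := by
        rcases b with rfl | rfl | rfl
        · exact h.lt.2.2.trans hgt
        · exact h.lt.2.1.trans hgt
        · exact hgt
      rw [lambdaExponent_of_lt l1, lambdaExponent_of_lt l2, c, hr]

theorem IsThreeMove.letter_ne (h : IsThreeMove w w' i j k) : w i ≠ w j := by
  intro e
  have := h.adjacent
  unfold Adjacent at this
  rw [e] at this
  omega

theorem IsThreeMove.isBox (h : IsThreeMove w w' i j k) : IsBox w i k := by
  refine ⟨h.lt.2.2, h.same.symm, fun q h1 h2 => ?_⟩
  have : q = j := by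
    have := h.j_eq
    have := h.k_eq
    rw [Fin.lt_def] at h1 h2
    ext; omega
  rw [this]
  exact h.letter_ne.symm

end Exponents

/-! ### The coefficients after a 3-move and the transport of box equations -/

section Coefficients

variable {n N : ℕ} {w w' : Fin N → Fin n} {i j k : Fin N} {G : Type*} [CommGroup G]

/-- The solutions of the box equations in a group. -/
def SolvesBoxEquations (w : Fin N → Fin n) (a : Inequality w → G) : Prop :=
  ∀ top bot p₁ p₂, BoxCondition w top bot p₁ p₂ →
    a (Sum.inl p₁) * a (Sum.inr top) = a (Sum.inl p₂) * a (Sum.inr bot)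

/-- The value of `a` at an exponent vector, `1` if it does not occur. -/
def stringValue (a : Inequality w → G) (m : Fin N → ℤ) : G :=
  open Classical in if h : m ∈ stringExponents w then a (Sum.inl ⟨m, h⟩) else 1

theorem stringValue_of_mem (a : Inequality w → G) {m : Fin N → ℤ} (h : m ∈ stringExponents w) :
    stringValue a m = a (Sum.inl ⟨m, h⟩) := dif_pos h

/-- The coefficients before a 3-move in terms of the coefficients after it. -/
def moveCoeff (w : Fin N → Fin n) (i j k : Fin N) (a : Inequality w' → G) : Inequality w → G :=
  Sum.elim
    (fun m => stringValue a (withTriple i j k m.val (movedTriple (m.val i, m.val j, m.val k))) *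
      (a (Sum.inr k) / a (Sum.inr i)) ^ movedPower (m.val i, m.val j, m.val k))
    (fun q => if q = i then a (Sum.inr j) * (a (Sum.inr k) / a (Sum.inr i)) ^ (-2 : ℤ)
      else if q = j then a (Sum.inr i) * (a (Sum.inr k) / a (Sum.inr i)) ^ (2 : ℤ)
      else if q = k then a (Sum.inr j) * (a (Sum.inr k) / a (Sum.inr i)) ^ (-1 : ℤ)
      else a (Sum.inr q) * (a (Sum.inr k) / a (Sum.inr i)) ^
        (lambdaExponent w q j - lambdaExponent w q k))

variable {a : Inequality w' → G}

theorem moveCoeff_i : moveCoeff w i j k a (Sum.inr i) =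
    a (Sum.inr j) * (a (Sum.inr k) / a (Sum.inr i)) ^ (-2 : ℤ) := by
  simp [moveCoeff]

theorem IsThreeMove.moveCoeff_j (h : IsThreeMove w w' i j k) : moveCoeff w i j k a (Sum.inr j) =
    a (Sum.inr i) * (a (Sum.inr k) / a (Sum.inr i)) ^ (2 : ℤ) := by
  simp [moveCoeff, h.ne.1.symm]

/-- As C = a_{λ_k}/a_{λ_i}, the coefficient can be expressed through either outer `λ`-coefficient.
This form suits a box that begins at `j`, since after the move it begins at `k`. -/
theorem IsThreeMove.moveCoeff_j' (h : IsThreeMove w w' i j k) :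
    moveCoeff w i j k a (Sum.inr j) =
      a (Sum.inr k) * (a (Sum.inr k) / a (Sum.inr i)) ^ (1 : ℤ) := by
  rw [h.moveCoeff_j, zpow_one, zpow_two, ← mul_assoc, mul_div_cancel]

theorem IsThreeMove.moveCoeff_k (h : IsThreeMove w w' i j k) : moveCoeff w i j k a (Sum.inr k) =
    a (Sum.inr j) * (a (Sum.inr k) / a (Sum.inr i)) ^ (-1 : ℤ) := by
  simp [moveCoeff, h.ne.2.1.symm, h.ne.2.2.symm]

theorem moveCoeff_other {q : Fin N} (h1 : q ≠ i) (h2 : q ≠ j) (h3 : q ≠ k) :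
    moveCoeff w i j k a (Sum.inr q) = a (Sum.inr q) * (a (Sum.inr k) / a (Sum.inr i)) ^
      (lambdaExponent w q j - lambdaExponent w q k) := by
  simp [moveCoeff, h1, h2, h3]

/-- The equation of the small box of a 3-move. -/
theorem IsThreeMove.small_box (h : IsThreeMove w w' i j k) {a : Inequality w → G}
    (ha : SolvesBoxEquations w a) {m m' : Fin N → ℤ} (hm : m ∈ stringExponents w)
    (hm' : m' ∈ stringExponents w) (hoff : ∀ q, q ≠ i → q ≠ j → q ≠ k → m q = m' q)
    (h1 : m i = -1) (h2 : m j = m' j + 1) (h3 : m k = 0) (h4 : m' i = 0) (h5 : m' k = 1) :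
    stringValue a m = stringValue a m' * (a (Sum.inr k) / a (Sum.inr i)) := by
  have key := ha i k ⟨m, hm⟩ ⟨m', hm'⟩ ⟨h.isBox, ?_, h1, h5⟩
  · rw [stringValue_of_mem a hm, stringValue_of_mem a hm', ← mul_div_assoc, eq_div_iff_mul_eq']
    exact key
  · funext q
    simp only [Pi.add_apply]
    by_cases e1 : q = i
    · subst e1
      rw [h.lambda_i.1, h.lambda_k.1]; omega
    by_cases e2 : q = j
    · subst e2
      rw [h.lambda_i.2.1, h.lambda_k.2.1]; omega
    by_cases e3 : q = k
    · subst e3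
      rw [h.lambda_i.2.2, h.lambda_k.2.2]; omega
    rw [hoff q e1 e2 e3]
    congr 1
    rcases h.off_cases e1 e2 e3 with hq | hq
    · rw [lambdaExponent_of_gt hq, lambdaExponent_of_gt (hq.trans h.lt.2.2)]
    · rw [lambdaExponent_of_lt hq, lambdaExponent_of_lt (h.lt.2.2.trans hq), h.same]

/-- The definition of `moveCoeff` picks one of the two terms of a split. On solutions the choice
does not matter, since by the small box equation the coefficients of the two terms differ by the
factor C that their powers differ by. -/
theorem IsThreeMove.moveCoeff_inl (h : IsThreeMove w w' i j k) (hw : IsReducedDecomposition w)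
    (hw' : IsReducedDecomposition w') (ha : SolvesBoxEquations w' a) (m : stringExponents w)
    {t : ℤ × ℤ × ℤ} {e : ℤ} (ht : MoveTo (m.val i, m.val j, m.val k) t e) :
    moveCoeff w i j k a (Sum.inl m) =
      stringValue a (withTriple i j k m.val t) * (a (Sum.inr k) / a (Sum.inr i)) ^ e := by
  have hmv := h.isMovable hw m.2
  have hd := moveTo_movedTriple hmv
  simp only [moveCoeff, Sum.elim_inl]
  rcases ht.eq_moved_or with ⟨h1, h2⟩ | ⟨hi, h0, h1, h2, rfl, rfl⟩
  · rw [h1, h2]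
  · rw [h1, h2]
    simp only at hi h0 ⊢
    have hm1 : withTriple i j k m.val (0, m.val k, 1) ∈ stringExponents w' :=
      h.withTriple_mem hw hw' m.2 (t := (0, m.val k, 1)) (by simp only [TripleMove]; tauto)
    have hm2 : withTriple i j k m.val (-1, m.val k + 1, 0) ∈ stringExponents w' :=
      h.withTriple_mem hw hw' m.2 (t := (-1, m.val k + 1, 0)) (by simp only [TripleMove, hi]; tauto)
    obtain ⟨a1, a2, a3⟩ := h.withTriple_apply m.val (0, m.val k, 1)
    obtain ⟨b1, b2, b3⟩ := h.withTriple_apply m.val (-1, m.val k + 1, 0)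
    rw [h.symm.small_box ha hm2 hm1 (fun q c1 c2 c3 => by
      rw [withTriple_other _ _ c1 c2 c3, withTriple_other _ _ c1 c2 c3])
      b1 (by rw [a2, b2]) b3 a1 a3]
    rw [mul_assoc]
    congr 1
    rw [← zpow_one_add]
    congr 1
    ring

/-- The parameter C is the same before and after the move; this makes the construction reversible
and lets both maps h use one parameter. -/
theorem IsThreeMove.ratio_moveCoeff (h : IsThreeMove w w' i j k) :
    moveCoeff w i j k a (Sum.inr k) / moveCoeff w i j k a (Sum.inr i) =
      a (Sum.inr k) / a (Sum.inr i) := by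
  rw [h.moveCoeff_k, moveCoeff_i, mul_div_mul_left_eq_div, div_eq_mul_inv, ← zpow_sub]
  norm_num

/-- The equation is a box equation of `w'` multiplied by a power of C. Away from the triangle the
balance is inherited, because there a `λ`-exponent depends only on its letter; at the three places
it is assumed, together with the balance of the powers of C. -/
theorem IsThreeMove.box_equation (h : IsThreeMove w w' i j k) (hw : IsReducedDecomposition w)
    (hw' : IsReducedDecomposition w') (ha : SolvesBoxEquations w' a) {p₁ p₂ : stringExponents w}
    {top bot top' bot' : Fin N} {t₁ t₂ : ℤ × ℤ × ℤ} {e₁ e₂ f₁ f₂ : ℤ}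
    (hp₁ : MoveTo (p₁.val i, p₁.val j, p₁.val k) t₁ e₁)
    (hp₂ : MoveTo (p₂.val i, p₂.val j, p₂.val k) t₂ e₂)
    (htop : moveCoeff w i j k a (Sum.inr top) =
      a (Sum.inr top') * (a (Sum.inr k) / a (Sum.inr i)) ^ f₁)
    (hbot : moveCoeff w i j k a (Sum.inr bot) =
      a (Sum.inr bot') * (a (Sum.inr k) / a (Sum.inr i)) ^ f₂)
    (hbox : IsBox w' top' bot')
    (hbal : p₁.val + lambdaExponent w top = p₂.val + lambdaExponent w bot)
    (htop' : (top' = top ∧ top ≠ i ∧ top ≠ j ∧ top ≠ k) ∨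
      ((top = i ∨ top = j ∨ top = k) ∧ (top' = i ∨ top' = j ∨ top' = k) ∧ w' top' = w top))
    (hbot' : (bot' = bot ∧ bot ≠ i ∧ bot ≠ j ∧ bot ≠ k) ∨
      ((bot = i ∨ bot = j ∨ bot = k) ∧ (bot' = i ∨ bot' = j ∨ bot' = k) ∧ w' bot' = w bot))
    (hi : t₁.1 + lambdaExponent w' top' i = t₂.1 + lambdaExponent w' bot' i)
    (hj : t₁.2.1 + lambdaExponent w' top' j = t₂.2.1 + lambdaExponent w' bot' j)
    (hk : t₁.2.2 + lambdaExponent w' top' k = t₂.2.2 + lambdaExponent w' bot' k)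
    (hdeg₁ : withTriple i j k p₁.val t₁ top' = -1) (hdeg₂ : withTriple i j k p₂.val t₂ bot' = 1)
    (he : e₁ + f₁ = e₂ + f₂) :
    moveCoeff w i j k a (Sum.inl p₁) * moveCoeff w i j k a (Sum.inr top) =
      moveCoeff w i j k a (Sum.inl p₂) * moveCoeff w i j k a (Sum.inr bot) := by
  have hm₁ := h.withTriple_mem hw hw' p₁.2 hp₁.tripleMove
  have hm₂ := h.withTriple_mem hw hw' p₂.2 hp₂.tripleMove
  have key := ha top' bot' ⟨_, hm₁⟩ ⟨_, hm₂⟩ ⟨hbox, ?_, hdeg₁, hdeg₂⟩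
  · rw [h.moveCoeff_inl hw hw' ha p₁ hp₁, h.moveCoeff_inl hw hw' ha p₂ hp₂, htop, hbot,
      stringValue_of_mem a hm₁, stringValue_of_mem a hm₂, mul_mul_mul_comm, key,
      ← zpow_add, he, zpow_add, ← mul_mul_mul_comm]
  · funext q
    simp only [Pi.add_apply]
    by_cases c1 : q = i
    · rw [c1, (h.withTriple_apply _ _).1, (h.withTriple_apply _ _).1, hi]
    by_cases c2 : q = j
    · rw [c2, (h.withTriple_apply _ _).2.1, (h.withTriple_apply _ _).2.1, hj]
    by_cases c3 : q = k
    · rw [c3, (h.withTriple_apply _ _).2.2, (h.withTriple_apply _ _).2.2, hk]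
    rw [withTriple_other _ _ c1 c2 c3, withTriple_other _ _ c1 c2 c3,
      h.lambda_off c1 c2 c3 htop', h.lambda_off c1 c2 c3 hbot']
    exact congrFun hbal q

end Coefficients

/-! ### Tables of exponent shifts for the positions of a box relative to the triangle -/

section BoxCases

instance (t t' : ℤ × ℤ × ℤ) (e : ℤ) : Decidable (MoveTo t t' e) := by
  unfold MoveTo; infer_instance

/-- Adding `δ` before and `δ'` after a 3-move are compatible with the 3-move, for exponents
satisfying the condition `P`; the power of the parameter changes by `f`. -/
def IsCompatible (P : ℤ × ℤ × ℤ → Prop) (δ δ' : ℤ × ℤ × ℤ) (f : ℤ) : Prop :=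
  ∀ x ∈ Finset.Icc (-1 : ℤ) 1, ∀ y ∈ Finset.Icc (-1 : ℤ) 1, ∀ z ∈ Finset.Icc (-1 : ℤ) 1,
    P (x, y, z) → IsMovable (x, y, z) → IsMovable ((x, y, z) + δ) →
    x + δ.1 ∈ Finset.Icc (-1) 1 → y + δ.2.1 ∈ Finset.Icc (-1) 1 → z + δ.2.2 ∈ Finset.Icc (-1) 1 →
    MoveTo ((x, y, z) + δ) (movedTriple (x, y, z) + δ') (movedPower (x, y, z) + f)

instance (P : ℤ × ℤ × ℤ → Prop) [DecidablePred P] (δ δ' : ℤ × ℤ × ℤ) (f : ℤ) :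
    Decidable (IsCompatible P δ δ' f) := by
  unfold IsCompatible; infer_instance

theorem isCompatible_zero : IsCompatible (fun _ => True) 0 0 0 := by decide +kernel

/-- Here and below the shifts are λ_top - λ_bot at the three places, before and after the move. This
one belongs to a box that runs past the triangle in a column adjacent to that of `i` and different
from that of `j`. The triple (0, 0, 1) must be left out: it moves to (1, 0, 0), but its shift (-1,
0, 0) moves to (0, 0, -1) and not to (1, -1, 0). By `IsThreeMove.ne_of_box` it does not occur. -/
theorem isCompatible_adjacent_i :
    IsCompatible (fun t => t ≠ (0, 0, 1)) (-1, 0, -1) (0, -1, 0) 1 := by decide +kernel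

theorem isCompatible_adjacent_j :
    IsCompatible (fun _ => True) (0, -1, 0) (-1, 0, -1) (-1) := by decide +kernel

/-- The next four tables concern a box with one corner at the triangle. A box that ends at `i` or
`j` ends at `j` or `i` after the move; one that starts at `j` or `k` starts at `k` or `j`. The
conditions on the triple are the degree conditions of the box equation, expressed through the first
string inequality: exponent 1 of the second one at `i`, for example, means exponent 0 of the first
one. -/
theorem isCompatible_bot_i :
    IsCompatible (fun t => t.1 = 0) (1, 0, 0) (-1, 1, 0) (-1) := by decide +kernel

theorem isCompatible_bot_j :
    IsCompatible (fun t => t.2.1 = 0) (-1, 1, 0) (1, 0, 0) 1 := by decide +kernel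

theorem isCompatible_top_j :
    IsCompatible (fun t => t.2.1 = -1) (0, 1, -1) (0, 0, 1) 1 := by decide +kernel

theorem isCompatible_top_k :
    IsCompatible (fun t => t.2.2 = -1) (0, 0, 1) (0, 1, -1) (-1) := by decide +kernel

/-- Used to verify the degree conditions of the transported box equation in the four cases where a
corner of the box moves. -/
theorem movedTriple_degrees :
    ∀ x ∈ Finset.Icc (-1 : ℤ) 1, ∀ y ∈ Finset.Icc (-1 : ℤ) 1, ∀ z ∈ Finset.Icc (-1 : ℤ) 1,
    IsMovable (x, y, z) →
    (x = 0 → IsMovable (x + 1, y, z) → (movedTriple (x, y, z)).2.1 = 0) ∧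
    (y = 0 → IsMovable (x - 1, y + 1, z) → (movedTriple (x, y, z)).1 = 0) ∧
    (y = -1 → IsMovable (x, y + 1, z - 1) → (movedTriple (x, y, z)).2.2 = -1) ∧
    (z = -1 → IsMovable (x, y, z + 1) → (movedTriple (x, y, z)).2.1 = -1) := by decide +kernel

end BoxCases

/-! ### Box equations are preserved, and the move of coefficients is reversible -/

section Coefficients

variable {n N : ℕ} {w w' : Fin N → Fin n} {i j k : Fin N} {G : Type*} [CommGroup G]
  {a : Inequality w' → G}

theorem IsThreeMove.box_equation_of_isCompatible (h : IsThreeMove w w' i j k)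
    (hw : IsReducedDecomposition w) (hw' : IsReducedDecomposition w')
    (ha : SolvesBoxEquations w' a) {p₁ p₂ : stringExponents w}
    {top bot top' bot' : Fin N} {δ δ' : ℤ × ℤ × ℤ} {f f₁ f₂ : ℤ} {P : ℤ × ℤ × ℤ → Prop}
    (hc : IsCompatible P δ δ' f) (hP : P (p₁.val i, p₁.val j, p₁.val k))
    (htop : moveCoeff w i j k a (Sum.inr top) =
      a (Sum.inr top') * (a (Sum.inr k) / a (Sum.inr i)) ^ f₁)
    (hbot : moveCoeff w i j k a (Sum.inr bot) =
      a (Sum.inr bot') * (a (Sum.inr k) / a (Sum.inr i)) ^ f₂)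
    (hbox : IsBox w' top' bot')
    (hbal : p₁.val + lambdaExponent w top = p₂.val + lambdaExponent w bot)
    (htop' : (top' = top ∧ top ≠ i ∧ top ≠ j ∧ top ≠ k) ∨
      ((top = i ∨ top = j ∨ top = k) ∧ (top' = i ∨ top' = j ∨ top' = k) ∧ w' top' = w top))
    (hbot' : (bot' = bot ∧ bot ≠ i ∧ bot ≠ j ∧ bot ≠ k) ∨
      ((bot = i ∨ bot = j ∨ bot = k) ∧ (bot' = i ∨ bot' = j ∨ bot' = k) ∧ w' bot' = w bot))
    (hδ : lambdaExponent w top i = lambdaExponent w bot i + δ.1 ∧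
      lambdaExponent w top j = lambdaExponent w bot j + δ.2.1 ∧
      lambdaExponent w top k = lambdaExponent w bot k + δ.2.2)
    (hδ' : lambdaExponent w' top' i = lambdaExponent w' bot' i + δ'.1 ∧
      lambdaExponent w' top' j = lambdaExponent w' bot' j + δ'.2.1 ∧
      lambdaExponent w' top' k = lambdaExponent w' bot' k + δ'.2.2)
    (hf : f₁ = f + f₂)
    (hdeg₁ : withTriple i j k p₁.val (movedTriple (p₁.val i, p₁.val j, p₁.val k)) top' = -1)
    (hdeg₂ : withTriple i j k p₂.val
      (movedTriple (p₁.val i, p₁.val j, p₁.val k) + δ') bot' = 1) :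
    moveCoeff w i j k a (Sum.inl p₁) * moveCoeff w i j k a (Sum.inr top) =
      moveCoeff w i j k a (Sum.inl p₂) * moveCoeff w i j k a (Sum.inr bot) := by
  have bi := congrFun hbal i
  have bj := congrFun hbal j
  have bk := congrFun hbal k
  simp only [Pi.add_apply] at bi bj bk
  have hm₁ := h.isMovable hw p₁.2
  have hm₂ := h.isMovable hw p₂.2
  have hp₂ : (p₂.val i, p₂.val j, p₂.val k) = (p₁.val i, p₁.val j, p₁.val k) + δ := by
    refine Prod.ext ?_ (Prod.ext ?_ ?_) <;> simp only [Prod.fst_add, Prod.snd_add] <;> omega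
  have e1 : p₁.val i + δ.1 = p₂.val i := by omega
  have e2 : p₁.val j + δ.2.1 = p₂.val j := by omega
  have e3 : p₁.val k + δ.2.2 = p₂.val k := by omega
  have hmt := hc (p₁.val i) (Finset.mem_Icc.2 (mem_Icc_of_mem_stringExponents p₁.2 i))
    (p₁.val j) (Finset.mem_Icc.2 (mem_Icc_of_mem_stringExponents p₁.2 j))
    (p₁.val k) (Finset.mem_Icc.2 (mem_Icc_of_mem_stringExponents p₁.2 k)) hP hm₁ (hp₂ ▸ hm₂)
    (by rw [e1]; exact Finset.mem_Icc.2 (mem_Icc_of_mem_stringExponents p₂.2 i))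
    (by rw [e2]; exact Finset.mem_Icc.2 (mem_Icc_of_mem_stringExponents p₂.2 j))
    (by rw [e3]; exact Finset.mem_Icc.2 (mem_Icc_of_mem_stringExponents p₂.2 k))
  rw [← hp₂] at hmt
  refine h.box_equation hw hw' ha (moveTo_movedTriple hm₁) hmt htop hbot hbox hbal htop' hbot'
    ?_ ?_ ?_ hdeg₁ hdeg₂ ?_
  · rw [hδ'.1, Prod.fst_add]; ring
  · rw [hδ'.2.1, Prod.snd_add, Prod.fst_add]; ring
  · rw [hδ'.2.2, Prod.snd_add, Prod.snd_add]; ring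
  · rw [hf]; ring

/-- The cases are the positions of the two corners relative to `i`, `j`, `k`. Outside the triangle
nothing but powers of C changes; a corner at the triangle moves to the new crossing with the same
letter; and for the triangle itself the equation holds by the very form of the coefficients. -/
theorem IsThreeMove.solvesBoxEquations (h : IsThreeMove w w' i j k)
    (hw : IsReducedDecomposition w) (hw' : IsReducedDecomposition w')
    (ha : SolvesBoxEquations w' a) : SolvesBoxEquations w (moveCoeff w i j k a) := by
  rintro top bot p₁ p₂ ⟨hbox, hbal, hd₁, hd₂⟩
  have hm₁ := h.isMovable hw p₁.2
  have hm₂ := h.isMovable hw p₂.2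
  have bi := congrFun hbal i
  have bj := congrFun hbal j
  have bk := congrFun hbal k
  simp only [Pi.add_apply] at bi bj bk
  have hdeg := movedTriple_degrees
    (p₁.val i) (Finset.mem_Icc.2 (mem_Icc_of_mem_stringExponents p₁.2 i))
    (p₁.val j) (Finset.mem_Icc.2 (mem_Icc_of_mem_stringExponents p₁.2 j))
    (p₁.val k) (Finset.mem_Icc.2 (mem_Icc_of_mem_stringExponents p₁.2 k)) hm₁
  obtain ⟨hij, hik, hjk⟩ := h.ne
  obtain ⟨lij, ljk, lik⟩ := h.lt
  have hbox' := hbox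
  obtain ⟨hlt, hlet, hbtw⟩ := hbox
  have hab := h.letter_ne
  have hwt := h.withTriple_apply
  rcases h.cases top with ht | rfl | rfl | rfl | ht
  · rw [← Fin.lt_def] at ht
    have ht1 := ht.ne
    have ht2 := (ht.trans lij).ne
    have ht3 := (ht.trans lik).ne
    have htop := moveCoeff_other (a := a) (w := w) ht1 ht2 ht3
    have hdt : withTriple i j k p₁.val (movedTriple (p₁.val i, p₁.val j, p₁.val k)) top = -1 := by
      rw [withTriple_other _ _ ht1 ht2 ht3, hd₁]
    obtain ⟨ti, tj, tk⟩ := h.lambda_lt ht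
    obtain ⟨ti', tj', tk'⟩ := h.lambda_lt' ht
    rcases h.cases bot with hb | rfl | rfl | rfl | hb
    · rw [← Fin.lt_def] at hb
      have hb1 := hb.ne
      have hb2 := (hb.trans lij).ne
      have hb3 := (hb.trans lik).ne
      obtain ⟨b1, b2, b3⟩ := h.lambda_lt hb
      obtain ⟨b1', b2', b3'⟩ := h.lambda_lt' hb
      refine h.box_equation_of_isCompatible hw hw' ha isCompatible_zero trivial htop
        (moveCoeff_other hb1 hb2 hb3)
        ⟨hlt, by rw [h.other_of_lt ht, h.other_of_lt hb, hlet], fun q h1 h2 => ?_⟩ hbal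
        (Or.inl ⟨rfl, ht1, ht2, ht3⟩) (Or.inl ⟨rfl, hb1, hb2, hb3⟩)
        ⟨?_, ?_, ?_⟩ ⟨?_, ?_, ?_⟩ ?_ hdt ?_
      · rw [h.other_of_lt ht, h.other_of_lt (h2.trans hb)]
        exact hbtw q h1 h2
      · rw [ti, b1, hlet]; simp
      · rw [tj, b2, hlet]; simp
      · rw [tk, b3, hlet]; simp
      · rw [ti', b1', hlet]; simp
      · rw [tj', b2', hlet]; simp
      · rw [tk', b3', hlet]; simp
      · rw [tj, tk, b2, b3, hlet]; simp
      · rw [withTriple_other _ _ hb1 hb2 hb3, hd₂]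
    -- The box ends at `i`; after the move its letter sits at `j`, so the box is prolonged past the
    -- new crossing `i`.
    · obtain ⟨b1, b2, b3⟩ := h.lambda_i
      obtain ⟨b1', b2', b3'⟩ := h.symm.lambda_j
      rw [hlet, letterCoeff_self] at ti tk tj'
      rw [hlet, letterCoeff_of_adjacent h.adjacent.symm] at tj ti' tk'
      have hz : p₁.val bot = 0 := by omega
      have hq := (hdeg.1 hz (by
        convert hm₂ using 2
        · omega
        · exact Prod.ext (by simp only; omega) (by simp only; omega)))
      refine h.box_equation_of_isCompatible hw hw' ha isCompatible_bot_i hz htop moveCoeff_i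
        (bot' := j) ⟨ht.trans lij, by rw [h.other_of_lt ht, h.new_j, hlet], fun q h1 h2 => ?_⟩ hbal
        (Or.inl ⟨rfl, ht1, ht2, ht3⟩)
        (Or.inr ⟨Or.inl rfl, Or.inr (Or.inl rfl), h.new_j⟩)
        ⟨by simp only; omega, by simp only; omega, by simp only; omega⟩
        ⟨by simp only; omega, by simp only; omega, by simp only; omega⟩
        (by omega) hdt ?_
      · rcases lt_or_ge q bot with h3 | h3
        · rw [h.other_of_lt h3, h.other_of_lt ht]
          exact hbtw q h1 h3
        · obtain rfl : q = bot := by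
            have := h.j_eq
            rw [Fin.le_def] at h3
            rw [Fin.lt_def] at h2
            ext; omega
          rw [h.new_i, h.other_of_lt ht, hlet]
          exact hab.symm
      · rw [(hwt _ _).2.1, Prod.snd_add, Prod.fst_add, hq]
        norm_num
    · obtain ⟨b1, b2, b3⟩ := h.lambda_j
      obtain ⟨b1', b2', b3'⟩ := h.symm.lambda_i
      rw [hlet, letterCoeff_self] at tj ti' tk'
      rw [hlet, letterCoeff_of_adjacent h.adjacent] at ti tk tj'
      have hz : p₁.val bot = 0 := by omega
      have hq := (hdeg.2.1 hz (by
        convert hm₂ using 2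
        · omega
        · exact Prod.ext (by simp only; omega) (by simp only; omega)))
      refine h.box_equation_of_isCompatible hw hw' ha isCompatible_bot_j hz htop h.moveCoeff_j
        (bot' := i) ⟨ht, by rw [h.other_of_lt ht, h.new_i, hlet], fun q h1 h2 => ?_⟩ hbal
        (Or.inl ⟨rfl, ht1, ht2, ht3⟩)
        (Or.inr ⟨Or.inr (Or.inl rfl), Or.inl rfl, h.new_i⟩)
        ⟨by simp only; omega, by simp only; omega, by simp only; omega⟩
        ⟨by simp only; omega, by simp only; omega, by simp only; omega⟩
        (by omega) hdt ?_
      · rw [h.other_of_lt h2, h.other_of_lt ht]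
        exact hbtw q h1 (h2.trans lij)
      · rw [(hwt _ _).1, Prod.fst_add, hq]
        norm_num
    -- A box starting above the triangle cannot end at `k`, since `i` has the same letter and lies
    -- in between.
    · exact absurd (hlet.trans h.same).symm (hbtw i ht lik)
    · rw [← Fin.lt_def] at hb
      have hb1 := (lik.trans hb).ne'
      have hb2 := (ljk.trans hb).ne'
      have hb3 := hb.ne'
      obtain ⟨b1, b2, b3⟩ := h.lambda_gt hb
      obtain ⟨b1', b2', b3'⟩ := h.symm.lambda_gt hb
      have hni : w top ≠ w i := (hbtw i ht (lik.trans hb)).symm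
      have hnj : w top ≠ w j := (hbtw j (ht.trans lij) (ljk.trans hb)).symm
      have hbx : IsBox w' top bot := by
        refine ⟨hlt, by rw [h.other_of_lt ht, h.other_of_gt hb, hlet], fun q h1 h2 => ?_⟩
        rw [h.other_of_lt ht]
        by_cases c1 : q = i
        · rw [c1, h.new_i]; exact hnj.symm
        by_cases c2 : q = j
        · rw [c2, h.new_j]; exact hni.symm
        by_cases c3 : q = k
        · rw [c3, h.new_k]; exact hnj.symm
        rw [h.other q c1 c2 c3]
        exact hbtw q h1 h2
      have ot : top = top ∧ top ≠ i ∧ top ≠ j ∧ top ≠ k := ⟨rfl, ht1, ht2, ht3⟩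
      have ob : bot = bot ∧ bot ≠ i ∧ bot ≠ j ∧ bot ≠ k := ⟨rfl, hb1, hb2, hb3⟩
      have hdb : ∀ t, withTriple i j k p₂.val t bot = 1 := fun t => by
        rw [withTriple_other _ _ hb1 hb2 hb3, hd₂]
      rcases letterCoeff_of_ne hni with ⟨ci, vi⟩ | ⟨ci, vi⟩
      -- A column cannot be adjacent to two columns that are adjacent to each other.
      · have vj : letterCoeff (w top) (w j) = 0 := by
          rcases letterCoeff_of_ne hnj with ⟨cj, vj⟩ | ⟨cj, vj⟩
          · have cij := h.adjacent
            unfold Adjacent at ci cj cij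
            omega
          · exact vj
        rw [vi] at ti tk tj'
        rw [vj] at tj ti' tk'
        exact h.box_equation_of_isCompatible hw hw' ha isCompatible_adjacent_i
          (h.ne_of_box hw hbox' p₁.2 p₂.2 hbal ht hb ci.symm hnj) htop
          (moveCoeff_other hb1 hb2 hb3) hbx hbal (Or.inl ot) (Or.inl ob)
          ⟨by simp only; omega, by simp only; omega, by simp only; omega⟩
          ⟨by simp only; omega, by simp only; omega, by simp only; omega⟩
          (by omega) hdt (hdb _)
      · rw [vi] at ti tk tj'
        rcases letterCoeff_of_ne hnj with ⟨cj, vj⟩ | ⟨cj, vj⟩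
        · rw [vj] at tj ti' tk'
          exact h.box_equation_of_isCompatible hw hw' ha isCompatible_adjacent_j trivial htop
            (moveCoeff_other hb1 hb2 hb3) hbx hbal (Or.inl ot) (Or.inl ob)
            ⟨by simp only; omega, by simp only; omega, by simp only; omega⟩
            ⟨by simp only; omega, by simp only; omega, by simp only; omega⟩
            (by omega) hdt (hdb _)
        · rw [vj] at tj ti' tk'
          exact h.box_equation_of_isCompatible hw hw' ha isCompatible_zero trivial htop
            (moveCoeff_other hb1 hb2 hb3) hbx hbal (Or.inl ot) (Or.inl ob)
            ⟨by simp; omega, by simp; omega, by simp; omega⟩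
            ⟨by simp; omega, by simp; omega, by simp; omega⟩ (by omega) hdt (hdb _)
  -- A box that starts at `i` is the triangle itself.
  · have hbk : bot = k := by
      rcases h.cases bot with hb | rfl | rfl | rfl | hb
      · exact absurd hlt (not_lt.2 (Fin.le_def.2 hb.le))
      · exact absurd hlt (lt_irrefl _)
      · exact absurd hlet hab
      · rfl
      · exact absurd h.same (hbtw k lik hb)
    subst hbk
    obtain ⟨b1, b2, b3⟩ := h.lambda_k
    obtain ⟨t1, t2, t3⟩ := h.lambda_i
    have hoff : ∀ q, q ≠ top → q ≠ j → q ≠ bot → p₁.val q = p₂.val q := by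
      intro q c1 c2 c3
      have := congrFun hbal q
      simp only [Pi.add_apply] at this
      rcases h.off_cases c1 c2 c3 with hq | hq
      · rw [lambdaExponent_of_gt hq, lambdaExponent_of_gt (hq.trans lik)] at this
        omega
      · rw [lambdaExponent_of_lt hq, lambdaExponent_of_lt (lik.trans hq), h.same] at this
        omega
    have x1 : p₁.val bot = 0 := by omega
    have x2 : p₂.val top = 0 := by omega
    have e₁ : MoveTo (p₁.val top, p₁.val j, p₁.val bot) (p₁.val j, 0, p₁.val j - 1) (p₁.val j) :=
      Or.inr (Or.inr (Or.inl ⟨hd₁, x1, rfl, rfl, rfl, rfl⟩))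
    have e₂ : MoveTo (p₂.val top, p₂.val j, p₂.val bot) (p₁.val j, 0, p₁.val j - 1)
        (p₁.val j - 1) :=
      Or.inr (Or.inl ⟨x2, hd₂, by simp only; omega, rfl, by simp only; omega, by simp only; omega⟩)
    rw [h.moveCoeff_inl hw hw' ha p₁ e₁, h.moveCoeff_inl hw hw' ha p₂ e₂, h.moveCoeff_k,
      moveCoeff_i]
    -- Both string inequalities of the small box merge into the same inequality of `w'`, so only the
    -- powers of C remain to be compared.
    have : withTriple top j bot p₁.val (p₁.val j, 0, p₁.val j - 1) =
        withTriple top j bot p₂.val (p₁.val j, 0, p₁.val j - 1) := by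
      funext q
      unfold withTriple
      split_ifs with c1 c2 c3
      · rfl
      · rfl
      · rfl
      · exact hoff q c1 c2 c3
    rw [this, mul_mul_mul_comm, ← zpow_add, mul_mul_mul_comm _ _ (a (Sum.inr j)) (_ ^ (-1 : ℤ)),
      ← zpow_add]
    congr 2
    ring
  -- The box starts at `j`; after the move its letter sits at `k`, so the box is shortened at the
  -- top.
  · have hb : k < bot := by
      rcases h.cases bot with hb | rfl | rfl | rfl | hb
      · exact absurd (hlt.trans (Fin.lt_def.2 hb)) (not_lt.2 lij.le)
      · exact absurd hlt (not_lt.2 lij.le)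
      · exact absurd hlt (lt_irrefl _)
      · exact absurd (hlet.trans h.same).symm hab
      · exact hb
    have hb1 := (lik.trans hb).ne'
    have hb2 := hlt.ne'
    have hb3 := hb.ne'
    obtain ⟨b1, b2, b3⟩ := h.lambda_gt hb
    obtain ⟨b1', b2', b3'⟩ := h.symm.lambda_gt hb
    obtain ⟨t1, t2, t3⟩ := h.lambda_j
    obtain ⟨t1', t2', t3'⟩ := h.symm.lambda_k
    have hq := hdeg.2.2.1 hd₁ (by
      convert hm₂ using 2
      · omega
      · exact Prod.ext (by simp only; omega) (by simp only; omega))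
    have hbot := moveCoeff_other (a := a) (w := w) hb1 hb2 hb3
    refine h.box_equation_of_isCompatible hw hw' ha isCompatible_top_j hd₁ h.moveCoeff_j' hbot
      ⟨hb, by rw [h.new_k, h.other_of_gt hb, hlet], fun q h1 h2 => ?_⟩ hbal
      (Or.inr ⟨Or.inr (Or.inl rfl), Or.inr (Or.inr rfl), h.new_k⟩)
      (Or.inl ⟨rfl, hb1, hb2, hb3⟩)
      ⟨by simp only; omega, by simp only; omega, by simp only; omega⟩
      ⟨by simp only; omega, by simp only; omega, by simp only; omega⟩
      (by omega) ?_ ?_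
    · rw [h.new_k, h.other_of_gt h1]
      exact hbtw q (ljk.trans h1) h2
    · rw [(hwt _ _).2.2, hq]
    · rw [withTriple_other _ _ hb1 hb2 hb3, hd₂]
  · have hb : top < bot := hlt
    have hb1 := (lik.trans hb).ne'
    have hb2 := (ljk.trans hb).ne'
    have hb3 := hb.ne'
    obtain ⟨b1, b2, b3⟩ := h.lambda_gt hb
    obtain ⟨b1', b2', b3'⟩ := h.symm.lambda_gt hb
    obtain ⟨t1, t2, t3⟩ := h.lambda_k
    obtain ⟨t1', t2', t3'⟩ := h.symm.lambda_j
    have hq := hdeg.2.2.2 hd₁ (by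
      convert hm₂ using 2
      · omega
      · exact Prod.ext (by simp only; omega) (by simp only; omega))
    have hbot := moveCoeff_other (a := a) (w := w) hb1 hb2 hb3
    refine h.box_equation_of_isCompatible hw hw' ha isCompatible_top_k hd₁ h.moveCoeff_k hbot
      (top' := j) ⟨ljk.trans hb, by rw [h.new_j, h.other_of_gt hb, ← hlet, h.same],
        fun q h1 h2 => ?_⟩ hbal
      (Or.inr ⟨Or.inr (Or.inr rfl), Or.inr (Or.inl rfl), by rw [h.new_j, h.same]⟩)
      (Or.inl ⟨rfl, hb1, hb2, hb3⟩)
      ⟨by simp only; omega, by simp only; omega, by simp only; omega⟩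
      ⟨by simp only; omega, by simp only; omega, by simp only; omega⟩
      (by omega) ?_ ?_
    · rcases lt_or_ge top q with h3 | h3
      · rw [h.new_j, h.other_of_gt h3, ← h.same]
        exact hbtw q h3 h2
      · obtain rfl : q = top := by
          have := h.k_eq
          rw [Fin.le_def] at h3
          rw [Fin.lt_def] at h1
          ext; omega
        rw [h.new_k, h.new_j]
        exact hab.symm
    · rw [(hwt _ _).2.1, hq]
    · rw [withTriple_other _ _ hb1 hb2 hb3, hd₂]
  · rw [← Fin.lt_def] at ht
    have hb : k < bot := ht.trans hlt
    have ht1 := (lik.trans ht).ne'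
    have ht2 := (ljk.trans ht).ne'
    have ht3 := ht.ne'
    have hb1 := (lik.trans hb).ne'
    have hb2 := (ljk.trans hb).ne'
    have hb3 := hb.ne'
    obtain ⟨t1, t2, t3⟩ := h.lambda_gt ht
    obtain ⟨t1', t2', t3'⟩ := h.symm.lambda_gt ht
    obtain ⟨b1, b2, b3⟩ := h.lambda_gt hb
    obtain ⟨b1', b2', b3'⟩ := h.symm.lambda_gt hb
    refine h.box_equation_of_isCompatible hw hw' ha isCompatible_zero trivial
      (moveCoeff_other ht1 ht2 ht3) (moveCoeff_other hb1 hb2 hb3)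
      ⟨hlt, by rw [h.other_of_gt ht, h.other_of_gt hb, hlet], fun q h1 h2 => ?_⟩ hbal
      (Or.inl ⟨rfl, ht1, ht2, ht3⟩) (Or.inl ⟨rfl, hb1, hb2, hb3⟩)
      ⟨by rw [t1, b1]; rfl, by rw [t2, b2]; rfl, by rw [t3, b3]; rfl⟩
      ⟨by rw [t1', b1']; rfl, by rw [t2', b2']; rfl, by rw [t3', b3']; rfl⟩
      (by rw [t2, t3, b2, b3]; rfl) ?_ ?_
    · rw [h.other_of_gt ht, h.other_of_gt (ht.trans h1)]
      exact hbtw q h1 h2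
    · rw [withTriple_other _ _ ht1 ht2 ht3, hd₁]
    · rw [withTriple_other _ _ hb1 hb2 hb3, hd₂]

/-- The parameter is unchanged, the triples move back, and the two powers of C are opposite. The box
equations are needed because moving back may require the other term of a split than the one chosen
in the definition. -/
theorem IsThreeMove.moveCoeff_moveCoeff (h : IsThreeMove w w' i j k)
    (hw : IsReducedDecomposition w) (hw' : IsReducedDecomposition w')
    (ha : SolvesBoxEquations w' a) : moveCoeff w' i j k (moveCoeff w i j k a) = a := by
  funext d
  rcases d with m | q
  · have hm := h.symm.isMovable hw' m.2
    have hmt := moveTo_movedTriple hm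
    have hmem := h.symm.withTriple_mem hw' hw m.2 hmt.tripleMove
    rw [h.symm.moveCoeff_inl hw' hw (h.solvesBoxEquations hw hw' ha) m hmt, h.ratio_moveCoeff,
      stringValue_of_mem _ hmem]
    have hmt' := hmt.symm
    obtain ⟨h1, h2, h3⟩ := h.withTriple_apply m.val
      (movedTriple (m.val i, m.val j, m.val k))
    have hback : withTriple i j k (withTriple i j k m.val
        (movedTriple (m.val i, m.val j, m.val k))) (m.val i, m.val j, m.val k) = m.val := by
      funext q
      unfold withTriple
      split_ifs with c1 c2 c3
      · rw [c1]
      · rw [c2]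
      · rw [c3]
      · rfl
    rw [h.moveCoeff_inl hw hw' ha ⟨_, hmem⟩ (t := (m.val i, m.val j, m.val k))
      (e := -movedPower (m.val i, m.val j, m.val k))
      (by simp only; rw [h1, h2, h3]; exact hmt'), mul_assoc,
      ← zpow_add, neg_add_cancel, zpow_zero, mul_one]
    rw [hback, stringValue_of_mem a m.2]
  · by_cases c1 : q = i
    · subst c1
      rw [moveCoeff_i, h.ratio_moveCoeff, h.moveCoeff_j, mul_assoc, ← zpow_add]
      simp
    by_cases c2 : q = j
    · subst c2
      rw [h.symm.moveCoeff_j, h.ratio_moveCoeff, moveCoeff_i, mul_assoc, ← zpow_add]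
      simp
    by_cases c3 : q = k
    · subst c3
      rw [h.symm.moveCoeff_k, h.ratio_moveCoeff, h.moveCoeff_j', mul_assoc, ← zpow_add]
      simp
    rw [moveCoeff_other c1 c2 c3, h.ratio_moveCoeff, moveCoeff_other c1 c2 c3, mul_assoc,
      ← zpow_add]
    have : lambdaExponent w q j - lambdaExponent w q k +
        (lambdaExponent w' q j - lambdaExponent w' q k) = 0 := by
      rcases h.off_cases c1 c2 c3 with hq | hq
      · obtain ⟨-, x1, x2⟩ := h.lambda_lt hq
        obtain ⟨-, y1, y2⟩ := h.lambda_lt' hq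
        rw [x1, x2, y1, y2]
        ring
      · obtain ⟨-, x1, x2⟩ := h.lambda_gt hq
        obtain ⟨-, y1, y2⟩ := h.symm.lambda_gt hq
        rw [x1, x2, y1, y2]
        ring
    rw [this, zpow_zero, mul_one]

end Coefficients

/-! ### Laurent polynomials: monomials, evaluation, extensionality -/

section Laurent

variable {S L ι : Type} [CommRing S] [CommRing L]

theorem coe_monomialUnit (m : ι → ℤ) :
    (monomialUnit S m : Laurent S ι) = AddMonoidAlgebra.single m 1 := rfl

theorem monomialUnit_add (m m' : ι → ℤ) :
    monomialUnit S (m + m') = monomialUnit S m * monomialUnit S m' := by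
  simp [monomialUnit, ofAdd_add]

/-- Monomials as a homomorphism from the additive group of exponents. -/
def monomialHom (S : Type) [CommRing S] (ι : Type) :
    Multiplicative (ι → ℤ) →* (Laurent S ι)ˣ where
  toFun m := monomialUnit S m.toAdd
  map_one' := by ext1; rfl
  map_mul' m m' := monomialUnit_add _ _

theorem monomialUnit_eq_prod [Fintype ι] [DecidableEq ι] (m : ι → ℤ) :
    monomialUnit S m = ∏ q, varUnit S q ^ m q := by
  have h : m = ∑ q, m q • (Pi.single q 1 : ι → ℤ) := by
    rw [← Finset.univ_sum_single m]
    refine Finset.sum_congr rfl fun q _ => ?_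
    rw [← Pi.single_smul, Finset.univ_sum_single, smul_eq_mul, mul_one]
  have e : monomialUnit S m = monomialHom S ι (Multiplicative.ofAdd m) := rfl
  rw [e]
  conv_lhs => rw [h]
  rw [ofAdd_sum, map_prod]
  exact Finset.prod_congr rfl fun q _ => by rw [ofAdd_zsmul, map_zpow]; rfl

variable [Fintype ι]

theorem laurentEval_single (γ : S →+* L) (u : ι → Lˣ) (m : ι → ℤ) (c : S) :
    laurentEval γ u (AddMonoidAlgebra.single m c) = γ c * ((∏ q, u q ^ m q : Lˣ) : L) := by
  simp only [laurentEval, AddMonoidAlgebra.liftNCRingHom]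
  exact AddMonoidAlgebra.liftNC_single _ _ _ _

theorem laurentEval_algebraMap (γ : S →+* L) (u : ι → Lˣ) (c : S) :
    laurentEval γ u (algebraMap S (Laurent S ι) c) = γ c := by
  rw [AddMonoidAlgebra.coe_algebraMap, Function.comp_apply, laurentEval_single]
  simp

theorem laurentEval_varUnit [DecidableEq ι] (γ : S →+* L) (u : ι → Lˣ) (q : ι) :
    laurentEval γ u (varUnit S q) = u q := by
  rw [varUnit, coe_monomialUnit, laurentEval_single, map_one, one_mul, Finset.prod_eq_single q]
  · simp
  · intro r _ h
    simp [h]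
  · simp

theorem laurent_hom_ext [DecidableEq ι] {φ ψ : Laurent S ι →+* L}
    (h : ∀ c, φ (algebraMap S _ c) = ψ (algebraMap S _ c))
    (hv : ∀ q : ι, φ (varUnit S q : Laurent S ι) = ψ (varUnit S q : Laurent S ι)) : φ = ψ := by
  have hv' : (Units.map (φ : Laurent S ι →* L)).comp (monomialHom S ι) =
      (Units.map (ψ : Laurent S ι →* L)).comp (monomialHom S ι) := by
    refine MonoidHom.ext fun m => ?_
    have e : monomialHom S ι m = ∏ q, varUnit S q ^ m.toAdd q := monomialUnit_eq_prod m.toAdd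
    simp only [MonoidHom.comp_apply, e, map_prod, map_zpow]
    refine Finset.prod_congr rfl fun q _ => ?_
    congr 1
    ext1
    exact hv q
  refine AddMonoidAlgebra.ringHom_ext h fun m => ?_
  exact congrArg Units.val (DFunLike.congr_fun hv' (Multiplicative.ofAdd m))

end Laurent

/-! ### The isomorphism of parameter spaces -/

section Param

variable {n N : ℕ} {w w' : Fin N → Fin n} {i j k : Fin N}

theorem map_stringValue {G H : Type*} [CommGroup G] [CommGroup H] (f : G →* H)
    (a : Inequality w → G) (m : Fin N → ℤ) :
    f (stringValue a m) = stringValue (fun d => f (a d)) m := by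
  unfold stringValue
  split_ifs
  · rfl
  · exact map_one f

/-- Naturality in the group of coefficients: it passes from the universal coefficients to points,
and reduces the inverse property of the ring homomorphisms to that of `moveCoeff`. -/
theorem map_moveCoeff {G H : Type*} [CommGroup G] [CommGroup H] (f : G →* H)
    (a : Inequality w' → G) (d : Inequality w) :
    f (moveCoeff w i j k a d) = moveCoeff w i j k (fun d => f (a d)) d := by
  rcases d with m | q
  · simp only [moveCoeff, Sum.elim_inl, map_mul, map_stringValue, map_zpow, map_div]
  · simp only [moveCoeff, Sum.elim_inr]
    split_ifs <;> simp only [map_mul, map_zpow, map_div]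

theorem SolvesBoxEquations.map {G H : Type*} [CommGroup G] [CommGroup H] (f : G →* H)
    {a : Inequality w → G} (ha : SolvesBoxEquations w a) :
    SolvesBoxEquations w (fun d => f (a d)) := by
  intro top bot p₁ p₂ hb
  simp only [← map_mul, ha top bot p₁ p₂ hb]

theorem solvesBoxEquations_univCoeff (w : Fin N → Fin n) :
    SolvesBoxEquations w (univCoeff w) := by
  intro top bot p₁ p₂ hb
  ext1
  refine Ideal.Quotient.eq.2 (Ideal.subset_span ?_)
  exact ⟨top, bot, p₁, p₂, hb, rfl⟩

theorem solvesBoxEquations_coeffAt {S : Type} [CommRing S] (γ : ParamRing w →+* S) :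
    SolvesBoxEquations w (coeffAt γ) :=
  (solvesBoxEquations_univCoeff w).map (Units.map (γ : ParamRing w →* S))

section Lift

variable {S : Type} [CommRing S] [Algebra ℂ S]

/-- The homomorphism from the coordinate ring of the parameter space that is given by a solution
of the box equations. -/
def paramLift (a : Inequality w → Sˣ) (ha : SolvesBoxEquations w a) : ParamRing w →ₐ[ℂ] S where
  __ := Ideal.Quotient.lift (boxIdeal w) (laurentEval (algebraMap ℂ S) a) (by
    intro x hx
    have hle : boxIdeal w ≤ RingHom.ker (laurentEval (algebraMap ℂ S) a) := by
      refine Ideal.span_le.2 ?_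
      rintro x ⟨top, bot, p₁, p₂, hb, rfl⟩
      simp only [SetLike.mem_coe, RingHom.mem_ker, map_sub, map_mul, coeffVar,
        laurentEval_varUnit]
      rw [← Units.val_mul, ha top bot p₁ p₂ hb, Units.val_mul, sub_self]
    exact hle hx)
  commutes' c := laurentEval_algebraMap (algebraMap ℂ S) a c

theorem paramLift_univCoeff (a : Inequality w → Sˣ) (ha : SolvesBoxEquations w a)
    (d : Inequality w) : paramLift a ha (univCoeff w d) = a d :=
  laurentEval_varUnit (algebraMap ℂ S) a d

theorem paramRing_hom_ext {φ ψ : ParamRing w →ₐ[ℂ] S}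
    (h : ∀ d, φ (univCoeff w d) = ψ (univCoeff w d)) : φ = ψ := by
  refine Ideal.Quotient.algHom_ext _ ?_
  refine AlgHom.coe_ringHom_injective ?_
  refine laurent_hom_ext (fun c => ?_) h
  exact (φ.commutes c).trans (ψ.commutes c).symm

end Lift

/-- The pull-back of functions under the isomorphism of parameter spaces of a 3-move. -/
def IsThreeMove.paramHom (h : IsThreeMove w w' i j k) (hw : IsReducedDecomposition w)
    (hw' : IsReducedDecomposition w') : ParamRing w →ₐ[ℂ] ParamRing w' :=
  paramLift (moveCoeff w i j k (univCoeff w'))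
    (h.solvesBoxEquations hw hw' (solvesBoxEquations_univCoeff w'))

theorem IsThreeMove.coeffAt_paramHom (h : IsThreeMove w w' i j k) (hw : IsReducedDecomposition w)
    (hw' : IsReducedDecomposition w') :
    coeffAt (h.paramHom hw hw' : ParamRing w →+* ParamRing w') =
      moveCoeff w i j k (univCoeff w') := by
  funext d
  ext1
  exact paramLift_univCoeff (moveCoeff w i j k (univCoeff w'))
    (h.solvesBoxEquations hw hw' (solvesBoxEquations_univCoeff w')) d

theorem IsThreeMove.paramHom_comp (h : IsThreeMove w w' i j k) (hw : IsReducedDecomposition w)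
    (hw' : IsReducedDecomposition w') :
    (h.symm.paramHom hw' hw).comp (h.paramHom hw hw') = AlgHom.id ℂ (ParamRing w) := by
  refine paramRing_hom_ext fun d => ?_
  have e : (h.paramHom hw hw') (univCoeff w d) = moveCoeff w i j k (univCoeff w') d :=
    congrArg Units.val (congrFun (h.coeffAt_paramHom hw hw') d)
  rw [AlgHom.comp_apply, e]
  have e' := map_moveCoeff (G := (ParamRing w')ˣ) (H := (ParamRing w)ˣ)
    (w := w) (i := i) (j := j) (k := k) (Units.map
    ((h.symm.paramHom hw' hw : ParamRing w' →+* ParamRing w) : ParamRing w' →* ParamRing w))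
    (univCoeff w') d
  have e'' : (fun d => Units.map ((h.symm.paramHom hw' hw : ParamRing w' →+* ParamRing w) :
      ParamRing w' →* ParamRing w) (univCoeff w' d)) = moveCoeff w' i j k (univCoeff w) :=
    h.symm.coeffAt_paramHom hw' hw
  rw [e'', h.symm.moveCoeff_moveCoeff hw' hw (solvesBoxEquations_univCoeff w)] at e'
  exact congrArg Units.val e'

/-- The isomorphism of parameter spaces of a 3-move, as an isomorphism of coordinate rings. -/
def IsThreeMove.paramEquiv (h : IsThreeMove w w' i j k) (hw : IsReducedDecomposition w)
    (hw' : IsReducedDecomposition w') : ParamRing w ≃ₐ[ℂ] ParamRing w' :=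
  AlgEquiv.ofAlgHom (h.paramHom hw hw') (h.symm.paramHom hw' hw)
    (h.symm.paramHom_comp hw' hw) (h.paramHom_comp hw hw')

end Param

/-! ### Rearranging the sum over string exponents -/

section Sums

variable {n N : ℕ} {w w' : Fin N → Fin n} {i j k : Fin N}

/-- The exponent vectors of the string inequalities, as a finset. -/
def stringFinset (w : Fin N → Fin n) : Finset (Fin N → ℤ) := (stringExponents w).toFinset

theorem mem_stringFinset {m : Fin N → ℤ} : m ∈ stringFinset w ↔ m ∈ stringExponents w :=
  Set.mem_toFinset

/-- The exponents at the three places of a 3-move. -/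
def tripleAt (i j k : Fin N) (m : Fin N → ℤ) : ℤ × ℤ × ℤ := (m i, m j, m k)

theorem IsThreeMove.tripleAt_withTriple (h : IsThreeMove w w' i j k) (m : Fin N → ℤ)
    (t : ℤ × ℤ × ℤ) : tripleAt i j k (withTriple i j k m t) = t := by
  obtain ⟨h1, h2, h3⟩ := h.withTriple_apply m t
  unfold tripleAt
  rw [h1, h2, h3]

theorem withTriple_withTriple (m : Fin N → ℤ) (t t' : ℤ × ℤ × ℤ) :
    withTriple i j k (withTriple i j k m t) t' = withTriple i j k m t' := by
  funext q
  unfold withTriple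
  split_ifs <;> rfl

theorem withTriple_tripleAt (m : Fin N → ℤ) : withTriple i j k m (tripleAt i j k m) = m := by
  funext q
  unfold withTriple tripleAt
  split_ifs with c1 c2 c3
  · rw [c1]
  · rw [c2]
  · rw [c3]
  · rfl

/-- The exponents that occur once on each side of a 3-move. -/
def IsFlip (t : ℤ × ℤ × ℤ) : Prop := t.1 = t.2.2

/-- The exponents of the terms that split into two. -/
def IsSplit (t : ℤ × ℤ × ℤ) : Prop := t.1 = t.2.2 + 1 ∧ t.2.1 = 0

/-- The exponents of the first term of a sum of two. -/
def IsFirst (t : ℤ × ℤ × ℤ) : Prop := t.1 = 0 ∧ t.2.2 = 1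

/-- The exponents of the second term of a sum of two. -/
def IsSecond (t : ℤ × ℤ × ℤ) : Prop := t.1 = -1 ∧ t.2.2 = 0

instance : DecidablePred IsFlip := fun t => by unfold IsFlip; infer_instance
instance : DecidablePred IsSplit := fun t => by unfold IsSplit; infer_instance
instance : DecidablePred IsFirst := fun t => by unfold IsFirst; infer_instance
instance : DecidablePred IsSecond := fun t => by unfold IsSecond; infer_instance

variable {M : Type*} [AddCommMonoid M]

/-- The sum over the string exponents whose exponents at the three places satisfy `P`. -/
def tripleSum (w : Fin N → Fin n) (i j k : Fin N) (P : ℤ × ℤ × ℤ → Prop) [DecidablePred P]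
    (F : (Fin N → ℤ) → M) : M :=
  ∑ m ∈ (stringFinset w).filter (fun m => P (tripleAt i j k m)), F m

/-- The admissible triples fall into four disjoint classes: m_i - m_k is 0 for flips, 1 for splits,
and -1 for the two members of a merging pair. -/
theorem IsThreeMove.sum_eq_tripleSum (h : IsThreeMove w w' i j k)
    (hw : IsReducedDecomposition w) (F : (Fin N → ℤ) → M) :
    ∑ m ∈ stringFinset w, F m = tripleSum w i j k IsFlip F + tripleSum w i j k IsSplit F +
      (tripleSum w i j k IsFirst F + tripleSum w i j k IsSecond F) := by
  simp only [tripleSum, Finset.sum_filter, ← Finset.sum_add_distrib]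
  refine Finset.sum_congr rfl fun m hm => ?_
  have hmv := h.isMovable hw (mem_stringFinset.1 hm)
  unfold IsMovable at hmv
  simp only at hmv
  have hF : IsFlip (tripleAt i j k m) ↔ m i = m k := Iff.rfl
  have hS : IsSplit (tripleAt i j k m) ↔ m i = m k + 1 ∧ m j = 0 := Iff.rfl
  have h₁ : IsFirst (tripleAt i j k m) ↔ m i = 0 ∧ m k = 1 := Iff.rfl
  have h₂ : IsSecond (tripleAt i j k m) ↔ m i = -1 ∧ m k = 0 := Iff.rfl
  rcases hmv with hmv | hmv | hmv | hmv
  · rw [if_pos (hF.2 (by omega)), if_neg (mt hS.1 (by omega)), if_neg (mt h₁.1 (by omega)),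
      if_neg (mt h₂.1 (by omega))]
    simp
  · rw [if_neg (mt hF.1 (by omega)), if_neg (mt hS.1 (by omega)), if_pos (h₁.2 (by omega)),
      if_neg (mt h₂.1 (by omega))]
    simp
  · rw [if_neg (mt hF.1 (by omega)), if_neg (mt hS.1 (by omega)), if_neg (mt h₁.1 (by omega)),
      if_pos (h₂.2 (by omega))]
    simp
  · rw [if_neg (mt hF.1 (by omega)), if_pos (hS.2 (by omega)), if_neg (mt h₁.1 (by omega)),
      if_neg (mt h₂.1 (by omega))]
    simp

theorem IsThreeMove.tripleSum_move (h : IsThreeMove w w' i j k) (hw : IsReducedDecomposition w)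
    (hw' : IsReducedDecomposition w') {P P' : ℤ × ℤ × ℤ → Prop} [DecidablePred P]
    [DecidablePred P'] (T T' : ℤ × ℤ × ℤ → ℤ × ℤ × ℤ)
    (hT : ∀ t, P t → TripleMove t (T t) ∧ P' (T t) ∧ T' (T t) = t)
    (hT' : ∀ t, P' t → TripleMove t (T' t) ∧ P (T' t) ∧ T (T' t) = t)
    (F : (Fin N → ℤ) → M) :
    tripleSum w i j k P (fun m => F (withTriple i j k m (T (tripleAt i j k m)))) =
      tripleSum w' i j k P' F := by
  refine Finset.sum_nbij' (fun m => withTriple i j k m (T (tripleAt i j k m)))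
    (fun m => withTriple i j k m (T' (tripleAt i j k m))) ?_ ?_ ?_ ?_ (fun _ _ => rfl)
  · intro m hm
    rw [Finset.mem_filter, mem_stringFinset] at hm ⊢
    rw [h.tripleAt_withTriple]
    exact ⟨h.withTriple_mem hw hw' hm.1 (hT _ hm.2).1, (hT _ hm.2).2.1⟩
  · intro m hm
    rw [Finset.mem_filter, mem_stringFinset] at hm ⊢
    rw [h.tripleAt_withTriple]
    exact ⟨h.symm.withTriple_mem hw' hw hm.1 (hT' _ hm.2).1, (hT' _ hm.2).2.1⟩
  · intro m hm
    rw [Finset.mem_filter] at hm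
    rw [h.tripleAt_withTriple, withTriple_withTriple, (hT _ hm.2).2.2, withTriple_tripleAt]
  · intro m hm
    rw [Finset.mem_filter] at hm
    rw [h.tripleAt_withTriple, withTriple_withTriple, (hT' _ hm.2).2.2, withTriple_tripleAt]

theorem IsThreeMove.tripleSum_flip (h : IsThreeMove w w' i j k) (hw : IsReducedDecomposition w)
    (hw' : IsReducedDecomposition w') (F : (Fin N → ℤ) → M) :
    tripleSum w i j k IsFlip (fun m => F (withTriple i j k m (m j, m i, m j))) =
      tripleSum w' i j k IsFlip F := by
  refine h.tripleSum_move hw hw' (fun t => (t.2.1, t.1, t.2.1)) (fun t => (t.2.1, t.1, t.2.1))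
    ?_ ?_ F <;>
  · rintro ⟨x, y, z⟩ ht
    simp only [IsFlip, TripleMove] at ht ⊢
    subst ht
    simp

theorem IsThreeMove.tripleSum_first (h : IsThreeMove w w' i j k) (hw : IsReducedDecomposition w)
    (hw' : IsReducedDecomposition w') (F : (Fin N → ℤ) → M) :
    tripleSum w i j k IsSplit (fun m => F (withTriple i j k m (0, m k, 1))) =
      tripleSum w' i j k IsFirst F := by
  refine h.tripleSum_move hw hw' (fun t => (0, t.2.2, 1)) (fun t => (t.2.1 + 1, 0, t.2.1))
    ?_ ?_ F
  · rintro ⟨x, y, z⟩ ht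
    simp only [IsSplit, IsFirst, TripleMove] at ht ⊢
    obtain ⟨rfl, rfl⟩ := ht
    simp
  · rintro ⟨x, y, z⟩ ht
    simp only [IsSplit, IsFirst, TripleMove] at ht ⊢
    obtain ⟨rfl, rfl⟩ := ht
    simp

theorem IsThreeMove.tripleSum_second (h : IsThreeMove w w' i j k) (hw : IsReducedDecomposition w)
    (hw' : IsReducedDecomposition w') (F : (Fin N → ℤ) → M) :
    tripleSum w i j k IsSplit (fun m => F (withTriple i j k m (-1, m i, 0))) =
      tripleSum w' i j k IsSecond F := by
  refine h.tripleSum_move hw hw' (fun t => (-1, t.1, 0)) (fun t => (t.2.1, 0, t.2.1 - 1))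
    ?_ ?_ F
  · rintro ⟨x, y, z⟩ ht
    simp only [IsSplit, IsSecond, TripleMove] at ht ⊢
    obtain ⟨rfl, rfl⟩ := ht
    simp
  · rintro ⟨x, y, z⟩ ht
    simp only [IsSplit, IsSecond, TripleMove] at ht ⊢
    obtain ⟨rfl, rfl⟩ := ht
    simp

/-- A sum over string exponents is not changed by a 3-move if its terms are related as follows. -/
theorem IsThreeMove.sum_stringFinset (h : IsThreeMove w w' i j k)
    (hw : IsReducedDecomposition w) (hw' : IsReducedDecomposition w') (F G : (Fin N → ℤ) → M)
    (hflip : ∀ m ∈ stringExponents w, m i = m k → F m = G (withTriple i j k m (m j, m i, m j)))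
    (hsplit : ∀ m ∈ stringExponents w, m i = m k + 1 → m j = 0 →
      F m = G (withTriple i j k m (0, m k, 1)) + G (withTriple i j k m (-1, m i, 0)))
    (hmerge : ∀ m ∈ stringExponents w', m i = m k + 1 → m j = 0 →
      F (withTriple i j k m (0, m k, 1)) + F (withTriple i j k m (-1, m i, 0)) = G m) :
    ∑ m ∈ stringFinset w, F m = ∑ m ∈ stringFinset w', G m := by
  rw [h.sum_eq_tripleSum hw, h.symm.sum_eq_tripleSum hw', ← h.tripleSum_flip hw hw' G,
    ← h.tripleSum_first hw hw' G, ← h.tripleSum_second hw hw' G,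
    ← h.symm.tripleSum_first hw' hw F, ← h.symm.tripleSum_second hw' hw F,
    add_assoc, add_assoc]
  congr 1
  · refine Finset.sum_congr rfl fun m hm => ?_
    rw [Finset.mem_filter, mem_stringFinset] at hm
    exact hflip m hm.1 hm.2
  -- The merging pairs of each diagram are by now indexed by the splitting exponents of the other,
  -- so the remaining sums are matched crosswise.
  rw [add_comm]
  congr 1
  · unfold tripleSum
    rw [← Finset.sum_add_distrib]
    refine Finset.sum_congr rfl fun m hm => ?_
    rw [Finset.mem_filter, mem_stringFinset] at hm
    exact hmerge m hm.1 hm.2.1 hm.2.2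
  · unfold tripleSum
    rw [← Finset.sum_add_distrib]
    refine Finset.sum_congr rfl fun m hm => ?_
    rw [Finset.mem_filter, mem_stringFinset] at hm
    exact hsplit m hm.1 hm.2.1 hm.2.2

end Sums

/-! ### Pull-back of a single monomial -/

section Monomials

variable {N : ℕ} {i j k : Fin N}

theorem prod_triple {G : Type*} [CommGroup G] (hij : i ≠ j) (hik : i ≠ k) (hjk : j ≠ k)
    (F : Fin N → G) : ∏ q, F q =
      F i * F j * F k * ∏ q ∈ Finset.univ.filter (fun q => q ≠ i ∧ q ≠ j ∧ q ≠ k), F q := by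
  have : (Finset.univ : Finset (Fin N)) = insert i (insert j (insert k
      (Finset.univ.filter (fun q => q ≠ i ∧ q ≠ j ∧ q ≠ k)))) := by
    ext q
    simp only [Finset.mem_univ, Finset.mem_insert, Finset.mem_filter, true_and, true_iff]
    tauto
  conv_lhs => rw [this]
  rw [Finset.prod_insert, Finset.prod_insert, Finset.prod_insert, mul_assoc, mul_assoc] <;>
    simp [hij, hik, hjk]

variable {S : Type} [CommRing S] {C : Sˣ}

/-- The factor of a monomial that does not involve the variables of the 3-move. -/
def hRest (i j k : Fin N) (C : Sˣ) (m : Fin N → ℤ) : (HRing i j k C)ˣ :=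
  ∏ q ∈ Finset.univ.filter (fun q => q ≠ i ∧ q ≠ j ∧ q ≠ k), hVar i j k C q ^ m q

theorem hRest_congr {m m' : Fin N → ℤ} (h : ∀ q, q ≠ i → q ≠ j → q ≠ k → m q = m' q) :
    hRest i j k C m = hRest i j k C m' := by
  refine Finset.prod_congr rfl fun q hq => ?_
  rw [Finset.mem_filter] at hq
  rw [h q hq.2.1 hq.2.2.1 hq.2.2.2]

theorem hRest_withTriple (m : Fin N → ℤ) (t : ℤ × ℤ × ℤ) :
    hRest i j k C (withTriple i j k m t) = hRest i j k C m :=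
  hRest_congr fun _ h1 h2 h3 => withTriple_other m t h1 h2 h3

/-- The exponent m_i - m_k of the denominator decides the fate of the term: 0 for one monomial, 1
for a split, -1 for a term that needs a partner. -/
theorem prod_hCoord (hij : i ≠ j) (hik : i ≠ k) (hjk : j ≠ k) (m : Fin N → ℤ) :
    ∏ q, hCoord i j k C q ^ m q =
      hVar i j k C i ^ (m j + m k - m i) * hVar i j k C j ^ m k * hVar i j k C k ^ m j *
        hDenomUnit i j k C ^ (m i - m k) * hConst i j k C ^ (m k - m j) * hRest i j k C m := by
  rw [prod_triple hij hik hjk]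
  congr 1
  · simp only [hCoord, if_true, if_neg hij.symm, if_neg hik.symm, if_neg hjk.symm]
    -- Identities between monomials are identities of units; in additive notation they become linear
    -- identities of exponents.
    apply Additive.ofMul.injective
    simp only [ofMul_mul, ofMul_zpow, ofMul_div]
    module
  · refine Finset.prod_congr rfl fun q hq => ?_
    rw [Finset.mem_filter] at hq
    simp only [hCoord, if_neg hq.2.1, if_neg hq.2.2.1, if_neg hq.2.2.2]

theorem coe_hDenomUnit : (hDenomUnit i j k C : HRing i j k C) =
    hVar i j k C i * hVar i j k C k + hConst i j k C * hVar i j k C j := by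
  have : (hDenomUnit i j k C : HRing i j k C) = algebraMap (Laurent S (Fin N)) (HRing i j k C)
      ((varUnit S i : Laurent S (Fin N)) * varUnit S k +
        algebraMap S (Laurent S (Fin N)) C * varUnit S j) := rfl
  rw [this, map_add, map_mul, map_mul, ← IsScalarTower.algebraMap_apply]
  rfl

theorem mul_hDenomUnit (X : (HRing i j k C)ˣ) : ((X * hDenomUnit i j k C : (HRing i j k C)ˣ) :
    HRing i j k C) = (X * (hVar i j k C i * hVar i j k C k) : (HRing i j k C)ˣ) +
      (X * (hConst i j k C * hVar i j k C j) : (HRing i j k C)ˣ) := by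
  rw [Units.val_mul, coe_hDenomUnit, Units.val_mul, Units.val_mul, Units.val_mul, Units.val_mul,
    mul_add]

theorem algebraMap_single (hij : i ≠ j) (hik : i ≠ k) (hjk : j ≠ k) (m : Fin N → ℤ) (c : Sˣ) :
    algebraMap (Laurent S (Fin N)) (HRing i j k C) (AddMonoidAlgebra.single m (c : S)) =
      ((Units.map (algebraMap S (HRing i j k C) : S →* HRing i j k C) c *
        (hVar i j k C i ^ m i * hVar i j k C j ^ m j * hVar i j k C k ^ m k * hRest i j k C m) :
          (HRing i j k C)ˣ) : HRing i j k C) := by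
  have e : AddMonoidAlgebra.single m (c : S) =
      algebraMap S (Laurent S (Fin N)) c * (monomialUnit S m : Laurent S (Fin N)) := by
    rw [coe_monomialUnit, AddMonoidAlgebra.coe_algebraMap, Function.comp_apply,
      AddMonoidAlgebra.single_mul_single]
    simp
  have e2 : Units.map (algebraMap (Laurent S (Fin N)) (HRing i j k C) :
      Laurent S (Fin N) →* HRing i j k C) (monomialUnit S m) =
      hVar i j k C i ^ m i * hVar i j k C j ^ m j * hVar i j k C k ^ m k * hRest i j k C m := by
    rw [monomialUnit_eq_prod, map_prod, prod_triple hij hik hjk]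
    simp only [map_zpow]
    rfl
  rw [e, map_mul, ← IsScalarTower.algebraMap_apply, Units.val_mul, ← e2]
  rfl

variable {S₀ : Type} [CommRing S₀] {γ : S₀ →+* S}

theorem hPull_single (hij : i ≠ j) (hik : i ≠ k) (hjk : j ≠ k) (m : Fin N → ℤ) {c : S₀} {c' : Sˣ}
    (hc : γ c = c') :
    hPull i j k γ C (AddMonoidAlgebra.single m c) =
      ((Units.map (algebraMap S (HRing i j k C) : S →* HRing i j k C) c' *
        (hVar i j k C i ^ (m j + m k - m i) * hVar i j k C j ^ m k * hVar i j k C k ^ m j *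
        hDenomUnit i j k C ^ (m i - m k) * hConst i j k C ^ (m k - m j) * hRest i j k C m) :
          (HRing i j k C)ˣ) : HRing i j k C) := by
  rw [hPull, laurentEval_single, prod_hCoord hij hik hjk, RingHom.comp_apply, hc, Units.val_mul]
  rfl

end Monomials

/-! ### The pull-back of the polynomial f -/

section PullBack

variable {n N : ℕ} {w w' : Fin N → Fin n} {i j k : Fin N} {S S₀ : Type} [CommRing S]
  [CommRing S₀] {γ : S₀ →+* S} {a : Inequality w → S₀ˣ} {a' : Inequality w' → Sˣ} {C : Sˣ}

/-- The image of a coefficient in the localization. -/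
def hScalar (i j k : Fin N) (C : Sˣ) : Sˣ →* (HRing i j k C)ˣ :=
  Units.map (algebraMap S (HRing i j k C) : S →* HRing i j k C)

theorem hScalar_self : hScalar i j k C C = hConst i j k C := rfl

/-- This is D = t_i t_k + C t_j multiplied by X / D. Read forward it splits a term, read backward it
merges a pair. -/
theorem coe_eq_add (X : (HRing i j k C)ˣ) : (X : HRing i j k C) =
    (X / hDenomUnit i j k C * (hVar i j k C i * hVar i j k C k) : (HRing i j k C)ˣ) +
      (X / hDenomUnit i j k C * (hConst i j k C * hVar i j k C j) : (HRing i j k C)ˣ) := by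
  rw [← mul_hDenomUnit, div_mul_cancel]

theorem IsThreeMove.hPull_string (h : IsThreeMove w w' i j k) (hw : IsReducedDecomposition w)
    (hw' : IsReducedDecomposition w') (ha' : SolvesBoxEquations w' a')
    (hγ : ∀ d, γ (a d) = moveCoeff w i j k a' d) (hC : a' (Sum.inr k) / a' (Sum.inr i) = C)
    {m : Fin N → ℤ} (hm : m ∈ stringExponents w) {t : ℤ × ℤ × ℤ} {e : ℤ}
    (ht : MoveTo (m i, m j, m k) t e) :
    hPull i j k γ C (AddMonoidAlgebra.single m ((stringValue a m : S₀ˣ) : S₀)) =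
      ((hScalar i j k C (stringValue a' (withTriple i j k m t)) *
        (hVar i j k C i ^ (m j + m k - m i) * hVar i j k C j ^ m k * hVar i j k C k ^ m j *
          hDenomUnit i j k C ^ (m i - m k) * hConst i j k C ^ (m k - m j + e) *
          hRest i j k C m) : (HRing i j k C)ˣ) : HRing i j k C) := by
  have hc : γ ((stringValue a m : S₀ˣ) : S₀) =
      (stringValue a' (withTriple i j k m t) * C ^ e : Sˣ) := by
    rw [stringValue_of_mem a hm, hγ, h.moveCoeff_inl hw hw' ha' ⟨m, hm⟩ ht, hC]
  rw [hPull_single h.ne.1 h.ne.2.1 h.ne.2.2 m hc]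
  congr 1
  change hScalar i j k C _ * _ = _
  rw [map_mul, map_zpow, hScalar_self]
  apply Additive.ofMul.injective
  simp only [ofMul_mul, ofMul_zpow]
  module

theorem IsThreeMove.algebraMap_withTriple (h : IsThreeMove w w' i j k) (m : Fin N → ℤ)
    (t : ℤ × ℤ × ℤ) (c : Sˣ) :
    algebraMap (Laurent S (Fin N)) (HRing i j k C)
        (AddMonoidAlgebra.single (withTriple i j k m t) (c : S)) =
      ((hScalar i j k C c *
        (hVar i j k C i ^ t.1 * hVar i j k C j ^ t.2.1 * hVar i j k C k ^ t.2.2 *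
          hRest i j k C m) : (HRing i j k C)ˣ) : HRing i j k C) := by
  rw [algebraMap_single h.ne.1 h.ne.2.1 h.ne.2.2, hRest_withTriple, (h.withTriple_apply m t).1,
    (h.withTriple_apply m t).2.1, (h.withTriple_apply m t).2.2]
  rfl

/-- Flips correspond one to one, a split of `w` gives a pair of `w'`, and a pair of `w` merges into
a split exponent of `w'`. In each case only powers of the variables and of C have to be compared. -/
theorem IsThreeMove.hPull_strings (h : IsThreeMove w w' i j k) (hw : IsReducedDecomposition w)
    (hw' : IsReducedDecomposition w') (ha' : SolvesBoxEquations w' a')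
    (hγ : ∀ d, γ (a d) = moveCoeff w i j k a' d) (hC : a' (Sum.inr k) / a' (Sum.inr i) = C) :
    ∑ m ∈ stringFinset w, hPull i j k γ C
        (AddMonoidAlgebra.single m ((stringValue a m : S₀ˣ) : S₀)) =
      ∑ m ∈ stringFinset w', algebraMap (Laurent S (Fin N)) (HRing i j k C)
        (AddMonoidAlgebra.single m ((stringValue a' m : Sˣ) : S)) := by
  refine h.sum_stringFinset hw hw' _ (fun m => algebraMap (Laurent S (Fin N)) (HRing i j k C)
        (AddMonoidAlgebra.single m ((stringValue a' m : Sˣ) : S))) ?_ ?_ ?_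
  · intro m hm hik
    rw [h.hPull_string hw hw' ha' hγ hC hm (t := (m j, m i, m j))
      (Or.inl ⟨hik, rfl, rfl, rfl, rfl⟩),
      h.algebraMap_withTriple]
    congr 1
    apply Additive.ofMul.injective
    simp only [ofMul_mul, ofMul_zpow, hik]
    module
  · intro m hm hik hj
    have hm₁ : withTriple i j k m (0, m k, 1) ∈ stringExponents w' :=
      h.withTriple_mem hw hw' hm (Or.inr (Or.inr (Or.inr ⟨hik, Or.inl rfl⟩)))
    have hm₂ : withTriple i j k m (-1, m i, 0) ∈ stringExponents w' :=
      h.withTriple_mem hw hw' hm (Or.inr (Or.inr (Or.inr ⟨hik, Or.inr rfl⟩)))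
    -- The two terms produced by D = t_i t_k + C t_j have coefficients of ratio C, which is the
    -- small box equation for `w'`.
    have hs : stringValue a' (withTriple i j k m (-1, m i, 0)) =
        stringValue a' (withTriple i j k m (0, m k, 1)) * C := by
      obtain ⟨b1, b2, b3⟩ := h.withTriple_apply m (0, m k, 1)
      obtain ⟨c1, c2, c3⟩ := h.withTriple_apply m (-1, m i, 0)
      rw [h.symm.small_box ha' hm₂ hm₁ (fun q d1 d2 d3 => by
        rw [withTriple_other _ _ d1 d2 d3, withTriple_other _ _ d1 d2 d3]) c1
        (by rw [b2, c2, hik]) c3 b1 b3, hC]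
    rw [h.hPull_string hw hw' ha' hγ hC hm (t := (0, m k, 1))
      (Or.inr (Or.inr (Or.inr (Or.inl ⟨hik, hj, rfl, rfl, rfl, rfl⟩)))),
      h.algebraMap_withTriple, h.algebraMap_withTriple, hs, map_mul, hScalar_self]
    refine (coe_eq_add _).trans ?_
    congr 2
    · apply Additive.ofMul.injective
      simp only [ofMul_mul, ofMul_zpow, ofMul_div, hik, hj]
      module
    · apply Additive.ofMul.injective
      simp only [ofMul_mul, ofMul_zpow, ofMul_div, hik, hj]
      module
  · intro m hm hik hj
    have hm₁ : withTriple i j k m (0, m k, 1) ∈ stringExponents w :=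
      h.symm.withTriple_mem hw' hw hm (Or.inr (Or.inr (Or.inr ⟨hik, Or.inl rfl⟩)))
    have hm₂ : withTriple i j k m (-1, m i, 0) ∈ stringExponents w :=
      h.symm.withTriple_mem hw' hw hm (Or.inr (Or.inr (Or.inr ⟨hik, Or.inr rfl⟩)))
    obtain ⟨b1, b2, b3⟩ := h.withTriple_apply m (0, m k, 1)
    obtain ⟨c1, c2, c3⟩ := h.withTriple_apply m (-1, m i, 0)
    have hback : ∀ t, withTriple i j k (withTriple i j k m t) (m i, m j, m k) = m := fun t => by
      rw [withTriple_withTriple]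
      exact withTriple_tripleAt m
    rw [h.hPull_string hw hw' ha' hγ hC hm₁ (t := (m i, m j, m k)) (e := m k)
        (by rw [b1, b2, b3]; exact Or.inr (Or.inl ⟨rfl, rfl, hik, hj, rfl, rfl⟩)),
      h.hPull_string hw hw' ha' hγ hC hm₂ (t := (m i, m j, m k)) (e := m i)
        (by rw [c1, c2, c3]; exact Or.inr (Or.inr (Or.inl
          ⟨rfl, rfl, rfl, hj, by simp only; omega, rfl⟩))),
      hback, hback, hRest_withTriple, hRest_withTriple, b1, b2, b3, c1, c2, c3,
      algebraMap_single h.ne.1 h.ne.2.1 h.ne.2.2]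
    change _ = ((hScalar i j k C (stringValue a' m) * _ : (HRing i j k C)ˣ) : HRing i j k C)
    refine Eq.trans ?_ (coe_eq_add _).symm
    rw [add_comm]
    congr 2
    · apply Additive.ofMul.injective
      simp only [ofMul_mul, ofMul_zpow, ofMul_div, hik, hj]
      module
    · apply Additive.ofMul.injective
      simp only [ofMul_mul, ofMul_zpow, ofMul_div, hik, hj]
      module

theorem IsThreeMove.sum_eq_add (h : IsThreeMove w w' i j k) {M : Type*} [AddCommMonoid M]
    (F : Fin N → M) : ∑ q, F q =
      (F i + F k) + F j + ∑ q ∈ Finset.univ.filter (fun q => q ≠ i ∧ q ≠ j ∧ q ≠ k), F q := by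
  have : (Finset.univ : Finset (Fin N)) = insert i (insert k (insert j
      (Finset.univ.filter (fun q => q ≠ i ∧ q ≠ j ∧ q ≠ k)))) := by
    ext q
    simp only [Finset.mem_univ, Finset.mem_insert, Finset.mem_filter, true_and, true_iff]
    tauto
  conv_lhs => rw [this]
  rw [Finset.sum_insert, Finset.sum_insert, Finset.sum_insert, add_assoc, add_assoc] <;>
    simp [h.ne.1, h.ne.2.1, h.ne.2.2, h.ne.2.2.symm]

/-- The terms of λ_i and λ_k carry the power -1 of D and merge into the new λ_j; the term of λ_j
carries the power 1 and splits into the new λ_i and λ_k. Every other λ_q has equal exponents at `i`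
and `k` and goes to the new λ_q. No box equation is needed. -/
theorem IsThreeMove.hPull_lambdas (h : IsThreeMove w w' i j k)
    (hγ : ∀ d, γ (a d) = moveCoeff w i j k a' d) (hC : a' (Sum.inr k) / a' (Sum.inr i) = C) :
    ∑ q, hPull i j k γ C (AddMonoidAlgebra.single (lambdaExponent w q) (a (Sum.inr q) : S₀)) =
      ∑ q, algebraMap (Laurent S (Fin N)) (HRing i j k C)
        (AddMonoidAlgebra.single (lambdaExponent w' q) (a' (Sum.inr q) : S)) := by
  have hp : ∀ q, hPull i j k γ C
      (AddMonoidAlgebra.single (lambdaExponent w q) (a (Sum.inr q) : S₀)) = _ := fun q =>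
    hPull_single h.ne.1 h.ne.2.1 h.ne.2.2 (lambdaExponent w q) (hγ (Sum.inr q))
  have hm : ∀ q, algebraMap (Laurent S (Fin N)) (HRing i j k C)
      (AddMonoidAlgebra.single (lambdaExponent w' q) (a' (Sum.inr q) : S)) = _ := fun q =>
    algebraMap_single h.ne.1 h.ne.2.1 h.ne.2.2 (lambdaExponent w' q) (a' (Sum.inr q))
  have hs : ∀ q q', (q' = q ∧ q ≠ i ∧ q ≠ j ∧ q ≠ k) ∨
      ((q = i ∨ q = j ∨ q = k) ∧ (q' = i ∨ q' = j ∨ q' = k) ∧ w' q' = w q) →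
      hRest i j k C (lambdaExponent w' q') = hRest i j k C (lambdaExponent w q) :=
    fun q q' hq => hRest_congr fun r h1 h2 h3 => h.lambda_off h1 h2 h3 hq
  have rij := hs i j (Or.inr ⟨Or.inl rfl, Or.inr (Or.inl rfl), h.new_j⟩)
  have rkj := hs k j (Or.inr ⟨Or.inr (Or.inr rfl), Or.inr (Or.inl rfl), h.new_j.trans h.same.symm⟩)
  have rji := hs j i (Or.inr ⟨Or.inr (Or.inl rfl), Or.inl rfl, h.new_i⟩)
  have rjk := hs j k (Or.inr ⟨Or.inr (Or.inl rfl), Or.inr (Or.inr rfl), h.new_k⟩)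
  obtain ⟨i1, i2, i3⟩ := h.lambda_i
  obtain ⟨j1, j2, j3⟩ := h.lambda_j
  obtain ⟨k1, k2, k3⟩ := h.lambda_k
  obtain ⟨i1', i2', i3'⟩ := h.symm.lambda_i
  obtain ⟨j1', j2', j3'⟩ := h.symm.lambda_j
  obtain ⟨k1', k2', k3'⟩ := h.symm.lambda_k
  have ck : a' (Sum.inr k) = a' (Sum.inr i) * C := by rw [← hC, mul_div_cancel]
  simp only [hp, hm]
  rw [h.sum_eq_add, h.sum_eq_add]
  change ((hScalar i j k C _ * _ : (HRing i j k C)ˣ) + (hScalar i j k C _ * _ : (HRing i j k C)ˣ) :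
      HRing i j k C) + (hScalar i j k C _ * _ : (HRing i j k C)ˣ) + _ =
    ((hScalar i j k C _ * _ : (HRing i j k C)ˣ) + (hScalar i j k C _ * _ : (HRing i j k C)ˣ) :
      HRing i j k C) + (hScalar i j k C _ * _ : (HRing i j k C)ˣ) + _
  rw [moveCoeff_i, h.moveCoeff_j, h.moveCoeff_k, hC, i1, i2, i3, j1, j2, j3, k1, k2, k3,
    i1', i2', i3', j1', j2', j3', k1', k2', k3', rji, rjk, ← rij, ← rkj, ck]
  congr 1
  · rw [add_comm (_ + _) ((hScalar i j k C (a' (Sum.inr j)) * _ : (HRing i j k C)ˣ) :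
      HRing i j k C)]
    congr 1
    · refine Eq.trans ?_ (coe_eq_add _).symm
      rw [add_comm]
      congr 2
      · apply Additive.ofMul.injective
        simp only [ofMul_mul, ofMul_zpow, ofMul_div, map_mul, map_zpow, hScalar_self]
        module
      · apply Additive.ofMul.injective
        simp only [ofMul_mul, ofMul_zpow, ofMul_div, map_mul, map_zpow, hScalar_self]
        module
    · refine (coe_eq_add _).trans ?_
      congr 2
      · apply Additive.ofMul.injective
        simp only [ofMul_mul, ofMul_zpow, ofMul_div, map_mul, map_zpow, hScalar_self]
        module
      · apply Additive.ofMul.injective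
        simp only [ofMul_mul, ofMul_zpow, ofMul_div, map_mul, map_zpow, hScalar_self]
        module
  · refine Finset.sum_congr rfl fun q hq => ?_
    rw [Finset.mem_filter] at hq
    obtain ⟨-, q1, q2, q3⟩ := hq
    rw [hs q q (Or.inl ⟨rfl, q1, q2, q3⟩)]
    change ((hScalar i j k C _ * _ : (HRing i j k C)ˣ) : HRing i j k C) =
      (hScalar i j k C _ * _ : (HRing i j k C)ˣ)
    rw [moveCoeff_other q1 q2 q3, hC]
    have hx : lambdaExponent w q k = lambdaExponent w q i ∧
        lambdaExponent w' q i = lambdaExponent w q j ∧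
        lambdaExponent w' q j = lambdaExponent w q i ∧
        lambdaExponent w' q k = lambdaExponent w q j := by
      rcases h.off_cases q1 q2 q3 with hq | hq
      · obtain ⟨x1, x2, x3⟩ := h.lambda_lt hq
        obtain ⟨y1, y2, y3⟩ := h.lambda_lt' hq
        rw [x1, x2, x3, y1, y2, y3]
        exact ⟨rfl, rfl, rfl, rfl⟩
      · obtain ⟨x1, x2, x3⟩ := h.lambda_gt hq
        obtain ⟨y1, y2, y3⟩ := h.symm.lambda_gt hq
        rw [x1, x2, x3, y1, y2, y3]
        exact ⟨rfl, rfl, rfl, rfl⟩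
    obtain ⟨x1, x2, x3, x4⟩ := hx
    congr 1
    apply Additive.ofMul.injective
    simp only [ofMul_mul, ofMul_zpow, map_mul, map_zpow, hScalar_self, x1, x2, x3, x4]
    module

theorem IsThreeMove.hPull_poly (h : IsThreeMove w w' i j k) (hw : IsReducedDecomposition w)
    (hw' : IsReducedDecomposition w') (ha' : SolvesBoxEquations w' a')
    (hγ : ∀ d, γ (a d) = moveCoeff w i j k a' d) (hC : a' (Sum.inr k) / a' (Sum.inr i) = C) :
    hPull i j k γ C (poly w a) =
      algebraMap (Laurent S (Fin N)) (HRing i j k C) (poly w' a') := by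
  have hsum : ∀ {v : Fin N → Fin n} {R : Type} [CommRing R] (b : Inequality v → Rˣ),
      ∑ d, AddMonoidAlgebra.single (exponent v d) (b d : R) =
        ∑ m ∈ stringFinset v, AddMonoidAlgebra.single m ((stringValue b m : Rˣ) : R) +
          ∑ q, AddMonoidAlgebra.single (lambdaExponent v q) (b (Sum.inr q) : R) := by
    intro v R _ b
    rw [Fintype.sum_sum_type, stringFinset, ← Finset.sum_set_coe]
    congr 1
    exact Finset.sum_congr rfl fun m _ => by rw [stringValue_of_mem b m.2]; rfl
  rw [poly, poly, hsum, hsum, map_sub, map_sub, map_one, map_one, map_add, map_add, map_sum,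
    map_sum, map_sum, map_sum, h.hPull_strings hw hw' ha' hγ hC, h.hPull_lambdas hγ hC]

end PullBack

/-! ### Regular elements and density -/

section Regular

/-- An element of an additive monoid algebra with a unit among its coefficients is not a zero
divisor. -/
theorem eq_zero_of_mul_eq_zero_of_isUnit_coeff {R G : Type*} [CommRing R] [AddMonoid G]
    [UniqueSums G] (f : AddMonoidAlgebra R G) (g₀ : G) (hu : IsUnit (f.coeff g₀))
    (y : AddMonoidAlgebra R G) (hy : f * y = 0) : y = 0 := by
  classical
  induction hn : y.coeff.support.card using Nat.strong_induction_on generalizing y with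
  | _ n ih =>
  by_contra hy0
  have hne : y.coeff.support.Nonempty := by
    rw [Finsupp.support_nonempty_iff]
    exact fun e => hy0 (AddMonoidAlgebra.coeff_eq_zero.1 e)
  -- Discarding the coefficients of `f` that annihilate `y` does not change the product with `y`,
  -- and the unit coefficient at `g₀` survives.
  set f' : AddMonoidAlgebra R G :=
    .ofCoeff (f.coeff.filter fun g => f.coeff g • y ≠ 0) with hf'
  have hmul : f' * y = 0 := by
    have hd : f = f' + .ofCoeff (f.coeff.filter fun g => ¬ f.coeff g • y ≠ 0) := by
      apply AddMonoidAlgebra.coeff_injective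
      exact (Finsupp.filter_add_filter_not f.coeff _).symm
    have hz : (AddMonoidAlgebra.ofCoeff (f.coeff.filter fun g => ¬ f.coeff g • y ≠ 0)) * y = 0 := by
      rw [AddMonoidAlgebra.mul_def]
      refine Finset.sum_eq_zero fun g hg => ?_
      have hg' : f.coeff g • y = 0 := by
        have := (Finsupp.mem_support_iff.1 hg)
        rw [Finsupp.filter_apply] at this
        by_contra h
        exact this (if_neg (not_not.2 h))
      refine Finset.sum_eq_zero fun b _ => ?_
      have := congrArg (fun z => AddMonoidAlgebra.coeff z b) hg'
      simp only [AddMonoidAlgebra.coeff_smul_apply, AddMonoidAlgebra.coeff_zero, Finsupp.zero_apply,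
        smul_eq_mul] at this
      have e : (f.coeff.filter fun g => ¬ f.coeff g • y ≠ 0) g = f.coeff g := by
        rw [Finsupp.filter_apply, if_pos (not_not.2 hg')]
      simp only [e, this, AddMonoidAlgebra.single_zero]
    rw [hd, add_mul, hz, add_zero] at hy
    exact hy
  have hg₀ : g₀ ∈ f'.coeff.support := by
    have : f.coeff g₀ • y ≠ 0 := by
      intro h
      exact hy0 (by simpa using (hu.smul_eq_zero).1 h)
    rw [Finsupp.mem_support_iff]
    change (f.coeff.filter fun g => f.coeff g • y ≠ 0) g₀ ≠ 0
    rw [Finsupp.filter_apply, if_pos this]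
    intro h
    rw [h, zero_smul] at this
    exact this rfl
  obtain ⟨g, hg, b, hb, hu'⟩ := UniqueSums.uniqueAdd_of_nonempty ⟨g₀, hg₀⟩ hne
  have hz : f'.coeff g * y.coeff b = 0 := by
    rw [← AddMonoidAlgebra.coeff_mul_add_of_uniqueAdd hu', hmul]
    rfl
  have hg' : f.coeff g • y ≠ 0 ∧ f'.coeff g = f.coeff g := by
    have h := Finsupp.mem_support_iff.1 hg
    change (f.coeff.filter fun g => f.coeff g • y ≠ 0) g ≠ 0 at h
    rw [Finsupp.filter_apply] at h
    have h' : f.coeff g • y ≠ 0 := by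
      by_contra h'
      exact h (if_neg (not_not.2 h'))
    exact ⟨h', by
      change (f.coeff.filter fun g => f.coeff g • y ≠ 0) g = _
      rw [Finsupp.filter_apply, if_pos h']⟩
  rw [hg'.2] at hz
  -- The product of the coefficients at a uniquely attained sum vanishes, so `f.coeff g • y` has
  -- lost the term at `b` and is still annihilated by `f`. By induction it is zero, against the
  -- choice of `f'`.
  refine hg'.1 (ih _ ?_ (f.coeff g • y) ?_ rfl)
  · rw [← hn]
    refine Finset.card_lt_card ⟨Finsupp.support_smul, fun h => ?_⟩
    exact Finsupp.mem_support_iff.1 (h hb) hz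
  · rw [mul_smul_comm, hy, smul_zero]

/-- A basic open set of `g` that misses that of `d` makes g d nilpotent, hence `g` nilpotent as `d`
is regular. The ring may have zero divisors and nilpotents, so irreducibility is not available here.
-/
theorem dense_basicOpen {A : Type*} [CommRing A] {d : A} (hd : ∀ x, d * x = 0 → x = 0) :
    Dense (PrimeSpectrum.basicOpen d : Set (PrimeSpectrum A)) := by
  rw [PrimeSpectrum.isTopologicalBasis_basic_opens.dense_iff]
  rintro _ ⟨g, rfl⟩ hne
  by_contra hempty
  rw [Set.not_nonempty_iff_eq_empty, ← TopologicalSpace.Opens.coe_inf,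
    ← PrimeSpectrum.basicOpen_mul,
    ← TopologicalSpace.Opens.coe_bot, SetLike.coe_set_eq, PrimeSpectrum.basicOpen_eq_bot_iff]
    at hempty
  obtain ⟨n, hn⟩ := hempty
  have hpow : ∀ m x, d ^ m * x = 0 → x = 0 := by
    intro m
    induction m with
    | zero => intro x hx; simpa using hx
    | succ m ih => intro x hx; exact hd _ (ih _ (by rwa [← mul_assoc, ← pow_succ]))
  rw [mul_comm, mul_pow] at hn
  have hg : PrimeSpectrum.basicOpen g = ⊥ :=
    (PrimeSpectrum.basicOpen_eq_bot_iff g).2 ⟨n, hpow n _ hn⟩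
  simp only [hg, TopologicalSpace.Opens.coe_bot] at hne
  exact Set.not_nonempty_empty hne

/-- If `d` is not a zero divisor and `f` is not a zero divisor modulo `d`, then `d` is not a zero
divisor modulo `f`. -/
theorem regular_quotient {A B : Type*} [CommRing A] [CommRing B] {d f : A} (ev : A →+* B)
    (hd : ∀ x, d * x = 0 → x = 0) (hev : ev d = 0) (hker : ∀ x, ev x = 0 → d ∣ x)
    (hf : ∀ y, ev f * y = 0 → y = 0) (x : A ⧸ Ideal.span {f})
    (hx : Ideal.Quotient.mk (Ideal.span {f}) d * x = 0) : x = 0 := by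
  obtain ⟨x, rfl⟩ := Ideal.Quotient.mk_surjective x
  rw [← map_mul, Ideal.Quotient.eq_zero_iff_mem, Ideal.mem_span_singleton] at hx
  obtain ⟨y, hy⟩ := hx
  obtain ⟨z, rfl⟩ := hker y (hf _ (by rw [← map_mul, ← hy, map_mul, hev, zero_mul]))
  rw [Ideal.Quotient.eq_zero_iff_mem, Ideal.mem_span_singleton]
  exact ⟨z, sub_eq_zero.1 (hd _ (by rw [mul_sub, hy]; ring))⟩

end Regular

/-! ### The denominator is regular on the hypersurface -/

section Denominator

variable {n N : ℕ} {w w' : Fin N → Fin n} {i j k : Fin N} {S : Type} [CommRing S] {C : Sˣ}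

/-- The direction of the exponent vectors that become constant modulo `t_i t_k + C t_j`. -/
def hDirection (i j k : Fin N) : Fin N → ℤ := Pi.single i 1 - Pi.single j 1 + Pi.single k 1

/-- The units which are substituted for the variables modulo `t_i t_k + C t_j`. -/
def hSubstUnit (i j k : Fin N) (C : Sˣ) (q : Fin N) : (Laurent S (Fin N))ˣ :=
  varUnit S q * (Units.map (algebraMap S (Laurent S (Fin N)) : S →* Laurent S (Fin N)) (-C⁻¹) *
    monomialUnit S (hDirection i j k)) ^ (Pi.single j (1 : ℤ) : Fin N → ℤ) q

/-- The substitution `t_j = - t_i t_k / C`. -/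
def hSubst (i j k : Fin N) (C : Sˣ) : Laurent S (Fin N) →+* Laurent S (Fin N) :=
  laurentEval (algebraMap S (Laurent S (Fin N))) (hSubstUnit i j k C)

theorem monomialUnit_zpow (m : Fin N → ℤ) (e : ℤ) :
    monomialUnit S m ^ e = monomialUnit S (e • m) :=
  (map_zpow (monomialHom S (Fin N)) (Multiplicative.ofAdd m) e).symm

theorem prod_hSubstUnit (m : Fin N → ℤ) : ∏ q, hSubstUnit i j k C q ^ m q =
    Units.map (algebraMap S (Laurent S (Fin N)) : S →* Laurent S (Fin N)) ((-C⁻¹) ^ m j) *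
      monomialUnit S (m + m j • hDirection i j k) := by
  have : ∀ q, hSubstUnit i j k C q ^ m q = varUnit S q ^ m q *
      (if q = j then
        (Units.map (algebraMap S (Laurent S (Fin N)) : S →* Laurent S (Fin N)) (-C⁻¹) *
          monomialUnit S (hDirection i j k)) ^ m j else 1) := by
    intro q
    unfold hSubstUnit
    split_ifs with hq
    · rw [hq, Pi.single_eq_same, zpow_one, mul_zpow]
    · rw [Pi.single_eq_of_ne hq, zpow_zero, mul_one, mul_one]
  simp only [this]
  rw [Finset.prod_mul_distrib, Finset.prod_ite_eq' Finset.univ j, if_pos (Finset.mem_univ _),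
    ← monomialUnit_eq_prod, mul_zpow, monomialUnit_add, monomialUnit_zpow, map_zpow]
  exact mul_left_comm _ _ _

theorem hSubst_single (m : Fin N → ℤ) (c : S) : hSubst i j k C (AddMonoidAlgebra.single m c) =
    AddMonoidAlgebra.single (m + m j • hDirection i j k) (c * ((-C⁻¹) ^ m j : Sˣ)) := by
  rw [hSubst, laurentEval_single, prod_hSubstUnit, Units.val_mul, coe_monomialUnit, ← mul_assoc,
    Units.coe_map, MonoidHom.coe_coe, ← map_mul, AddMonoidAlgebra.coe_algebraMap,
    Function.comp_apply, AddMonoidAlgebra.single_mul_single]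
  simp

theorem hDenom_eq : hDenom i j k C = AddMonoidAlgebra.single (Pi.single i 1 + Pi.single k 1) 1 +
    AddMonoidAlgebra.single (Pi.single j 1) (C : S) := by
  rw [hDenom, varUnit, varUnit, varUnit, coe_monomialUnit, coe_monomialUnit, coe_monomialUnit,
    AddMonoidAlgebra.coe_algebraMap, Function.comp_apply, AddMonoidAlgebra.single_mul_single,
    AddMonoidAlgebra.single_mul_single]
  simp

/-- Modulo the denominator t_j equals -t_i t_k / C, so the substitution is the identity modulo the
denominator. -/
theorem hDenom_dvd (x : Laurent S (Fin N)) (hx : hSubst i j k C x = 0) : hDenom i j k C ∣ x := by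
  have key : (Ideal.Quotient.mk (Ideal.span {hDenom i j k C})).comp (hSubst i j k C) =
      Ideal.Quotient.mk (Ideal.span {hDenom i j k C}) := by
    refine laurent_hom_ext (fun c => ?_) (fun q => ?_)
    · rw [RingHom.comp_apply, hSubst, laurentEval_algebraMap]
    · rw [RingHom.comp_apply, Ideal.Quotient.eq, Ideal.mem_span_singleton, varUnit,
        coe_monomialUnit, hSubst_single]
      by_cases hq : q = j
      · subst hq
        refine ⟨algebraMap S (Laurent S (Fin N)) (-C⁻¹ : Sˣ), ?_⟩
        rw [hDenom_eq, AddMonoidAlgebra.coe_algebraMap, Function.comp_apply, add_mul,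
          AddMonoidAlgebra.single_mul_single, AddMonoidAlgebra.single_mul_single]
        have e : (Pi.single q 1 + (Pi.single q 1 : Fin N → ℤ) q • hDirection i q k : Fin N → ℤ) =
            Pi.single i 1 + Pi.single k 1 + 0 := by
          rw [Pi.single_eq_same, hDirection]
          module
        rw [e]
        simp [sub_eq_add_neg]
      · rw [Pi.single_eq_of_ne (Ne.symm hq)]
        simp
  have := RingHom.congr_fun key x
  rwa [RingHom.comp_apply, hx, map_zero, eq_comm, Ideal.Quotient.eq_zero_iff_mem,
    Ideal.mem_span_singleton] at this

theorem hSubst_hDenom (hij : i ≠ j) (hjk : j ≠ k) : hSubst i j k C (hDenom i j k C) = 0 := by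
  rw [hDenom_eq, map_add, hSubst_single, hSubst_single]
  simp only [Pi.add_apply, Pi.single_eq_of_ne hij.symm, Pi.single_eq_of_ne hjk, Pi.single_eq_same]
  have e : (Pi.single j 1 + (1 : ℤ) • hDirection i j k : Fin N → ℤ) =
      Pi.single i 1 + Pi.single k 1 + (0 + 0 : ℤ) • hDirection i j k := by
    rw [hDirection]
    module
  rw [e, ← AddMonoidAlgebra.single_add]
  simp

/-- This is the exponent after the substitution, and the direction is λ_i - λ_k. For a string
inequality, zero would make its vector a multiple of the vector of the small box, which
`IsBox.ne_smul` excludes; for a `λ`-inequality one coordinate suffices. Hence no term of f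
interferes with the constant term. -/
theorem IsThreeMove.exponent_ne (h : IsThreeMove w w' i j k) (hw : IsReducedDecomposition w)
    (d : Inequality w) : exponent w d + exponent w d j • hDirection i j k ≠ 0 := by
  have hdir : lambdaExponent w k - lambdaExponent w i = -hDirection i j k := by
    obtain ⟨i1, i2, i3⟩ := h.lambda_i
    obtain ⟨k1, k2, k3⟩ := h.lambda_k
    funext q
    simp only [hDirection, Pi.sub_apply, Pi.neg_apply, Pi.add_apply]
    by_cases c1 : q = i
    · subst c1; simp [i1, k1, h.ne.1, h.ne.2.1]
    by_cases c2 : q = j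
    · subst c2; simp [i2, k2, c1, h.ne.2.2]
    by_cases c3 : q = k
    · subst c3; simp [i3, k3, c1, c2]
    simp only [Pi.single_eq_of_ne c1, Pi.single_eq_of_ne c2, Pi.single_eq_of_ne c3]
    rcases h.off_cases c1 c2 c3 with hq | hq
    · rw [lambdaExponent_of_gt hq, lambdaExponent_of_gt (hq.trans h.lt.2.2)]; rfl
    · rw [lambdaExponent_of_lt hq, lambdaExponent_of_lt (h.lt.2.2.trans hq), h.same, sub_self]; rfl
  intro e
  rcases d with m | q
  · refine h.isBox.ne_smul hw m.2 (m.val j) ?_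
    rw [hdir, smul_neg]
    exact eq_neg_of_add_eq_zero_left e
  · change lambdaExponent w q + lambdaExponent w q j • hDirection i j k = 0 at e
    have di : hDirection i j k i = 1 := by simp [hDirection, h.ne.1, h.ne.2.1]
    have dk : hDirection i j k k = 1 := by
      simp [hDirection, h.ne.2.1.symm, h.ne.2.2.symm]
    by_cases c1 : q = i
    · subst c1
      have := congrFun e k
      simp only [Pi.add_apply, Pi.smul_apply, h.lambda_i.2.1, h.lambda_i.2.2, dk,
        Pi.zero_apply] at this
      norm_num at this
    by_cases c2 : q = j
    · subst c2
      have := congrFun e i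
      simp only [Pi.add_apply, Pi.smul_apply, h.lambda_j.1, h.lambda_j.2.1, di,
        Pi.zero_apply] at this
      norm_num at this
    by_cases c3 : q = k
    · subst c3
      have := congrFun e q
      simp only [Pi.add_apply, Pi.smul_apply, h.lambda_k.2.1, h.lambda_k.2.2, dk,
        Pi.zero_apply] at this
      norm_num at this
    have dq : hDirection i j k q = 0 := by simp [hDirection, c1, c2, c3]
    have := congrFun e q
    simp only [Pi.add_apply, Pi.smul_apply, dq, lambdaExponent_self, Pi.zero_apply] at this
    norm_num at this

/-- The denominator has the unit coefficient C at t_j, and after the substitution f has constant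
coefficient 1; both are thus regular. Then `regular_quotient` exchanges the roles of the two
elements. -/
theorem IsThreeMove.hDenom_regular (h : IsThreeMove w w' i j k) (hw : IsReducedDecomposition w)
    (a : Inequality w → Sˣ) (C : Sˣ) (x : Laurent S (Fin N) ⧸ Ideal.span {poly w a})
    (hx : Ideal.Quotient.mk (Ideal.span {poly w a}) (hDenom i j k C) * x = 0) : x = 0 := by
  classical
  refine regular_quotient (hSubst i j k C) ?_ (hSubst_hDenom h.ne.1 h.ne.2.2) hDenom_dvd ?_ x hx
  · refine eq_zero_of_mul_eq_zero_of_isUnit_coeff _ (Pi.single j 1) ?_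
    rw [hDenom_eq, AddMonoidAlgebra.coeff_add, Finsupp.add_apply, AddMonoidAlgebra.coeff_single,
      AddMonoidAlgebra.coeff_single, Finsupp.single_eq_same, Finsupp.single_eq_of_ne, zero_add]
    · exact C.isUnit
    · intro e
      have := congrFun e j
      simp [h.ne.2.2, h.ne.1.symm] at this
  · refine eq_zero_of_mul_eq_zero_of_isUnit_coeff _ 0 ?_
    have e : (hSubst i j k C (poly w a)).coeff 0 = 1 := by
      rw [poly, map_sub, map_one, map_sum, AddMonoidAlgebra.coeff_sub, Finsupp.sub_apply,
        AddMonoidAlgebra.coeff_sum, Finsupp.finsetSum_apply, Finset.sum_eq_zero, sub_zero]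
      · simp [AddMonoidAlgebra.one_def]
      · intro d _
        rw [hSubst_single, AddMonoidAlgebra.coeff_single,
          Finsupp.single_eq_of_ne (h.exponent_ne hw d).symm]
    rw [e]
    exact isUnit_one

end Denominator

/-! ### From inverse maps of localizations to a birational map of hypersurfaces -/

section Localization

variable {R R' B : Type} [CommRing R] [CommRing R'] [CommRing B] {d f : R} {d' f' : R'}

/-- The map induced on the quotients by `f` and `f'` of localizations. -/
def awayQuotient (d f : R) : Localization.Away d →+*
    Localization.Away (Ideal.Quotient.mk (Ideal.span {f}) d) :=
  IsLocalization.Away.lift (S := Localization.Away d) (g := (algebraMap (R ⧸ Ideal.span {f})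
    (Localization.Away (Ideal.Quotient.mk (Ideal.span {f}) d))).comp (Ideal.Quotient.mk _)) d
    (IsLocalization.Away.algebraMap_isUnit (R := R ⧸ Ideal.span {f})
      (S := Localization.Away (Ideal.Quotient.mk (Ideal.span {f}) d)) (Ideal.Quotient.mk _ d))

theorem awayQuotient_algebraMap (r : R) : awayQuotient d f (algebraMap R _ r) =
    algebraMap (R ⧸ Ideal.span {f}) _ (Ideal.Quotient.mk _ r) :=
  IsLocalization.Away.lift_eq _ _ r

/-- The homomorphism between localizations of quotients that is induced by `α`. -/
def awayQuotientMap (α : R →+* Localization.Away d') (hα : IsUnit (α d))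
    (hf : α f = algebraMap _ _ f') :
    Localization.Away (Ideal.Quotient.mk (Ideal.span {f}) d) →+*
      Localization.Away (Ideal.Quotient.mk (Ideal.span {f'}) d') :=
  IsLocalization.Away.lift (g := Ideal.Quotient.lift (Ideal.span {f}) ((awayQuotient d' f').comp α)
    (by
      intro x hx
      rw [Ideal.mem_span_singleton] at hx
      obtain ⟨y, rfl⟩ := hx
      have h0 : Ideal.Quotient.mk (Ideal.span {f'}) f' = 0 :=
        Ideal.Quotient.eq_zero_iff_mem.2 (Ideal.mem_span_singleton_self f')
      rw [RingHom.comp_apply, map_mul, map_mul, hf, awayQuotient_algebraMap, h0, map_zero,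
        zero_mul]))
    (Ideal.Quotient.mk _ d) (by
      rw [Ideal.Quotient.lift_mk]
      exact hα.map (awayQuotient d' f'))

theorem awayQuotientMap_algebraMap (α : R →+* Localization.Away d') (hα : IsUnit (α d))
    (hf : α f = algebraMap _ _ f') (r : R) :
    awayQuotientMap α hα hf (algebraMap (R ⧸ Ideal.span {f}) _ (Ideal.Quotient.mk _ r)) =
      awayQuotient d' f' (α r) := by
  rw [awayQuotientMap, IsLocalization.Away.lift_eq, Ideal.Quotient.lift_mk]
  rfl

theorem awayQuotientMap_awayQuotient (α : R →+* Localization.Away d') (hα : IsUnit (α d))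
    (hf : α f = algebraMap _ _ f') (x : Localization.Away d) :
    awayQuotientMap α hα hf (awayQuotient d f x) =
      awayQuotient d' f' (IsLocalization.Away.lift d hα x) := by
  have : (awayQuotientMap α hα hf).comp (awayQuotient d f) =
      (awayQuotient d' f').comp (IsLocalization.Away.lift d hα) := by
    refine IsLocalization.ringHom_ext (Submonoid.powers d) (RingHom.ext fun r => ?_)
    simp only [RingHom.comp_apply]
    rw [awayQuotient_algebraMap, awayQuotientMap_algebraMap, IsLocalization.Away.lift_eq]
  exact RingHom.congr_fun this x

theorem awayQuotientMap_comp (α : R →+* Localization.Away d') (hα : IsUnit (α d))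
    (hf : α f = algebraMap _ _ f') (β : R' →+* Localization.Away d) (hβ : IsUnit (β d'))
    (hf' : β f' = algebraMap _ _ f)
    (hβα : ∀ r, IsLocalization.Away.lift d' hβ (α r) = algebraMap R (Localization.Away d) r) :
    (awayQuotientMap β hβ hf').comp (awayQuotientMap α hα hf) = RingHom.id _ := by
  refine IsLocalization.ringHom_ext
    (Submonoid.powers (Ideal.Quotient.mk (Ideal.span {f}) d)) ?_
  refine Ideal.Quotient.ringHom_ext (RingHom.ext fun r => ?_)
  simp only [RingHom.comp_apply, RingHom.id_apply]
  rw [awayQuotientMap_algebraMap, awayQuotientMap_awayQuotient, hβα, awayQuotient_algebraMap]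

/-- Mutually inverse homomorphisms between localizations induce a birational map between the
hypersurfaces `f' = 0` and `f = 0`. -/
theorem exists_partialIso (α : R →+* Localization.Away d') (hα : IsUnit (α d))
    (hf : α f = algebraMap _ _ f') (β : R' →+* Localization.Away d) (hβ : IsUnit (β d'))
    (hf' : β f' = algebraMap _ _ f)
    (hβα : ∀ r, IsLocalization.Away.lift d' hβ (α r) = algebraMap R (Localization.Away d) r)
    (hαβ : ∀ r, IsLocalization.Away.lift d hα (β r) = algebraMap R' (Localization.Away d') r)
    (hd : ∀ x, Ideal.Quotient.mk (Ideal.span {f}) d * x = 0 → x = 0)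
    (hd' : ∀ x, Ideal.Quotient.mk (Ideal.span {f'}) d' * x = 0 → x = 0) :
    ∃ H : (Spec (CommRingCat.of (R' ⧸ Ideal.span {f'}))).PartialIso
        (Spec (CommRingCat.of (R ⧸ Ideal.span {f}))),
      H.source = Spec.map (CommRingCat.ofHom (Ideal.Quotient.mk (Ideal.span {f'}))) ⁻¹ᵁ
        PrimeSpectrum.basicOpen d' ∧
      ∃ φ : H.source.toScheme ⟶ Spec (CommRingCat.of (Localization.Away d')),
        φ ≫ Spec.map (CommRingCat.ofHom (algebraMap R' (Localization.Away d'))) =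
          H.source.ι ≫ Spec.map (CommRingCat.ofHom (Ideal.Quotient.mk (Ideal.span {f'}))) ∧
        H.iso.hom ≫ H.target.ι ≫ Spec.map (CommRingCat.ofHom (Ideal.Quotient.mk (Ideal.span {f}))) =
          φ ≫ Spec.map (CommRingCat.ofHom α) := by
  -- The coordinate rings of the two open sets are the quotients localized at the denominators. The
  -- maps between them are mutually inverse because `α` and `β` are.
  let e : CommRingCat.of (Localization.Away (Ideal.Quotient.mk (Ideal.span {f}) d)) ≅
      CommRingCat.of (Localization.Away (Ideal.Quotient.mk (Ideal.span {f'}) d')) :=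
    { hom := CommRingCat.ofHom (awayQuotientMap α hα hf)
      inv := CommRingCat.ofHom (awayQuotientMap β hβ hf')
      hom_inv_id := by
        rw [← CommRingCat.ofHom_comp, awayQuotientMap_comp α hα hf β hβ hf' hβα]; rfl
      inv_hom_id := by
        rw [← CommRingCat.ofHom_comp, awayQuotientMap_comp β hβ hf' α hα hf hαβ]; rfl }
  let U' := basicOpenIsoSpecAway (R := CommRingCat.of (R' ⧸ Ideal.span {f'}))
    (Ideal.Quotient.mk (Ideal.span {f'}) d')
  let U := basicOpenIsoSpecAway (R := CommRingCat.of (R ⧸ Ideal.span {f}))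
    (Ideal.Quotient.mk (Ideal.span {f}) d)
  refine ⟨{ source := PrimeSpectrum.basicOpen (Ideal.Quotient.mk (Ideal.span {f'}) d')
            dense_source := dense_basicOpen hd'
            target := PrimeSpectrum.basicOpen (Ideal.Quotient.mk (Ideal.span {f}) d)
            dense_target := dense_basicOpen hd
            iso := U' ≪≫ Scheme.Spec.mapIso e.op ≪≫ U.symm }, rfl,
    U'.hom ≫ Spec.map (CommRingCat.ofHom (awayQuotient d' f')), ?_, ?_⟩
  · have h1 := basicOpenIsoSpecAway_hom_SpecMap (R := CommRingCat.of (R' ⧸ Ideal.span {f'}))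
      (Ideal.Quotient.mk (Ideal.span {f'}) d')
    rw [← h1, Category.assoc, Category.assoc, ← Spec.map_comp, ← Spec.map_comp,
      ← CommRingCat.ofHom_comp, ← CommRingCat.ofHom_comp]
    congr 3
    exact RingHom.ext fun r => awayQuotient_algebraMap r
  · have h1 := basicOpenIsoSpecAway_hom_SpecMap (R := CommRingCat.of (R ⧸ Ideal.span {f}))
      (Ideal.Quotient.mk (Ideal.span {f}) d)
    have h2 : (U' ≪≫ Scheme.Spec.mapIso e.op ≪≫ U.symm).hom ≫ U.hom =
        U'.hom ≫ Spec.map (CommRingCat.ofHom (awayQuotientMap α hα hf)) := by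
      simp [e]
    dsimp only
    rw [← h1, Category.assoc, reassoc_of% h2, Category.assoc, ← Spec.map_comp, ← Spec.map_comp,
      ← Spec.map_comp, ← CommRingCat.ofHom_comp, ← CommRingCat.ofHom_comp,
      ← CommRingCat.ofHom_comp]
    congr 3
    exact RingHom.ext fun r => awayQuotientMap_algebraMap α hα hf r

end Localization

/-! ### h is inverse to the map of the reverse move; the induced birational maps -/

section Induced

variable {n N : ℕ} {w w' : Fin N → Fin n} {i j k : Fin N} {S S' : Type} [CommRing S] [CommRing S']
  {γ : S →+* S'} {γ' : S' →+* S} {C : S'ˣ} {C₀ : Sˣ}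

theorem hPull_algebraMap (c : S) : hPull i j k γ C (algebraMap S (Laurent S (Fin N)) c) =
    algebraMap S' (HRing i j k C) (γ c) := by
  rw [hPull, laurentEval_algebraMap]
  rfl

theorem hPull_varUnit (q : Fin N) : hPull i j k γ C (varUnit S q) = hCoord i j k C q :=
  laurentEval_varUnit _ _ q

/-- The product t_i t_k pulls back to C t_j' and C t_j to t_i' t_k': the two summands of the
denominator are exchanged. -/
theorem IsThreeMove.hPull_hDenom (h : IsThreeMove w w' i j k) (hC : γ C₀ = C) :
    hPull i j k γ C (hDenom i j k C₀) = hDenomUnit i j k C := by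
  have e₀ : hDenom i j k C₀ = (varUnit S i : Laurent S (Fin N)) * varUnit S k +
      algebraMap S (Laurent S (Fin N)) C₀ * varUnit S j := rfl
  rw [e₀, map_add, map_mul, map_mul, hPull_algebraMap, hPull_varUnit, hPull_varUnit,
    hPull_varUnit, hC]
  have e : algebraMap S' (HRing i j k C) C = hConst i j k C := rfl
  rw [e, coe_hDenomUnit, ← Units.val_mul, ← Units.val_mul, ← Units.val_mul, ← Units.val_mul,
    add_comm]
  simp only [hCoord, if_true, if_neg h.ne.1.symm, if_neg h.ne.2.1.symm, if_neg h.ne.2.2.symm]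
  congr 2
  · rw [mul_div_cancel]
  · apply Additive.ofMul.injective
    simp only [ofMul_mul, ofMul_div]
    abel

theorem IsThreeMove.isUnit_hPull_hDenom (h : IsThreeMove w w' i j k) (hC : γ C₀ = C) :
    IsUnit (hPull i j k γ C (hDenom i j k C₀)) := by
  rw [h.hPull_hDenom hC]
  exact Units.isUnit _

/-- The map `h` is an involution. -/
theorem IsThreeMove.lift_hPull (h : IsThreeMove w w' i j k) (hC' : γ' C = C₀)
    (hγ : ∀ c, γ' (γ c) = c) (r : Laurent S (Fin N)) :
    IsLocalization.Away.lift (hDenom i j k C) (h.isUnit_hPull_hDenom hC') (hPull i j k γ C r) =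
      algebraMap (Laurent S (Fin N)) (HRing i j k C₀) r := by
  set L := IsLocalization.Away.lift (S := HRing i j k C) (hDenom i j k C)
    (h.isUnit_hPull_hDenom (γ := γ') hC')
  have hLa : ∀ x, L (algebraMap _ (HRing i j k C) x) = hPull i j k γ' C₀ x := fun x =>
    IsLocalization.Away.lift_eq _ _ x
  have hV : ∀ q, Units.map (L : HRing i j k C →* HRing i j k C₀) (hVar i j k C q) =
      hCoord i j k C₀ q := fun q => Units.ext ((hLa _).trans (hPull_varUnit q))
  have hK : Units.map (L : HRing i j k C →* HRing i j k C₀) (hConst i j k C) =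
      hConst i j k C₀ := by
    ext1
    change L (algebraMap S' (HRing i j k C) C) = algebraMap S (HRing i j k C₀) C₀
    rw [IsScalarTower.algebraMap_apply S' (Laurent S' (Fin N)) (HRing i j k C), hLa,
      hPull_algebraMap, hC']
  have hD : Units.map (L : HRing i j k C →* HRing i j k C₀) (hDenomUnit i j k C) =
      hDenomUnit i j k C₀ := Units.ext ((hLa _).trans (h.hPull_hDenom hC'))
  have key : L.comp (hPull i j k γ C) = algebraMap (Laurent S (Fin N)) (HRing i j k C₀) := by
    refine laurent_hom_ext (fun c => ?_) (fun q => ?_)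
    · rw [RingHom.comp_apply, hPull_algebraMap,
        IsScalarTower.algebraMap_apply S' (Laurent S' (Fin N)) (HRing i j k C), hLa,
        hPull_algebraMap, hγ, ← IsScalarTower.algebraMap_apply]
    · rw [RingHom.comp_apply, hPull_varUnit]
      change ((Units.map (L : HRing i j k C →* HRing i j k C₀) (hCoord i j k C q) :
        (HRing i j k C₀)ˣ) : HRing i j k C₀) = (hVar i j k C₀ q : HRing i j k C₀)
      congr 1
      have hi : hCoord i j k C₀ i = hDenomUnit i j k C₀ / hVar i j k C₀ i := by simp [hCoord]
      have hj : hCoord i j k C₀ j = hVar i j k C₀ i * hVar i j k C₀ k / hConst i j k C₀ := by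
        simp [hCoord, h.ne.1.symm]
      have hk : hCoord i j k C₀ k =
          hConst i j k C₀ * hVar i j k C₀ i * hVar i j k C₀ j / hDenomUnit i j k C₀ := by
        simp [hCoord, h.ne.2.1.symm, h.ne.2.2.symm]
      rw [hCoord]
      split_ifs with c1 c2 c3
      · rw [map_div, hD, hV, hi, c1]
        simp
      · rw [map_div, map_mul, hV, hV, hK, hi, hk, c2]
        apply Additive.ofMul.injective
        simp only [ofMul_mul, ofMul_div]
        abel
      · rw [map_div, map_mul, map_mul, hD, hV, hV, hK, hi, hj, c3]
        apply Additive.ofMul.injective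
        simp only [ofMul_mul, ofMul_div]
        abel
      · rw [hV, hCoord, if_neg c1, if_neg c2, if_neg c3]
  exact RingHom.congr_fun key r

/-- The inverse is the same map for the reverse move with the same parameter, so the results on
pull-back, denominators and regularity are applied once in each direction. -/
theorem IsThreeMove.exists_isInducedBy (h : IsThreeMove w w' i j k)
    (hw : IsReducedDecomposition w) (hw' : IsReducedDecomposition w') {a : Inequality w → Sˣ}
    {a' : Inequality w' → S'ˣ} (ha : SolvesBoxEquations w a) (ha' : SolvesBoxEquations w' a')
    (hγ : ∀ d, γ (a d) = moveCoeff w i j k a' d) (hγ' : ∀ d, γ' (a' d) = moveCoeff w' i j k a d)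
    (hid : ∀ c, γ' (γ c) = c) (hid' : ∀ c, γ (γ' c) = c)
    (hC : a' (Sum.inr k) / a' (Sum.inr i) = C) :
    ∃ H : (hypersurface w' a').PartialIso (hypersurface w a), IsInducedBy i j k γ C H := by
  set C₀ := a (Sum.inr k) / a (Sum.inr i) with hC₀
  have hCC : γ C₀ = C := by
    have : Units.map (γ : S →* S') C₀ = C := by
      have e : ∀ d, Units.map (γ : S →* S') (a d) = moveCoeff w i j k a' d :=
        fun d => Units.ext (hγ d)
      rw [hC₀, map_div, e, e, h.ratio_moveCoeff, hC]
    exact congrArg Units.val this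
  have hCC' : γ' C = C₀ := by rw [← hCC, hid]
  obtain ⟨H, h1, h2⟩ := exists_partialIso (hPull i j k γ C) (h.isUnit_hPull_hDenom hCC)
    (h.hPull_poly hw hw' ha' hγ hC) (hPull i j k γ' C₀) (h.isUnit_hPull_hDenom hCC')
    (h.symm.hPull_poly hw' hw ha hγ' rfl) (h.lift_hPull hCC' hid)
    (h.lift_hPull hCC hid') (h.hDenom_regular hw a C₀) (h.symm.hDenom_regular hw' a' C)
  exact ⟨H, h1, h2⟩

/-- Compatibility with the projections only concerns functions from the base, and on these the
pull-back is `γ`. -/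
theorem iso_comp_of_isInducedBy {γ : ParamRing w →+* ParamRing w'} {C : (ParamRing w')ˣ}
    {H : (hypersurface w' (univCoeff w')).PartialIso (hypersurface w (univCoeff w))}
    (hH : IsInducedBy i j k γ C H) :
    H.iso.hom ≫ H.target.ι ≫ hypersurfaceIncl w (univCoeff w) ≫
        Spec.map (CommRingCat.ofHom (algebraMap (ParamRing w) (Laurent (ParamRing w) (Fin N)))) =
      H.source.ι ≫ (hypersurfaceIncl w' (univCoeff w') ≫ Spec.map (CommRingCat.ofHom
        (algebraMap (ParamRing w') (Laurent (ParamRing w') (Fin N))))) ≫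
        Spec.map (CommRingCat.ofHom γ) := by
  obtain ⟨φ, h1, h2⟩ := hH.formula
  have e : Spec.map (CommRingCat.ofHom (hPull i j k γ C)) ≫
      Spec.map (CommRingCat.ofHom (algebraMap (ParamRing w) (Laurent (ParamRing w) (Fin N)))) =
      Spec.map (CommRingCat.ofHom (algebraMap (Laurent (ParamRing w') (Fin N)) (HRing i j k C))) ≫
      Spec.map (CommRingCat.ofHom (algebraMap (ParamRing w') (Laurent (ParamRing w') (Fin N)))) ≫
      Spec.map (CommRingCat.ofHom γ) := by
    simp only [← Spec.map_comp, ← CommRingCat.ofHom_comp]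
    congr 2
    refine RingHom.ext fun c => ?_
    exact (hPull_algebraMap c).trans (IsScalarTower.algebraMap_apply (ParamRing w')
      (Laurent (ParamRing w') (Fin N)) (HRing i j k C) (γ c))
  rw [reassoc_of% h2, e, reassoc_of% h1, Category.assoc]

end Induced

/-! ### Tropicalization of h -/

section Lift

variable {n N : ℕ} {i j k : Fin N}

/-- The coordinates of `h` as subtraction-free expressions. -/
def liftExpr (i j k q : Fin N) : SubtractionFree (Fin N) :=
  if q = i then .div (.add (.mul (.var i) (.var k)) (.mul .param (.var j))) (.var i)
  else if q = j then .div (.mul (.var i) (.var k)) .param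
  else if q = k then .div (.mul (.mul .param (.var i)) (.var j))
    (.add (.mul (.var i) (.var k)) (.mul .param (.var j)))
  else .var q

theorem eval_liftExpr (C : ℂˣ) (e : HRing i j k C →ₐ[ℂ] ℂ) (q : Fin N) :
    e (hPull i j k (RingHom.id ℂ) C (varUnit ℂ q)) =
      (liftExpr i j k q).eval (C : ℂ) fun r => e (hVar i j k C r) := by
  have hmap : ∀ u : (HRing i j k C)ˣ,
      e u = (Units.map (e : HRing i j k C →* ℂ) u : ℂˣ) := fun _ => rfl
  have hC : Units.map (e : HRing i j k C →* ℂ) (hConst i j k C) = C :=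
    Units.ext (e.commutes (C : ℂ))
  have hD : ((Units.map (e : HRing i j k C →* ℂ) (hDenomUnit i j k C) : ℂˣ) : ℂ) =
      e (hVar i j k C i) * e (hVar i j k C k) + C * e (hVar i j k C j) := by
    rw [← hmap, coe_hDenomUnit, map_add, map_mul, map_mul, hmap (hConst i j k C), hC]
  rw [hPull_varUnit, hmap, hCoord, liftExpr]
  split_ifs with c1 c2 c3
  · rw [map_div, Units.val_div_eq_div_val, hD, ← hmap]
    rfl
  · rw [map_div, map_mul, hC, Units.val_div_eq_div_val, Units.val_mul, ← hmap, ← hmap]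
    rfl
  · rw [map_div, map_mul, map_mul, hC, Units.val_div_eq_div_val, Units.val_mul, Units.val_mul, hD,
      ← hmap, ← hmap]
    rfl
  · rfl

/-- With C replaced by 0, the expressions for t_i and t_k tropicalize to the left-hand sides. The
hypotheses are translation invariance of the tropical sum and, in effect, the identity min + max =
sum, so both conventions are covered. -/
theorem isGeometricLift {op op' : ℝ → ℝ → ℝ}
    (h : ∀ x y z, op (x + z) y - x = op z (y - x))
    (h' : ∀ x y z, x + y - op (x + z) y = op' x (y - z)) :
    IsGeometricLift op i j k (tropicalBZ op op' i j k) := by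
  refine ⟨liftExpr i j k, eval_liftExpr, fun x q => ?_⟩
  unfold liftExpr tropicalBZ
  split_ifs with c1 c2 c3
  · simp only [SubtractionFree.trop, zero_add]
    exact h _ _ _
  · simp only [SubtractionFree.trop, sub_zero]
  · simp only [SubtractionFree.trop, zero_add]
    exact h' _ _ _
  · rfl

theorem isGeometricLift_min : IsGeometricLift min i j k (tropicalBZ min max i j k) := by
  refine isGeometricLift (fun x y z => ?_) (fun x y z => ?_)
  · rw [← min_sub_sub_right, add_sub_cancel_left]
  · rcases le_total (x + z) y with h | h
    · rw [min_eq_left h, max_eq_right (by linarith)]; ring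
    · rw [min_eq_right h, max_eq_left (by linarith)]; ring

theorem isGeometricLift_max : IsGeometricLift max i j k (tropicalBZ max min i j k) := by
  refine isGeometricLift (fun x y z => ?_) (fun x y z => ?_)
  · rw [← max_sub_sub_right, add_sub_cancel_left]
  · rcases le_total (x + z) y with h | h
    · rw [max_eq_right h, min_eq_left (by linarith)]; ring
    · rw [max_eq_left h, min_eq_right (by linarith)]; ring

end Lift

end StringMirror

end

/-! ### The theorem: universal family and fibres -/

open CategoryTheory AlgebraicGeometry StringMirror in
theorem theorem4p11 {n N : ℕ} (w w' : Fin N → Fin n) (i j k : Fin N)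
    (hw : IsReducedDecomposition w) (hw' : IsReducedDecomposition w')
    (hmove : IsThreeMove w w' i j k) :
    -- `h` is a geometric lift of the tropical Berenstein–Zelevinsky map
    (IsGeometricLift min i j k (tropicalBZ min max i j k) ∧
      IsGeometricLift max i j k (tropicalBZ max min i j k)) ∧
    -- the isomorphism `g : P_{w'} ⟶ P_w`, given as the isomorphism `g^*` of coordinate rings
    ∃ g : ParamRing w ≃ₐ[ℂ] ParamRing w',
      (∀ C : (ParamRing w')ˣ,
        C = coeffAt (g : ParamRing w →+* ParamRing w') (Sum.inr k) /
          coeffAt (g : ParamRing w →+* ParamRing w') (Sum.inr i) →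
        -- `(g, h)` pulls back the equation of the family `F_w` to that of the family `F_{w'}`
        hPull i j k (g : ParamRing w →+* ParamRing w') C (poly w (univCoeff w)) =
          algebraMap _ (HRing i j k C) (poly w' (univCoeff w')) ∧
        -- and induces a birational map of families `H = (g, h_a) : F_{w'} ⇢ F_w` over `g`
        ∃ H : (family w').PartialIso (family w),
          IsInducedBy i j k (g : ParamRing w →+* ParamRing w') C H ∧
          H.IsOver
            (familyProj w' ≫
              Spec.map (CommRingCat.ofHom (g : ParamRing w →+* ParamRing w')))
            (familyProj w)) ∧
      -- for every complex point `a'` of `P_{w'}`, with image `a = g(a')`, the map `h_a` pulls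
      -- back `f_{w,a}` to `f_{w',a'}` and induces a birational map `Z_{w',a'} ⇢ Z_{w,a}`
      ∀ (a' : ParamRing w' →ₐ[ℂ] ℂ) (a : ParamRing w →ₐ[ℂ] ℂ),
        a = a'.comp (g : ParamRing w →ₐ[ℂ] ParamRing w') →
        ∀ C : ℂˣ,
          C = coeffAt (a : ParamRing w →+* ℂ) (Sum.inr k) /
            coeffAt (a : ParamRing w →+* ℂ) (Sum.inr i) →
          hPull i j k (RingHom.id ℂ) C (poly w (coeffAt (a : ParamRing w →+* ℂ))) =
            algebraMap _ (HRing i j k C) (poly w' (coeffAt (a' : ParamRing w' →+* ℂ))) ∧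
          ∃ h : (hypersurface w' (coeffAt (a' : ParamRing w' →+* ℂ))).PartialIso
              (hypersurface w (coeffAt (a : ParamRing w →+* ℂ))),
            IsInducedBy i j k (RingHom.id ℂ) C h := by
  have hsolve := hmove.solvesBoxEquations hw hw' (solvesBoxEquations_univCoeff w')
  set g := hmove.paramEquiv hw hw' with hg
  have hcoeff : coeffAt (g : ParamRing w →+* ParamRing w') = moveCoeff w i j k (univCoeff w') :=
    hmove.coeffAt_paramHom hw hw'
  have hcoeff' : coeffAt (g.symm : ParamRing w' →+* ParamRing w) =
      moveCoeff w' i j k (univCoeff w) := hmove.symm.coeffAt_paramHom hw' hw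
  have hu : ∀ d, (g : ParamRing w →+* ParamRing w') (univCoeff w d) =
      moveCoeff w i j k (univCoeff w') d := fun d => congrArg Units.val (congrFun hcoeff d)
  have hu' : ∀ d, (g.symm : ParamRing w' →+* ParamRing w) (univCoeff w' d) =
      moveCoeff w' i j k (univCoeff w) d := fun d => congrArg Units.val (congrFun hcoeff' d)
  refine ⟨⟨isGeometricLift_min, isGeometricLift_max⟩, g, ?_, ?_⟩
  · intro C hC
    -- The parameter is given as a ratio of coefficients for `w`; it equals the same ratio for `w'`.
    rw [hcoeff, hmove.ratio_moveCoeff] at hC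
    refine ⟨hmove.hPull_poly hw hw' (solvesBoxEquations_univCoeff w') hu hC.symm, ?_⟩
    obtain ⟨H, hH⟩ := hmove.exists_isInducedBy hw hw' (solvesBoxEquations_univCoeff w)
      (solvesBoxEquations_univCoeff w') hu hu' g.symm_apply_apply g.apply_symm_apply hC.symm
    exact ⟨H, hH, iso_comp_of_isInducedBy hH⟩
  · intro a' a ha C hC
    have hb : coeffAt (a : ParamRing w →+* ℂ) =
        moveCoeff w i j k (coeffAt (a' : ParamRing w' →+* ℂ)) := by
      funext d
      have h1 : coeffAt (a : ParamRing w →+* ℂ) d = Units.map (a' : ParamRing w' →* ℂ)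
          (coeffAt (g : ParamRing w →+* ParamRing w') d) := by
        subst ha
        rfl
      rw [h1, hcoeff]
      exact map_moveCoeff (G := (ParamRing w')ˣ) (H := ℂˣ) (w := w) (i := i) (j := j) (k := k)
        (Units.map (a' : ParamRing w' →* ℂ)) (univCoeff w') d
    have hs' := solvesBoxEquations_coeffAt (a' : ParamRing w' →+* ℂ)
    rw [hb, hmove.ratio_moveCoeff] at hC
    have h1 : ∀ d, RingHom.id ℂ (coeffAt (a : ParamRing w →+* ℂ) d) =
        moveCoeff w i j k (coeffAt (a' : ParamRing w' →+* ℂ)) d := fun d => by rw [hb]; rfl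
    -- Over a point both scalar maps are the identity, so the reverse direction needs `a'` to be
    -- recovered from `a`; this uses that `a'` satisfies the box equations.
    have h2 : ∀ d, RingHom.id ℂ (coeffAt (a' : ParamRing w' →+* ℂ) d) =
        moveCoeff w' i j k (coeffAt (a : ParamRing w →+* ℂ)) d := fun d => by
      rw [hb, hmove.moveCoeff_moveCoeff hw hw' hs']; rfl
    exact ⟨hmove.hPull_poly hw hw' hs' h1 hC.symm,
      hmove.exists_isInducedBy hw hw' (solvesBoxEquations_coeffAt _) hs' h1 h2
        (fun _ => rfl) (fun _ => rfl) hC.symm⟩
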